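/- Let $d\ge 2$ and let $V=\{e\in\mathbb Z^d:|e|_1=1\}$. Let $\mathcal P$ be the set of probability vectors on $V$, let $\mu$ be a probability measure on $\mathcal P$, and let the environment $\omega=(\omega(x))_{x\in\mathbb Z^d}\in\Omega=\mathcal P^{\mathbb Z^d}$ have law $\mathbb P=\mu^{\otimes\mathbb Z^d}$, i.e. the vectors $\omega(x)=(\omega(x,e))_{e\in V}$ are i.i.d. with law $\mu$. For fixed $\omega$ let $P_{x,\omega}$ be the law of the Markov chain $(X_n)_{n\ge0}$ on $\mathbb Z^d$ with $X_0=x$ and $P_{x,\omega}(X_{n+1}=y+e\mid X_n=y)=\omega(y,e)$, and let $P_x=\mathbb P\otimes P_{x,\omega}$ be the annealed law on $\Omega\times(\mathbb Z^d)^{\mathbb N_0}$. Put $$\epsilon=4d\,\inf\Big\{M>0:\ \big|\omega(0,e)-\tfrac1{2d}\big|\le M\ \ \mu\text{-a.s. for all }e\in V\Big\},\qquad \sigma^2=\sum_{e\in V}\mathrm{Var}_\mu(\omega(0,e)),\qquad \lambda=\mathbb E\big(\omega(0,e_1)-\omega(0,-e_1)\big),$$ where $e_1=(1,0,\dots,0)$,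 and assume that $\epsilon\in(0,1)$. For $B\subsetneq\mathbb Z^d$ connected (for the nearest-neighbour structure) and containing $0$, let $T_B=\inf\{n\ge0:X_n\notin B\}$, $g_B(0,y,\omega)=E_{0,\omega}\big(\sum_{n=0}^{T_B}\mathbf 1_{\{X_n=y\}}\big)$, and for $y\in B$ let $$\vec d_{B,0}(y)=\sum_{e\in V}\frac{\mathbb E\big(g_B(0,y,\omega)\,\omega(y,e)\big)}{\mathbb E\big(g_B(0,y,\omega)\big)}\,e .$$ If $$\lambda>4d\,\sigma^2(1+9\epsilon),$$ then Kalikow's condition holds in direction $e_1$, that is, $$\inf\big\{\vec d_{B,0}(y)\cdot e_1:\ B\subsetneq\mathbb Z^d\text{ connected},\ 0,y\in B\big\}>0 .$$ In particular, the walk is ballistic in direction $e_1$: $$\liminf_{n\to\infty}\frac{X_n\cdot e_1}{n}>0\qquad P_0\text{-a.s.}$$ -/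

import Mathlib

open MeasureTheory ProbabilityTheory Filter

namespace RWRE

/-- The sites of the lattice `ℤ^d`. -/
abbrev Site (d : ℕ) : Type := Fin d → ℤ

/-- The `ℓ¹`-norm on `ℤ^d`. -/
def l1norm {d : ℕ} (x : Site d) : ℤ := ∑ i, |x i|

/-- `V = {e ∈ ℤ^d : |e|₁ = 1}`, the `2d` canonical unit vectors `± e_i`. -/
abbrev V (d : ℕ) : Type := {e : Site d // l1norm e = 1}

instance (d : ℕ) : Finite (V d) := by
  have h : Set.Finite {e : Site d | l1norm e = 1} := by
    refine (Set.Finite.pi' (t := fun _ : Fin d => Set.Icc (-1 : ℤ) 1)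
      (fun _ => Set.finite_Icc _ _)).subset ?_
    intro e he i
    have h1 : |e i| ≤ l1norm e :=
      Finset.single_le_sum (f := fun i => |e i|) (fun j _ => abs_nonneg _) (Finset.mem_univ i)
    have h2 : |e i| ≤ 1 := h1.trans_eq he
    exact abs_le.mp h2
  exact h

noncomputable instance (d : ℕ) : Fintype (V d) := Fintype.ofFinite _

/-- `𝒫`: the probability vectors `p = (p(e))_{e ∈ V}` on `V`, with the Borel `σ`-algebra. -/
abbrev ProbVec (d : ℕ) : Type := ↥(stdSimplex ℝ (V d))

/-- `Ω = 𝒫^{ℤ^d}`: the environments, with the product (= Borel) `σ`-algebra; the weight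
`ω(x, e)` is `(ω x).1 e`. -/
abbrev Env (d : ℕ) : Type := Site d → ProbVec d

/-- Trajectories of the walk. -/
abbrev Path (d : ℕ) : Type := ℕ → Site d

/-! ### The quenched and the annealed law -/

/-- The law of one step from `y` in the environment `ω`: jump to `y + e` with
probability `ω(y, e)`. -/
noncomputable def stepLaw {d : ℕ} (ω : Env d) (y : Site d) : Measure (Site d) :=
  ∑ e : V d, ENNReal.ofReal ((ω y).1 e) • Measure.dirac (y + e.1)

instance {d : ℕ} (ω : Env d) (y : Site d) : IsProbabilityMeasure (stepLaw ω y) := by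
  constructor
  simp only [stepLaw, Measure.finsetSum_apply, Measure.smul_apply, measure_univ, smul_eq_mul,
    mul_one]
  rw [← ENNReal.ofReal_sum_of_nonneg (fun e _ => (ω y).2.1 e), (ω y).2.2, ENNReal.ofReal_one]

/-- The transition kernel at time `n`: given the trajectory up to time `n`, one step is made
from its last position. -/
noncomputable def stepKernel {d : ℕ} (ω : Env d) (n : ℕ) :
    Kernel (Π _ : Finset.Iic n, Site d) (Site d) where
  toFun p := stepLaw ω (p ⟨n, Finset.mem_Iic.2 le_rfl⟩)
  measurable' := measurable_of_countable _

instance {d : ℕ} (ω : Env d) (n : ℕ) : IsMarkovKernel (stepKernel ω n) :=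
  ⟨fun p => inferInstanceAs (IsProbabilityMeasure (stepLaw ω (p ⟨n, Finset.mem_Iic.2 le_rfl⟩)))⟩

/-- The quenched law `P_{x,ω}`: the law on trajectories of the Markov chain with `X₀ = x` and
transition probabilities `P(X_{n+1} = y + e | X_n = y) = ω(y, e)`. -/
noncomputable def quenchedLaw {d : ℕ} (x : Site d) (ω : Env d) : Measure (Path d) :=
  Kernel.traj (X := fun _ => Site d) (stepKernel ω) 0 (fun _ => x)

instance {d : ℕ} (x : Site d) (ω : Env d) : IsProbabilityMeasure (quenchedLaw x ω) :=
  inferInstanceAs (IsProbabilityMeasure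
    (Kernel.traj (X := fun _ => Site d) (stepKernel ω) 0 (fun _ => x)))

theorem measurable_stepLaw_apply {d : ℕ} (y : Site d) (A : Set (Site d)) :
    Measurable (fun ω : Env d => stepLaw ω y A) := by
  simp only [stepLaw, Measure.finsetSum_apply, Measure.smul_apply, smul_eq_mul]
  refine Finset.measurable_sum _ (fun e _ => Measurable.mul_const ?_ _)
  exact ENNReal.measurable_ofReal.comp
    ((measurable_pi_apply e).comp (measurable_subtype_coe.comp (measurable_pi_apply y)))

theorem measurable_partialTraj_apply {d : ℕ} (x : Site d) (n : ℕ)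
    (A : Set (Π _ : Finset.Iic n, Site d)) :
    Measurable (fun ω : Env d =>
      Kernel.partialTraj (X := fun _ => Site d) (stepKernel ω) 0 n (fun _ => x) A) := by
  induction n with
  | zero =>
    simp only [Kernel.partialTraj_self]
    exact measurable_const
  | succ n ih =>
    have hA : MeasurableSet A := A.to_countable.measurableSet
    have key : ∀ ω : Env d,
        Kernel.partialTraj (X := fun _ => Site d) (stepKernel ω) 0 (n + 1) (fun _ => x) A
        = ∑' p : (Π _ : Finset.Iic n, Site d),
          stepLaw ω (p ⟨n, Finset.mem_Iic.2 le_rfl⟩)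
            {z | IicProdIoc (X := fun _ => Site d) n (n + 1)
              (p, MeasurableEquiv.piSingleton (X := fun _ => Site d) n z) ∈ A} *
          Kernel.partialTraj (X := fun _ => Site d) (stepKernel ω) 0 n (fun _ => x) {p} := by
      intro ω
      have hm : Measurable (IicProdIoc (X := fun _ => Site d) n (n + 1)) := measurable_IicProdIoc
      have hpre : MeasurableSet (IicProdIoc (X := fun _ => Site d) n (n + 1) ⁻¹' A) := hm hA
      rw [Kernel.partialTraj_succ_of_le (Nat.zero_le n), Kernel.map_apply' _ hm _ hA,
        Kernel.comp_apply' _ _ _ hpre, lintegral_countable']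
      refine tsum_congr (fun p => ?_)
      congr 1
      rw [Kernel.prod_apply, Kernel.id_apply,
        Measure.dirac_prod, Measure.map_apply measurable_prodMk_left hpre,
        Kernel.map_apply' _ (MeasurableEquiv.measurable _) _ (measurable_prodMk_left hpre)]
      rfl
    simp only [key]
    exact Measurable.tsum fun p => (measurable_stepLaw_apply _ _).mul (ih _)

theorem measurable_quenchedLaw {d : ℕ} (x : Site d) :
    Measurable (quenchedLaw x : Env d → Measure (Path d)) := by
  refine Measurable.measure_of_isPiSystem_of_isProbabilityMeasure
    (generateFrom_measurableCylinders (α := fun _ : ℕ => Site d)).symm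
    isPiSystem_measurableCylinders ?_
  intro s hs
  obtain ⟨I, S, hS, rfl⟩ := (mem_measurableCylinders s).1 hs
  have hI : I ⊆ Finset.Iic (I.sup id) := fun i hi =>
    Finset.mem_Iic.2 (Finset.le_sup (f := id) hi)
  have h : ∀ ω : Env d, quenchedLaw x ω (cylinder I S)
      = Kernel.partialTraj (X := fun _ => Site d) (stepKernel ω) 0 (I.sup id) (fun _ => x)
        (Finset.restrict₂ (π := fun _ => Site d) hI ⁻¹' S) := by
    intro ω
    have hm : Measurable (Finset.restrict₂ (π := fun _ : ℕ => Site d) hI) :=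
      Finset.measurable_restrict₂ hI
    have hm' : Measurable (Preorder.frestrictLe (π := fun _ : ℕ => Site d) (I.sup id)) :=
      Preorder.measurable_frestrictLe _
    rw [← Kernel.traj_map_frestrictLe_apply, Measure.map_apply hm' (hm hS)]
    rfl
  simp only [h]
  exact measurable_partialTraj_apply _ _ _

/-- The quenched laws as a Markov kernel from environments to trajectories. -/
noncomputable def quenchedKernel {d : ℕ} (x : Site d) : Kernel (Env d) (Path d) where
  toFun := quenchedLaw x
  measurable' := measurable_quenchedLaw x

instance {d : ℕ} (x : Site d) : IsMarkovKernel (quenchedKernel x) :=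
  ⟨fun ω => inferInstanceAs (IsProbabilityMeasure (quenchedLaw x ω))⟩

/-- The environmental law `ℙ`: the `ω(x)`, `x ∈ ℤ^d`, are i.i.d. with common law `μ`, i.e. `ℙ`
is the product measure with marginals `μ`. -/
noncomputable def envLaw {d : ℕ} (μ : Measure (ProbVec d)) : Measure (Env d) :=
  Measure.infinitePi (fun _ : Site d => μ)

/-- The annealed law `P_x = ℙ ⊗ P_{x,ω}` on `Ω × (ℤ^d)^ℕ`:
`P_x(A × B) = ∫_A P_{x,ω}(B) dℙ(ω)`. -/
noncomputable def annealedLaw {d : ℕ} (μ : Measure (ProbVec d)) (x : Site d) :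
    Measure (Env d × Path d) :=
  (envLaw μ) ⊗ₘ (quenchedKernel x)

/-! ### The parameters `ε`, `λ`, `σ` of the single-site law -/

/-- The norm `inf {M > 0 : |ξ(e)| ≤ M μ-a.s. for all e ∈ V}` of a random vector `ξ`. -/
noncomputable def linftyNorm {d : ℕ} (μ : Measure (ProbVec d)) (ξ : ProbVec d → V d → ℝ) : ℝ :=
  sInf {M : ℝ | 0 < M ∧ ∀ e : V d, ∀ᵐ p ∂μ, |ξ p e| ≤ M}

/-- `ε(μ) = 4d ‖ω(0) - (1/2d, …, 1/2d)‖_{L^∞(μ)}`. -/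
noncomputable def epsilon {d : ℕ} (μ : Measure (ProbVec d)) : ℝ :=
  4 * (d : ℝ) * linftyNorm μ (fun p e => p.1 e - 1 / (2 * (d : ℝ)))

/-- `v · ℓ` for a lattice vector `v` and a direction `ℓ ∈ ℝ^d`. -/
noncomputable def dot {d : ℕ} (v : Site d) (ℓ : EuclideanSpace ℝ (Fin d)) : ℝ :=
  ∑ i, (v i : ℝ) * ℓ i

/-- `(∑_{e ∈ V} q(e) e) · ℓ`: the drift, in direction `ℓ`, of the jump weights `q`. -/
noncomputable def driftDot {d : ℕ} (q : V d → ℝ) (ℓ : EuclideanSpace ℝ (Fin d)) : ℝ :=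
  ∑ e : V d, q e * dot e.1 ℓ

/-- The direction `e₁ = (1, 0, …, 0)`. -/
noncomputable def e1 {d : ℕ} (hd : 0 < d) : EuclideanSpace ℝ (Fin d) :=
  EuclideanSpace.single (⟨0, hd⟩ : Fin d) 1

/-- `λ = 𝔼(d(0) · ℓ)`: the average local drift in direction `ℓ`. -/
noncomputable def avgDrift {d : ℕ} (μ : Measure (ProbVec d)) (ℓ : EuclideanSpace ℝ (Fin d)) : ℝ :=
  ∫ p, driftDot p.1 ℓ ∂μ

/-- `σ(μ) = √(∑_{e ∈ V} Var_μ(ω(0, e)))`. -/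
noncomputable def sigma {d : ℕ} (μ : Measure (ProbVec d)) : ℝ :=
  √(∑ e : V d, variance (fun p : ProbVec d => p.1 e) μ)

/-! ### Green's function, Kalikow's walk, Kalikow's condition -/

/-- The first exit time `T_B = inf {n ≥ 0 : X_n ∉ B}`, with `inf ∅ = ∞`. -/
noncomputable def exitTime {d : ℕ} (B : Set (Site d)) (X : Path d) : ℕ∞ :=
  ⨅ n ∈ {n : ℕ | X n ∉ B}, (n : ℕ∞)

open Classical in
/-- The Green function `g_B(x, y, ω) = E_{x,ω}(∑_{n=0}^{T_B} 1{X_n = y})` of the walk killed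
upon exiting `B`. -/
noncomputable def green {d : ℕ} (B : Set (Site d)) (x y : Site d) (ω : Env d) : ENNReal :=
  ∫⁻ X, ∑' n : ℕ, (if (n : ℕ∞) ≤ exitTime B X ∧ X n = y then 1 else 0) ∂(quenchedLaw x ω)

/-- The transition weights `ω_B^x(y, e) = 𝔼(g_B(x,y,ω) ω(y,e)) / 𝔼(g_B(x,y,ω))` of Kalikow's
walk on `B` started from `x`. -/
noncomputable def kalikowEnv {d : ℕ} (μ : Measure (ProbVec d)) (B : Set (Site d)) (x y : Site d)
    (e : V d) : ℝ :=
  ((∫⁻ ω, green B x y ω * ENNReal.ofReal ((ω y).1 e) ∂(envLaw μ)) /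
    (∫⁻ ω, green B x y ω ∂(envLaw μ))).toReal

/-- The nearest-neighbour graph on `ℤ^d`. -/
def lattice (d : ℕ) : SimpleGraph (Site d) where
  Adj x y := l1norm (x - y) = 1
  symm := ⟨fun x y h => by
    have h' : l1norm (y - x) = l1norm (x - y) :=
      Finset.sum_congr rfl fun i _ => abs_sub_comm (y i) (x i)
    rw [h', h]⟩
  loopless := ⟨fun x h => by simp [l1norm] at h⟩

/-- `ε_K(ℓ) = inf {d_{B,0}(y) · ℓ : B ⊊ ℤ^d connected with 0, y ∈ B}`. The set is nonempty and
bounded (the weights `kalikowEnv` lie in `[0, 1]`), so the real infimum is the true one. -/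
noncomputable def kalikowEps {d : ℕ} (μ : Measure (ProbVec d)) (ℓ : EuclideanSpace ℝ (Fin d)) :
    ℝ :=
  sInf {r : ℝ | ∃ (B : Set (Site d)) (y : Site d), B ≠ Set.univ ∧
    ((lattice d).induce B).Connected ∧ (0 : Site d) ∈ B ∧ y ∈ B ∧
    r = driftDot (kalikowEnv μ B 0 y) ℓ}

/-- Kalikow's condition in direction `ℓ`. -/
def KalikowCondition {d : ℕ} (μ : Measure (ProbVec d)) (ℓ : EuclideanSpace ℝ (Fin d)) : Prop :=
  0 < kalikowEps μ ℓ

/-- Ballisticity in direction `ℓ`: `liminf_n (X_n · ℓ) / n > 0`, `P_0`-almost surely. -/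
def Ballistic {d : ℕ} (μ : Measure (ProbVec d)) (ℓ : EuclideanSpace ℝ (Fin d)) : Prop :=
  ∀ᵐ z ∂(annealedLaw μ 0),
    (0 : EReal) < liminf (fun n : ℕ => ((dot (z.2 n) ℓ / (n : ℝ) : ℝ) : EReal)) atTop

end RWRE

/-! Kalikow's condition. The Green function g_B(x,y,ω) is the probability of hitting y divided by
the probability of escaping from y (`green_eq_hitProb_div`). Hitting probabilities of y involve no
step made from y, so given the environment off y, the vector p = ω(y) enters only through the escape
probability ∑ p(e)u(e), a linear form with weights u ≥ 0. Kalikow's drift is therefore at least κ =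
λ - 4dσ²(1+9ε), called `driftBound`, once ∫ (drift(p) - κ) / ∑ p(e)u(e) dμ ≥ 0 for all u ≥ 0
(`integral_drift_div_nonneg`). Expanding the inverse of the linear form around its mean, the
first-order term integrates to 0, the correlation of drift and denominator costs a multiple of σ²,
and λ - κ pays for it.

Ballisticity. The same inequality, E[g_B(0,y)(drift(y) - κ)] ≥ 0, is inserted into Dynkin's formula
for the walk stopped on leaving a finite set (`kalikow_comparison`). For suitable test functions the
annealed walk then behaves as if its local drift were at least κ everywhere. The first coordinate
yields an expected passage time of level M of at most M/κ; the function -exp(-θx₁) yields a positive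
probability of never going below the start.

The annealed walk is not Markov, but up to the first passage of a level it has stepped only from
sites below that level, while a future that never backtracks steps only from the others; i.i.d.
environments make the two independent (`pathLaw_inter_shift_rise`). A pathwise count of levels
(`card_levels_le`), averaged with the bound on passage times, shows that for small c the walk rises
forever at speed c with positive probability. As a fresh independent attempt is available at
arbitrarily late times, some attempt succeeds almost surely (`ae_exists_shift_riseForever`). -/

namespace RWRE

/-! ### Cylinders and the Markov property of the quenched walk -/

open scoped ENNReal

/-- The trajectories that agree with `γ` up to time `n`. -/
def cyl {d : ℕ} (γ : Path d) (n : ℕ) : Set (Path d) := {X | ∀ k ≤ n, X k = γ k}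

/-- The trajectory seen from time `m` on. -/
def shift {d : ℕ} (m : ℕ) (X : Path d) : Path d := fun k => X (m + k)

theorem measurable_shift {d : ℕ} (m : ℕ) : Measurable (shift m : Path d → Path d) :=
  measurable_pi_lambda _ fun _ => measurable_pi_apply _

theorem measurableSet_coord {d : ℕ} (n : ℕ) (s : Set (Site d)) :
    MeasurableSet {X : Path d | X n ∈ s} :=
  measurable_pi_apply n s.to_countable.measurableSet

theorem measurableSet_cyl {d : ℕ} (γ : Path d) (n : ℕ) : MeasurableSet (cyl γ n) := by
  have : cyl γ n = ⋂ k, ⋂ (_ : k ≤ n), {X : Path d | X k ∈ ({γ k} : Set (Site d))} := by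
    ext X; simp [cyl]
  rw [this]
  exact MeasurableSet.iInter fun k => MeasurableSet.iInter fun _ => measurableSet_coord k _

theorem quenchedLaw_preimage_frestrictLe {d : ℕ} (x : Site d) (ω : Env d) (n : ℕ)
    (A : Set (Π _ : Finset.Iic n, Site d)) :
    quenchedLaw x ω (Preorder.frestrictLe (π := fun _ => Site d) n ⁻¹' A) =
      Kernel.partialTraj (X := fun _ => Site d) (stepKernel ω) 0 n (fun _ => x) A := by
  rw [← Kernel.traj_map_frestrictLe_apply,
    Measure.map_apply (Preorder.measurable_frestrictLe _) A.to_countable.measurableSet]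
  rfl

theorem cyl_eq_preimage {d : ℕ} (γ : Path d) (n : ℕ) :
    cyl γ n = Preorder.frestrictLe (π := fun _ => Site d) n ⁻¹'
      {Preorder.frestrictLe (π := fun _ => Site d) n γ} := by
  ext X
  simp only [cyl, Set.mem_ofPred_eq, Set.mem_preimage, Set.mem_singleton_iff, funext_iff,
    Subtype.forall, Finset.mem_Iic]
  rfl

theorem partialTraj_succ_singleton {d : ℕ} (x : Site d) (ω : Env d) (γ : Path d) (n : ℕ) :
    Kernel.partialTraj (X := fun _ => Site d) (stepKernel ω) 0 (n + 1) (fun _ => x)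
        {Preorder.frestrictLe (π := fun _ => Site d) (n + 1) γ} =
      Kernel.partialTraj (X := fun _ => Site d) (stepKernel ω) 0 n (fun _ => x)
        {Preorder.frestrictLe (π := fun _ => Site d) n γ} * stepLaw ω (γ n) {γ (n + 1)} := by
  set A : Set (Π _ : Finset.Iic (n + 1), Site d) :=
    {Preorder.frestrictLe (π := fun _ => Site d) (n + 1) γ} with hAdef
  have hA : MeasurableSet A := A.to_countable.measurableSet
  have hm : Measurable (IicProdIoc (X := fun _ => Site d) n (n + 1)) := measurable_IicProdIoc
  have hpre : MeasurableSet (IicProdIoc (X := fun _ => Site d) n (n + 1) ⁻¹' A) := hm hA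
  have hmem : ∀ (p : Π _ : Finset.Iic n, Site d) (z : Site d),
      IicProdIoc (X := fun _ => Site d) n (n + 1)
        (p, MeasurableEquiv.piSingleton (X := fun _ => Site d) n z) ∈ A ↔
      p = Preorder.frestrictLe (π := fun _ => Site d) n γ ∧ z = γ (n + 1) := by
    intro p z
    simp only [hAdef, Set.mem_singleton_iff, funext_iff, Subtype.forall, Finset.mem_Iic,
      IicProdIoc, Preorder.frestrictLe_apply]
    constructor
    · intro h
      refine ⟨fun k hk => ?_, ?_⟩
      · have := h k (hk.trans n.le_succ)
        rwa [dif_pos hk] at this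
      · have := h (n + 1) le_rfl
        rwa [dif_neg (by omega)] at this
    · rintro ⟨h1, h2⟩ k hk
      split_ifs with h
      · exact h1 k h
      · have : k = n + 1 := by omega
        subst this
        exact h2
  rw [Kernel.partialTraj_succ_of_le (Nat.zero_le n), Kernel.map_apply' _ hm _ hA,
    Kernel.comp_apply' _ _ _ hpre, lintegral_countable',
    tsum_eq_single (Preorder.frestrictLe (π := fun _ => Site d) n γ)]
  · rw [mul_comm]
    congr 1
    rw [Kernel.prod_apply, Kernel.id_apply,
      Measure.dirac_prod, Measure.map_apply measurable_prodMk_left hpre,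
      Kernel.map_apply' _ (MeasurableEquiv.measurable _) _ (measurable_prodMk_left hpre)]
    change stepLaw ω (γ n) {z | IicProdIoc (X := fun _ => Site d) n (n + 1)
        (_, MeasurableEquiv.piSingleton (X := fun _ => Site d) n z) ∈ A} = _
    congr 1
    ext z
    rw [Set.mem_ofPred_eq, hmem]
    simp
  · intro p hp
    rw [Kernel.prod_apply, Kernel.id_apply,
      Measure.dirac_prod, Measure.map_apply measurable_prodMk_left hpre,
      Kernel.map_apply' _ (MeasurableEquiv.measurable _) _ (measurable_prodMk_left hpre)]
    change stepLaw ω _ {z | IicProdIoc (X := fun _ => Site d) n (n + 1)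
        (p, MeasurableEquiv.piSingleton (X := fun _ => Site d) n z) ∈ A} * _ = 0
    have : {z | IicProdIoc (X := fun _ => Site d) n (n + 1)
        (p, MeasurableEquiv.piSingleton (X := fun _ => Site d) n z) ∈ A} = ∅ := by
      ext z
      rw [Set.mem_ofPred_eq, hmem]
      simp [hp]
    rw [this, measure_empty, zero_mul]

open Classical in
theorem quenchedLaw_cyl {d : ℕ} (x : Site d) (ω : Env d) (γ : Path d) (n : ℕ) :
    quenchedLaw x ω (cyl γ n) =
      (if γ 0 = x then 1 else 0) * ∏ k ∈ Finset.range n, stepLaw ω (γ k) {γ (k + 1)} := by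
  rw [cyl_eq_preimage, quenchedLaw_preimage_frestrictLe]
  induction n with
  | zero =>
    rw [Kernel.partialTraj_self, Kernel.id_apply,
      Measure.dirac_apply' _ (Set.to_countable _).measurableSet, Set.indicator_apply]
    simp only [Set.mem_singleton_iff, Pi.one_apply, Finset.range_zero, Finset.prod_empty, mul_one,
      funext_iff, Subtype.forall, Finset.mem_Iic, Preorder.frestrictLe_apply, Nat.le_zero,
      forall_eq, eq_comm]
  | succ n ih => rw [partialTraj_succ_singleton, ih, Finset.prod_range_succ, mul_assoc]

/-- A measure of a set of trajectories is the sum over its intersections with the cylinders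
of a given length. -/
theorem measure_eq_tsum_cyl {d : ℕ} (ν : Measure (Path d)) (n : ℕ) {A : Set (Path d)}
    (hA : MeasurableSet A) :
    ν A = ∑' g : (Π _ : Finset.Iic n, Site d),
      ν (cyl (fun k => if h : k ∈ Finset.Iic n then g ⟨k, h⟩ else 0) n ∩ A) := by
  have h : ∀ g : (Π _ : Finset.Iic n, Site d),
      cyl (fun k => if h : k ∈ Finset.Iic n then g ⟨k, h⟩ else 0) n =
        Preorder.frestrictLe (π := fun _ => Site d) n ⁻¹' {g} := by
    intro g
    rw [cyl_eq_preimage]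
    congr 2
    ext k : 1
    simp [Preorder.frestrictLe_apply, Finset.mem_Iic.1 k.2]
  simp only [h]
  have hm : ∀ g : (Π _ : Finset.Iic n, Site d),
      MeasurableSet (Preorder.frestrictLe (π := fun _ => Site d) n ⁻¹' {g}) := fun g =>
    Preorder.measurable_frestrictLe (X := fun _ => Site d) n (Set.to_countable _).measurableSet
  rw [← measure_iUnion]
  · congr 1
    ext X
    simp
  · intro g g' hg
    refine Disjoint.mono Set.inter_subset_left Set.inter_subset_left ?_
    exact Disjoint.preimage _ (Set.disjoint_singleton.2 hg)
  · exact fun g => (hm g).inter hA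

/-- Sites are countable, so the cylinders of a fixed length form a countable partition; on a
cylinder the quenched law is an explicit finite product. -/
theorem measure_congr_cyl {d : ℕ} {ν ν' : Measure (Path d)} (n : ℕ) {A A' : Set (Path d)}
    (hA : MeasurableSet A) (hA' : MeasurableSet A')
    (h : ∀ γ : Path d, ν (cyl γ n ∩ A) = ν' (cyl γ n ∩ A')) : ν A = ν' A' := by
  rw [measure_eq_tsum_cyl ν n hA, measure_eq_tsum_cyl ν' n hA']
  exact tsum_congr fun g => h _

/-- Two finite measures that agree on all cylinders are equal. -/
theorem measure_ext_cyl {d : ℕ} {ν ν' : Measure (Path d)} [IsFiniteMeasure ν]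
    (h : ∀ (γ : Path d) (n : ℕ), ν (cyl γ n) = ν' (cyl γ n)) : ν = ν' := by
  have huniv : ν Set.univ = ν' Set.univ :=
    measure_congr_cyl 0 MeasurableSet.univ MeasurableSet.univ fun γ => by simpa using h γ 0
  refine ext_of_generate_finite (insert ∅ {s | ∃ (γ : Path d) (n : ℕ), s = cyl γ n}) ?_ ?_ ?_ huniv
  · refine le_antisymm ?_ (MeasurableSpace.generateFrom_le ?_)
    · refine iSup_le fun n => ?_
      rintro _ ⟨s, -, rfl⟩
      have : (fun X : Path d => X n) ⁻¹' s = ⋃ (g : (Π _ : Finset.Iic n, Site d))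
          (_ : g ⟨n, Finset.mem_Iic.2 le_rfl⟩ ∈ s),
          cyl (fun k => if h : k ∈ Finset.Iic n then g ⟨k, h⟩ else 0) n := by
        ext X
        simp only [Set.mem_preimage, Set.mem_iUnion, cyl, Set.mem_ofPred_eq, exists_prop]
        constructor
        · intro hX
          refine ⟨fun k => X k, hX, fun k hk => ?_⟩
          rw [dif_pos (Finset.mem_Iic.2 hk)]
        · rintro ⟨g, hg, hX⟩
          rw [hX n le_rfl, dif_pos (Finset.mem_Iic.2 le_rfl)]
          exact hg
      rw [this]
      refine @MeasurableSet.iUnion _ _ (MeasurableSpace.generateFrom _) _ _ fun g => ?_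
      refine @MeasurableSet.iUnion _ _ (MeasurableSpace.generateFrom _) _ _ fun hg => ?_
      exact MeasurableSpace.measurableSet_generateFrom (Or.inr ⟨_, _, rfl⟩)
    · rintro s (rfl | ⟨γ, n, rfl⟩)
      · exact MeasurableSet.empty
      · exact measurableSet_cyl γ n
  -- Two cylinders that meet are nested, which makes the cylinders a π-system.
  · have key : ∀ (γ γ' : Path d) (m n : ℕ), m ≤ n → (cyl γ m ∩ cyl γ' n).Nonempty →
        cyl γ m ∩ cyl γ' n = cyl γ' n := by
      rintro γ γ' m n hmn ⟨X, hX, hX'⟩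
      refine Set.inter_eq_right.2 fun Z hZ k hk => ?_
      rw [hZ k (hk.trans hmn), ← hX' k (hk.trans hmn), hX k hk]
    rintro s (rfl | ⟨γ, m, rfl⟩) t (rfl | ⟨γ', n, rfl⟩) hst
    · simp at hst
    · simp at hst
    · simp at hst
    · rcases le_total m n with hmn | hmn
      · rw [key γ γ' m n hmn hst]
        exact Or.inr ⟨_, _, rfl⟩
      · rw [Set.inter_comm] at hst ⊢
        rw [key γ' γ n m hmn hst]
        exact Or.inr ⟨_, _, rfl⟩
  · rintro s (rfl | ⟨γ, n, rfl⟩)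
    · simp
    · exact h γ n

/-- The Markov property of the quenched walk. -/
theorem quenchedLaw_cyl_inter_shift {d : ℕ} (x : Site d) (ω : Env d) (γ : Path d) (m : ℕ)
    {S : Set (Path d)} (hS : MeasurableSet S) :
    quenchedLaw x ω (cyl γ m ∩ shift m ⁻¹' S) =
      quenchedLaw x ω (cyl γ m) * quenchedLaw (γ m) ω S := by
  classical
  have : Measure.map (shift m) ((quenchedLaw x ω).restrict (cyl γ m)) =
      quenchedLaw x ω (cyl γ m) • quenchedLaw (γ m) ω := by
    refine measure_ext_cyl fun γ' n => ?_
    rw [Measure.map_apply (measurable_shift m) (measurableSet_cyl γ' n),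
      Measure.restrict_apply (measurable_shift m (measurableSet_cyl γ' n)), Measure.smul_apply,
      smul_eq_mul, quenchedLaw_cyl (γ m)]
    by_cases h : γ' 0 = γ m
    -- Gluing γ up to time m with γ' afterwards turns the intersection into one longer cylinder,
    -- whose product of weights splits at m. If γ' does not start at γ m, both sides vanish.
    · set ρ : Path d := fun k => if k ≤ m then γ k else γ' (k - m) with hρ
      have hρ' : ∀ k, ρ (m + k) = γ' k := by
        intro k
        rcases Nat.eq_zero_or_pos k with rfl | hk
        · simp [hρ, h]
        · simp only [hρ]
          rw [if_neg (by omega), Nat.add_sub_cancel_left]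
      have hset : shift m ⁻¹' cyl γ' n ∩ cyl γ m = cyl ρ (m + n) := by
        ext X
        constructor
        · rintro ⟨h1, h2⟩ k hk
          by_cases hkm : k ≤ m
          · rw [h2 k hkm]; simp [hρ, hkm]
          · have := h1 (k - m) (by omega)
            obtain ⟨j, rfl⟩ := Nat.exists_eq_add_of_le (Nat.le_of_not_ge hkm)
            rw [Nat.add_sub_cancel_left] at this
            rw [hρ']
            exact this
        · intro hX
          refine ⟨fun k hk => ?_, fun k hk => ?_⟩
          · rw [← hρ']; exact hX (m + k) (by omega)
          · rw [hX k (by omega)]; simp [hρ, hk]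
      have h0 : ρ 0 = γ 0 := by simp [hρ]
      have h1 : ∏ k ∈ Finset.range m, stepLaw ω (ρ k) {ρ (k + 1)} =
          ∏ k ∈ Finset.range m, stepLaw ω (γ k) {γ (k + 1)} := by
        refine Finset.prod_congr rfl fun k hk => ?_
        have hk := Finset.mem_range.1 hk
        simp only [hρ]
        rw [if_pos (by omega), if_pos (by omega)]
      have h2 : ∏ k ∈ Finset.range n, stepLaw ω (ρ (m + k)) {ρ (m + k + 1)} =
          ∏ k ∈ Finset.range n, stepLaw ω (γ' k) {γ' (k + 1)} := by
        refine Finset.prod_congr rfl fun k hk => ?_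
        rw [hρ', add_assoc, hρ']
      rw [hset, quenchedLaw_cyl, quenchedLaw_cyl, Finset.prod_range_add, if_pos h, one_mul,
        h0, h1, h2, mul_assoc]
    · have : shift m ⁻¹' cyl γ' n ∩ cyl γ m = ∅ := by
        ext X
        simp only [Set.mem_inter_iff, Set.mem_empty_iff_false, iff_false, not_and]
        intro h1 h2
        exact h ((h1 0 (Nat.zero_le _)).symm.trans (h2 m le_rfl))
      rw [this, if_neg h]
      simp
  have h2 := congrArg (fun ν => ν S) this
  simp only [Measure.smul_apply, smul_eq_mul] at h2
  rw [Measure.map_apply (measurable_shift m) hS,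
    Measure.restrict_apply (measurable_shift m hS), Set.inter_comm] at h2
  exact h2

theorem quenchedLaw_start {d : ℕ} (x : Site d) (ω : Env d) :
    ∀ᵐ X ∂(quenchedLaw x ω), X 0 = x := by
  have h : quenchedLaw x ω (cyl (fun _ => x) 0) = 1 := by
    rw [quenchedLaw_cyl]; simp
  have h' : cyl (fun _ => x) 0 = {X : Path d | X 0 = x} := by ext X; simp [cyl]
  rw [h'] at h
  exact (prob_compl_eq_zero_iff (h' ▸ measurableSet_cyl _ _)).2 h

theorem lintegral_stepLaw {d : ℕ} (ω : Env d) (x : Site d) (f : Site d → ℝ≥0∞) :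
    ∫⁻ z, f z ∂(stepLaw ω x) = ∑ e : V d, ENNReal.ofReal ((ω x).1 e) * f (x + e.1) := by
  simp [stepLaw, lintegral_finsetSum_measure]

/-- The decomposition of the quenched walk at its first step. -/
theorem quenchedLaw_shift_one {d : ℕ} (x : Site d) (ω : Env d) {S : Set (Path d)}
    (hS : MeasurableSet S) :
    quenchedLaw x ω (shift 1 ⁻¹' S) =
      ∑ e : V d, ENNReal.ofReal ((ω x).1 e) * quenchedLaw (x + e.1) ω S := by
  have hpt : ∀ z : Site d, quenchedLaw x ω ({X | X 1 = z} ∩ shift 1 ⁻¹' S) =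
      quenchedLaw z ω S * stepLaw ω x {z} := by
    intro z
    have hae : quenchedLaw x ω ({X | X 1 = z} ∩ shift 1 ⁻¹' S) =
        quenchedLaw x ω (cyl (fun k => if k = 0 then x else z) 1 ∩ shift 1 ⁻¹' S) := by
      refine measure_congr ?_
      filter_upwards [quenchedLaw_start x ω] with X hX
      refine propext (and_congr_left fun _ => ⟨fun h => ?_, fun h => ?_⟩)
      · have h : X 1 = z := h
        intro k hk
        interval_cases k <;> simp [hX, h]
      · simpa using h 1 le_rfl
    rw [hae, quenchedLaw_cyl_inter_shift _ _ _ _ hS, quenchedLaw_cyl]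
    simp [mul_comm]
  rw [← lintegral_stepLaw ω x (fun z => quenchedLaw z ω S), lintegral_countable']
  simp only [← hpt]
  rw [← measure_iUnion]
  · congr 1
    ext X
    simp
  · intro a b hab
    refine Disjoint.mono Set.inter_subset_left Set.inter_subset_left ?_
    rw [Set.disjoint_left]
    rintro X h1 h2
    exact hab (h1.symm.trans h2)
  · intro z
    exact (measurableSet_coord 1 {z}).inter (measurable_shift 1 hS)

/-! ### The Green function of the killed walk -/

/-- The trajectories that are at `y` at time `n`, having stayed in `B` before. -/
def surv {d : ℕ} (B : Set (Site d)) (y : Site d) (n : ℕ) : Set (Path d) :=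
  {X | (∀ k < n, X k ∈ B) ∧ X n = y}

theorem measurableSet_forall_lt {d : ℕ} (B : Set (Site d)) (n : ℕ) :
    MeasurableSet {X : Path d | ∀ k < n, X k ∈ B} := by
  have : {X : Path d | ∀ k < n, X k ∈ B} = ⋂ k, ⋂ (_ : k < n), {X : Path d | X k ∈ B} := by
    ext X; simp
  rw [this]
  exact MeasurableSet.iInter fun k => MeasurableSet.iInter fun _ => measurableSet_coord k B

theorem measurableSet_surv {d : ℕ} (B : Set (Site d)) (y : Site d) (n : ℕ) :
    MeasurableSet (surv B y n) :=
  (measurableSet_forall_lt B n).inter (measurableSet_coord n {y})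

theorem measurable_quenchedLaw_apply {d : ℕ} (x : Site d) {S : Set (Path d)}
    (hS : MeasurableSet S) : Measurable fun ω : Env d => quenchedLaw x ω S :=
  (Measure.measurable_coe hS).comp (measurable_quenchedLaw x)

open Classical in
theorem quenchedLaw_surv_zero {d : ℕ} (B : Set (Site d)) (x y : Site d) (ω : Env d) :
    quenchedLaw x ω (surv B y 0) = if x = y then 1 else 0 := by
  split_ifs with h
  · refine (prob_compl_eq_zero_iff (measurableSet_surv B y 0)).1 ?_
    refine measure_eq_zero_iff_ae_notMem.2 ?_
    filter_upwards [quenchedLaw_start x ω] with X hX hX'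
    exact hX' ⟨fun k hk => absurd hk (Nat.not_lt_zero k), hX.trans h⟩
  · have : ∀ᵐ X ∂(quenchedLaw x ω), X ∉ surv B y 0 := by
      filter_upwards [quenchedLaw_start x ω] with X hX hX'
      exact h (hX.symm.trans hX'.2)
    exact measure_eq_zero_iff_ae_notMem.2 this

theorem quenchedLaw_surv_succ {d : ℕ} {B : Set (Site d)} {x : Site d} (hx : x ∈ B) (y : Site d)
    (n : ℕ) (ω : Env d) :
    quenchedLaw x ω (surv B y (n + 1)) =
      ∑ e : V d, ENNReal.ofReal ((ω x).1 e) * quenchedLaw (x + e.1) ω (surv B y n) := by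
  rw [← quenchedLaw_shift_one x ω (measurableSet_surv B y n)]
  refine measure_congr ?_
  filter_upwards [quenchedLaw_start x ω] with X hX
  refine propext ⟨fun h => ⟨fun k hk => ?_, ?_⟩, fun h => ⟨fun k hk => ?_, ?_⟩⟩
  · exact h.1 (1 + k) (by omega)
  · have := h.2
    rwa [add_comm n 1] at this
  · rcases k with _ | k
    · rwa [hX]
    · have := h.1 k (by omega)
      rwa [shift, add_comm 1 k] at this
  · have := h.2
    rwa [shift, add_comm 1 n] at this

theorem quenchedLaw_surv_succ_of_notMem {d : ℕ} {B : Set (Site d)} {x : Site d} (hx : x ∉ B)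
    (y : Site d) (n : ℕ) (ω : Env d) : quenchedLaw x ω (surv B y (n + 1)) = 0 := by
  have : ∀ᵐ X ∂(quenchedLaw x ω), X ∉ surv B y (n + 1) := by
    filter_upwards [quenchedLaw_start x ω] with X hX hX'
    exact hx (hX ▸ hX'.1 0 (Nat.succ_pos n))
  exact measure_eq_zero_iff_ae_notMem.2 this

theorem le_exitTime_iff {d : ℕ} (B : Set (Site d)) (X : Path d) (n : ℕ) :
    (n : ℕ∞) ≤ exitTime B X ↔ ∀ k < n, X k ∈ B := by
  simp only [exitTime, le_iInf_iff, Set.mem_ofPred_eq, Nat.cast_le]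
  exact ⟨fun h k hk => by_contra fun hB => absurd (h k hB) (by omega),
    fun h k hB => by_contra fun hk => hB (h k (by omega))⟩

/-- The Green function counts visits up to and including the exit time, and n ≤ T_B constrains only
the times before n; this is the event `surv`, which also allows y outside B. -/
theorem green_eq_tsum {d : ℕ} (B : Set (Site d)) (x y : Site d) (ω : Env d) :
    green B x y ω = ∑' n, quenchedLaw x ω (surv B y n) := by
  classical
  have h : ∀ n, quenchedLaw x ω (surv B y n) =
      ∫⁻ X, (surv B y n).indicator 1 X ∂(quenchedLaw x ω) := fun n =>
    (lintegral_indicator_one (measurableSet_surv B y n)).symm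
  simp only [h]
  rw [← lintegral_tsum fun n => (measurable_one.indicator (measurableSet_surv B y n)).aemeasurable]
  refine lintegral_congr fun X => tsum_congr fun n => ?_
  simp only [Set.indicator_apply, surv, Set.mem_ofPred_eq, le_exitTime_iff, Pi.one_apply]

theorem measurable_green {d : ℕ} (B : Set (Site d)) (x y : Site d) :
    Measurable (green B x y) := by
  have : green B x y = fun ω => ∑' n, quenchedLaw x ω (surv B y n) :=
    funext (green_eq_tsum B x y)
  rw [this]
  exact Measurable.tsum fun n => measurable_quenchedLaw_apply x (measurableSet_surv B y n)

open Classical in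
theorem green_eq {d : ℕ} {B : Set (Site d)} {x : Site d} (hx : x ∈ B) (y : Site d) (ω : Env d) :
    green B x y ω = (if x = y then 1 else 0) +
      ∑ e : V d, ENNReal.ofReal ((ω x).1 e) * green B (x + e.1) y ω := by
  simp only [green_eq_tsum]
  rw [tsum_eq_zero_add' ENNReal.summable, quenchedLaw_surv_zero]
  simp only [quenchedLaw_surv_succ hx, ← ENNReal.tsum_mul_left]
  rw [Summable.tsum_finsetSum fun _ _ => ENNReal.summable]

open Classical in
theorem green_eq_of_notMem {d : ℕ} {B : Set (Site d)} {x : Site d} (hx : x ∉ B) (y : Site d)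
    (ω : Env d) : green B x y ω = if x = y then 1 else 0 := by
  rw [green_eq_tsum, tsum_eq_zero_add' ENNReal.summable, quenchedLaw_surv_zero]
  simp [quenchedLaw_surv_succ_of_notMem hx]

-- The equation of `green_eq` does not determine a function that might be infinite. Upper bounds are
-- instead proved for the sums up to a finite horizon, by induction on the horizon.
open Classical in
theorem sum_surv_succ {d : ℕ} {B : Set (Site d)} {x : Site d} (hx : x ∈ B) (y : Site d)
    (ω : Env d) (N : ℕ) :
    ∑ n ∈ Finset.range (N + 1), quenchedLaw x ω (surv B y n) = (if x = y then 1 else 0) +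
      ∑ e : V d, ENNReal.ofReal ((ω x).1 e) *
        ∑ n ∈ Finset.range N, quenchedLaw (x + e.1) ω (surv B y n) := by
  rw [Finset.sum_range_succ', quenchedLaw_surv_zero, add_comm]
  simp only [quenchedLaw_surv_succ hx, Finset.mul_sum]
  rw [Finset.sum_comm]

open Classical in
theorem sum_surv_succ_of_notMem {d : ℕ} {B : Set (Site d)} {x : Site d} (hx : x ∉ B)
    (y : Site d) (ω : Env d) (N : ℕ) :
    ∑ n ∈ Finset.range (N + 1), quenchedLaw x ω (surv B y n) = if x = y then 1 else 0 := by
  rw [Finset.sum_range_succ', quenchedLaw_surv_zero]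
  simp [quenchedLaw_surv_succ_of_notMem hx]

theorem green_le_of_sum_le {d : ℕ} {B : Set (Site d)} {x y : Site d} {ω : Env d} {c : ℝ≥0∞}
    (h : ∀ N, ∑ n ∈ Finset.range N, quenchedLaw x ω (surv B y n) ≤ c) : green B x y ω ≤ c := by
  rw [green_eq_tsum, ENNReal.tsum_eq_iSup_nat]
  exact iSup_le h

theorem sum_ofReal_env {d : ℕ} (ω : Env d) (x : Site d) :
    ∑ e : V d, ENNReal.ofReal ((ω x).1 e) = 1 := by
  rw [← ENNReal.ofReal_sum_of_nonneg (fun e _ => (ω x).2.1 e), (ω x).2.2, ENNReal.ofReal_one]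

/-- A visit to y outside B ends the walk, so at most one visit is counted and the Green function is
a hitting probability. -/
theorem green_le_one {d : ℕ} {B : Set (Site d)} {y : Site d} (hy : y ∉ B) (x : Site d)
    (ω : Env d) : green B x y ω ≤ 1 := by
  classical
  refine green_le_of_sum_le fun N => ?_
  induction N generalizing x with
  | zero => simp
  | succ N ih =>
    by_cases hx : x ∈ B
    · rw [sum_surv_succ hx, if_neg (fun h : x = y => hy (h ▸ hx)), zero_add]
      calc _ ≤ ∑ e : V d, ENNReal.ofReal ((ω x).1 e) * 1 :=
            Finset.sum_le_sum fun e _ => mul_le_mul_right (ih _) _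
        _ = 1 := by simp only [mul_one, sum_ofReal_env]
    · rw [sum_surv_succ_of_notMem hx]
      split_ifs <;> simp

theorem quenchedLaw_surv_congr {d : ℕ} {B : Set (Site d)} {ω ω' : Env d}
    (h : ∀ x ∈ B, ω x = ω' x) (x y : Site d) (n : ℕ) :
    quenchedLaw x ω (surv B y n) = quenchedLaw x ω' (surv B y n) := by
  classical
  induction n generalizing x with
  | zero => rw [quenchedLaw_surv_zero, quenchedLaw_surv_zero]
  | succ n ih =>
    by_cases hx : x ∈ B
    · rw [quenchedLaw_surv_succ hx, quenchedLaw_surv_succ hx, h x hx]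
      simp only [ih]
    · rw [quenchedLaw_surv_succ_of_notMem hx, quenchedLaw_surv_succ_of_notMem hx]

theorem green_congr {d : ℕ} {B : Set (Site d)} {ω ω' : Env d} (h : ∀ x ∈ B, ω x = ω' x)
    (x y : Site d) : green B x y ω = green B x y ω' := by
  simp only [green_eq_tsum, quenchedLaw_surv_congr h]

/-! ### Hitting and escape probabilities -/

/-- The quenched probability, starting from `x`, of visiting `y` no later than leaving `B`. -/
noncomputable def hitProb {d : ℕ} (B : Set (Site d)) (x y : Site d) (ω : Env d) : ℝ :=
  (green (B \ {y}) x y ω).toReal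

theorem hitProb_nonneg {d : ℕ} (B : Set (Site d)) (x y : Site d) (ω : Env d) :
    0 ≤ hitProb B x y ω := ENNReal.toReal_nonneg

theorem hitProb_le_one {d : ℕ} (B : Set (Site d)) (x y : Site d) (ω : Env d) :
    hitProb B x y ω ≤ 1 := by
  have := green_le_one (B := B \ {y}) (y := y) (by simp) x ω
  exact ENNReal.toReal_le_of_le_ofReal zero_le_one (by simpa using this)

theorem ofReal_hitProb {d : ℕ} (B : Set (Site d)) (x y : Site d) (ω : Env d) :
    ENNReal.ofReal (hitProb B x y ω) = green (B \ {y}) x y ω :=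
  ENNReal.ofReal_toReal
    (ne_top_of_le_ne_top ENNReal.one_ne_top (green_le_one (by simp) x ω))

theorem measurable_hitProb {d : ℕ} (B : Set (Site d)) (x y : Site d) :
    Measurable (hitProb B x y) := (measurable_green _ x y).ennreal_toReal

/-- This is the purpose of removing y from B: the walk killed at y never steps from y, so ω(y) plays
no role. -/
theorem hitProb_congr {d : ℕ} (B : Set (Site d)) (x : Site d) {y : Site d} {ω ω' : Env d}
    (h : ∀ z, z ≠ y → ω z = ω' z) : hitProb B x y ω = hitProb B x y ω' :=
  congrArg ENNReal.toReal (green_congr (fun z hz => h z hz.2) x y)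

theorem hitProb_of_notMem {d : ℕ} {B : Set (Site d)} {x y : Site d} (hx : x ∉ B) (hxy : x ≠ y)
    (ω : Env d) : hitProb B x y ω = 0 := by
  rw [hitProb, green_eq_of_notMem (fun h => hx h.1), if_neg hxy, ENNReal.toReal_zero]

theorem hitProb_eq {d : ℕ} {B : Set (Site d)} {x y : Site d} (hx : x ∈ B) (hxy : x ≠ y)
    (ω : Env d) : hitProb B x y ω = ∑ e : V d, (ω x).1 e * hitProb B (x + e.1) y ω := by
  rw [hitProb, green_eq (B := B \ {y}) ⟨hx, hxy⟩, if_neg hxy, zero_add, ENNReal.toReal_sum]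
  · refine Finset.sum_congr rfl fun e _ => ?_
    rw [ENNReal.toReal_mul, ENNReal.toReal_ofReal ((ω x).2.1 e), hitProb]
  · exact fun e _ => ENNReal.mul_ne_top ENNReal.ofReal_ne_top
      (ne_top_of_le_ne_top ENNReal.one_ne_top (green_le_one (by simp) _ ω))

/-- The quenched probability, starting from `y`, of leaving `B` before returning to `y`. -/
noncomputable def escapeProb {d : ℕ} (B : Set (Site d)) (y : Site d) (ω : Env d) : ℝ :=
  ∑ e : V d, (ω y).1 e * (1 - hitProb B (y + e.1) y ω)

theorem exists_unit_step {d : ℕ} {v : Site d} {j : ℕ} (hv : l1norm v = j + 1) :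
    ∃ e : V d, l1norm (v + e.1) = j := by
  obtain ⟨i, hi⟩ : ∃ i, v i ≠ 0 := by
    by_contra! h
    have : l1norm v = 0 := by simp [l1norm, h]
    omega
  have hs : |(Int.sign (v i))| = 1 := by
    rcases lt_or_gt_of_ne hi with h | h
    · rw [Int.sign_eq_neg_one_of_neg h]; rfl
    · rw [Int.sign_eq_one_of_pos h]; rfl
  have he : l1norm (Pi.single i (-Int.sign (v i)) : Site d) = 1 := by
    rw [l1norm, Finset.sum_eq_single i]
    · rw [Pi.single_eq_same, abs_neg, hs]
    · intro k _ hk; simp [hk]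
    · simp
  refine ⟨⟨_, he⟩, ?_⟩
  have hsplit : ∀ w : Site d, l1norm w = |w i| + ∑ k ∈ Finset.univ.erase i, |w k| := fun w =>
    (Finset.add_sum_erase _ (fun k => |w k|) (Finset.mem_univ i)).symm
  rw [hsplit] at hv ⊢
  have h1 : ∑ k ∈ Finset.univ.erase i, |(v + Pi.single i (-Int.sign (v i)) : Site d) k| =
      ∑ k ∈ Finset.univ.erase i, |v k| := by
    refine Finset.sum_congr rfl fun k hk => ?_
    have hk : k ≠ i := Finset.ne_of_mem_erase hk
    simp [hk]
  have h2 : |(v + Pi.single i (-Int.sign (v i)) : Site d) i| = |v i| - 1 := by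
    simp only [Pi.add_apply, Pi.single_eq_same]
    rcases lt_or_gt_of_ne hi with h | h
    · rw [Int.sign_eq_neg_one_of_neg h, abs_of_neg h, abs_of_nonpos (by omega)]; omega
    · rw [Int.sign_eq_one_of_pos h, abs_of_pos h, abs_of_nonneg (by omega)]; omega
  simp only [h1, h2]
  omega

theorem l1norm_eq_zero {d : ℕ} {v : Site d} : l1norm v = 0 ↔ v = 0 := by
  rw [l1norm, Finset.sum_eq_zero_iff_of_nonneg fun _ _ => abs_nonneg _]
  simp [funext_iff]

theorem l1norm_nonneg {d : ℕ} (v : Site d) : 0 ≤ l1norm v :=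
  Finset.sum_nonneg fun _ _ => abs_nonneg _

theorem single_le_escape {d : ℕ} (B : Set (Site d)) (x y : Site d) (ω : Env d) (e : V d) :
    (ω x).1 e * (1 - hitProb B (x + e.1) y ω) ≤
      ∑ e : V d, (ω x).1 e * (1 - hitProb B (x + e.1) y ω) :=
  Finset.single_le_sum (f := fun e : V d => (ω x).1 e * (1 - hitProb B (x + e.1) y ω))
    (fun e _ => mul_nonneg ((ω x).2.1 e) (sub_nonneg.2 (hitProb_le_one _ _ _ _)))
    (Finset.mem_univ e)

/-- A shortest path from x to the outside site z costs a factor κ per step. Its sites are all closer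
to z than y is, so it avoids y; if it leaves B earlier, so much the better. -/
theorem one_sub_hitProb_ge {d : ℕ} {B : Set (Site d)} {y z : Site d} (hz : z ∉ B) {ω : Env d}
    {κ : ℝ} (hκ : 0 ≤ κ) (hκ1 : κ ≤ 1) (hω : ∀ x e, κ ≤ (ω x).1 e) (j : ℕ) (x : Site d)
    (hx : l1norm (x - z) = j) (hj : (j : ℤ) < l1norm (y - z)) :
    κ ^ j ≤ 1 - hitProb B x y ω := by
  have hxy : x ≠ y := by rintro rfl; omega
  induction j generalizing x with
  | zero =>
    have hxz : x = z := sub_eq_zero.1 (l1norm_eq_zero.1 (by simpa using hx))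
    rw [hitProb_of_notMem (hxz ▸ hz) hxy]
    simp
  | succ j ih =>
    by_cases hxB : x ∈ B
    · obtain ⟨e, he⟩ := exists_unit_step (v := x - z) (j := j) (by simpa using hx)
      have he' : l1norm (x + e.1 - z) = j := by rwa [add_sub_right_comm]
      have hj' : (j : ℤ) < l1norm (y - z) := by push_cast at hj; omega
      have h1 := ih (x + e.1) he' hj' (by rintro h; rw [h] at he'; omega)
      have h2 := single_le_escape B x y ω e
      have h3 : ∑ e : V d, (ω x).1 e * (1 - hitProb B (x + e.1) y ω) = 1 - hitProb B x y ω := by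
        rw [hitProb_eq hxB hxy]
        simp only [mul_sub, mul_one, Finset.sum_sub_distrib]
        rw [(ω x).2.2]
      calc κ ^ (j + 1) = κ * κ ^ j := pow_succ' _ _
        _ ≤ (ω x).1 e * (1 - hitProb B (x + e.1) y ω) :=
            mul_le_mul (hω x e) h1 (pow_nonneg hκ _) ((ω x).2.1 e)
        _ ≤ _ := h3 ▸ h2
    · rw [hitProb_of_notMem hxB hxy, sub_zero]
      exact pow_le_one₀ hκ hκ1

/-- The exponent r is the ℓ¹-distance from y to z, hence the bound is uniform over elliptic
environments. -/
theorem escapeProb_ge {d : ℕ} {B : Set (Site d)} {y z : Site d} (hy : y ∈ B) (hz : z ∉ B) {κ : ℝ}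
    (hκ : 0 ≤ κ) (hκ1 : κ ≤ 1) : ∃ r : ℕ, ∀ ω : Env d, (∀ x e, κ ≤ (ω x).1 e) →
      κ ^ r ≤ escapeProb B y ω := by
  have h0 : l1norm (y - z) ≠ 0 := fun h => hz (sub_eq_zero.1 (l1norm_eq_zero.1 h) ▸ hy)
  have h0' := l1norm_nonneg (y - z)
  obtain ⟨j, hj⟩ : ∃ j : ℕ, l1norm (y - z) = j + 1 := ⟨(l1norm (y - z) - 1).toNat, by omega⟩
  obtain ⟨e, he⟩ := exists_unit_step hj
  refine ⟨j + 1, fun ω hω => ?_⟩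
  have h1 := one_sub_hitProb_ge (y := y) hz hκ hκ1 hω j (y + e.1)
    (by rwa [add_sub_right_comm]) (by omega)
  calc κ ^ (j + 1) = κ * κ ^ j := pow_succ' _ _
    _ ≤ (ω y).1 e * (1 - hitProb B (y + e.1) y ω) :=
        mul_le_mul (hω y e) h1 (pow_nonneg hκ _) ((ω y).2.1 e)
    _ ≤ _ := single_le_escape B y y ω e

/-- The Green function factorizes into the hitting probability of `y` and the inverse of the
escape probability from `y`. -/
theorem green_eq_hitProb_div {d : ℕ} {B : Set (Site d)} {y : Site d} (hy : y ∈ B) {ω : Env d}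
    (hD : 0 < escapeProb B y ω) (x : Site d) :
    green B x y ω = ENNReal.ofReal (hitProb B x y ω / escapeProb B y ω) := by
  classical
  set D := escapeProb B y ω with hDdef
  set C : ℝ≥0∞ := ENNReal.ofReal (1 / D) with hC
  have hsum : ∑ e : V d, (ω y).1 e * hitProb B (y + e.1) y ω = 1 - D := by
    rw [hDdef, escapeProb]
    simp only [mul_sub, mul_one, Finset.sum_sub_distrib]
    rw [(ω y).2.2]
    ring
  have hr : ∑ e : V d, ENNReal.ofReal ((ω y).1 e) * green (B \ {y}) (y + e.1) y ω =
      ENNReal.ofReal (1 - D) := by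
    rw [← hsum, ENNReal.ofReal_sum_of_nonneg fun e _ =>
      mul_nonneg ((ω y).2.1 e) (hitProb_nonneg _ _ _ _)]
    refine Finset.sum_congr rfl fun e _ => ?_
    rw [ENNReal.ofReal_mul ((ω y).2.1 e), ofReal_hitProb]
  have hD1 : 0 ≤ 1 - D := hsum ▸ Finset.sum_nonneg fun e _ =>
      mul_nonneg ((ω y).2.1 e) (hitProb_nonneg _ _ _ _)
  -- C = 1/D is the sum of the geometric series over returns to y, each of probability 1 - D.
  have hCeq : 1 + ENNReal.ofReal (1 - D) * C = C := by
    rw [hC, ← ENNReal.ofReal_mul hD1, ← ENNReal.ofReal_one, ← ENNReal.ofReal_add zero_le_one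
      (by positivity)]
    congr 1
    field_simp
    ring
  have hself : green (B \ {y}) y y ω = 1 := by rw [green_eq_of_notMem (by simp), if_pos rfl]
  -- The right-hand side satisfies the one-step equation of the Green function on B, so it dominates
  -- every finite-horizon sum.
  have hupper : ∀ x, green B x y ω ≤ green (B \ {y}) x y ω * C := by
    intro x
    refine green_le_of_sum_le fun N => ?_
    induction N generalizing x with
    | zero => simp
    | succ N ih =>
      by_cases hx : x ∈ B
      · rw [sum_surv_succ hx]
        by_cases hxy : x = y
        · subst hxy
          rw [hself, if_pos rfl, one_mul]
          calc _ ≤ 1 + ∑ e : V d, ENNReal.ofReal ((ω x).1 e) *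
                (green (B \ {x}) (x + e.1) x ω * C) := by gcongr; exact ih _
            _ = C := by
              simp only [← mul_assoc]
              rw [← Finset.sum_mul, hr, hCeq]
        · rw [if_neg hxy, zero_add, green_eq (B := B \ {y}) ⟨hx, hxy⟩, if_neg hxy, zero_add,
            Finset.sum_mul]
          refine Finset.sum_le_sum fun e _ => ?_
          rw [mul_assoc]
          gcongr
          exact ih _
      · rw [sum_surv_succ_of_notMem hx, if_neg (fun h : x = y => hx (h ▸ hy))]
        exact zero_le
  -- The Markov property at the hitting time of y, carried out as an induction on the horizon for
  -- the hitting probability.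
  have hlower : ∀ x, green (B \ {y}) x y ω * green B y y ω ≤ green B x y ω := by
    intro x
    rw [green_eq_tsum (B \ {y}), ENNReal.tsum_eq_iSup_nat, ENNReal.iSup_mul]
    refine iSup_le fun N => ?_
    induction N generalizing x with
    | zero => simp
    | succ N ih =>
      by_cases hxy : x = y
      · subst hxy
        rw [sum_surv_succ_of_notMem (by simp), if_pos rfl, one_mul]
      · by_cases hx : x ∈ B
        · rw [sum_surv_succ (B := B \ {y}) ⟨hx, hxy⟩, if_neg hxy, zero_add, green_eq hx,
            if_neg hxy, zero_add, Finset.sum_mul]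
          refine Finset.sum_le_sum fun e _ => ?_
          rw [mul_assoc]
          gcongr
          exact ih _
        · rw [sum_surv_succ_of_notMem (fun h => hx h.1), if_neg hxy, zero_mul]
          exact zero_le
  have hGle : green B y y ω ≤ C := by simpa [hself] using hupper y
  have hGtop : green B y y ω ≠ ∞ := ne_top_of_le_ne_top ENNReal.ofReal_ne_top hGle
  -- At y the lower bound reads 1 + (1 - D)G ≤ G. Since G is finite by the upper bound, it may be
  -- solved for G ≥ 1/D.
  have hGge : C ≤ green B y y ω := by
    have h1 : 1 + ENNReal.ofReal (1 - D) * green B y y ω ≤ green B y y ω := by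
      conv_rhs => rw [green_eq hy, if_pos rfl]
      rw [← hr, Finset.sum_mul]
      refine add_le_add le_rfl (Finset.sum_le_sum fun e _ => ?_)
      rw [mul_assoc]
      exact mul_le_mul_right (hlower _) _
    have h2 : ENNReal.ofReal (green B y y ω).toReal = green B y y ω := ENNReal.ofReal_toReal hGtop
    rw [← h2, ← ENNReal.ofReal_mul hD1, ← ENNReal.ofReal_one,
      ← ENNReal.ofReal_add zero_le_one (mul_nonneg hD1 ENNReal.toReal_nonneg),
      ENNReal.ofReal_le_ofReal_iff ENNReal.toReal_nonneg] at h1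
    rw [hC, ← h2]
    refine ENNReal.ofReal_le_ofReal ?_
    rw [div_le_iff₀ hD]
    linarith
  have : green B x y ω = green (B \ {y}) x y ω * C :=
    le_antisymm (hupper x) (le_trans (by gcongr) (hlower x))
  rw [this, ← ofReal_hitProb, hC, ← ENNReal.ofReal_mul (hitProb_nonneg _ _ _ _), mul_one_div]

/-! ### The environment -/

instance {d : ℕ} (μ : Measure (ProbVec d)) [IsProbabilityMeasure μ] :
    IsProbabilityMeasure (envLaw μ) :=
  inferInstanceAs (IsProbabilityMeasure (Measure.infinitePi _))

open Classical in
theorem measurable_piecewise_env {d : ℕ} (H : Set (Site d)) :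
    Measurable fun p : Env d × Env d => (H.piecewise p.1 p.2 : Env d) := by
  refine measurable_pi_lambda _ fun x => ?_
  by_cases hx : x ∈ H
  · simp only [Set.piecewise_eq_of_mem _ _ _ hx]
    exact (measurable_pi_apply x).comp measurable_fst
  · simp only [Set.piecewise_eq_of_notMem _ _ _ hx]
    exact (measurable_pi_apply x).comp measurable_snd

open Classical in
/-- Resampling the environment outside `H` does not change its law. -/
theorem envLaw_piecewise {d : ℕ} (μ : Measure (ProbVec d)) [IsProbabilityMeasure μ]
    (H : Set (Site d)) :
    Measure.map (fun p : Env d × Env d => (H.piecewise p.1 p.2 : Env d))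
      ((envLaw μ).prod (envLaw μ)) = envLaw μ := by
  refine Measure.eq_infinitePi _ fun s t ht => ?_
  have hbox : ∀ s' : Finset (Site d), MeasurableSet (Set.pi (s' : Set (Site d)) t) := fun s' =>
    MeasurableSet.pi s'.countable_toSet fun i _ => ht i
  rw [Measure.map_apply (measurable_piecewise_env H) (hbox s)]
  have : (fun p : Env d × Env d => (H.piecewise p.1 p.2 : Env d)) ⁻¹' (Set.pi (s : Set _) t) =
      (Set.pi ((s.filter (· ∈ H) : Finset _) : Set (Site d)) t) ×ˢ
        (Set.pi ((s.filter (· ∉ H) : Finset _) : Set (Site d)) t) := by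
    ext p
    simp only [Set.mem_preimage, Set.mem_pi, Finset.mem_coe, Set.mem_prod, Finset.mem_filter]
    constructor
    · intro h
      refine ⟨fun i hi => ?_, fun i hi => ?_⟩
      · have := h i hi.1
        rwa [Set.piecewise_eq_of_mem _ _ _ hi.2] at this
      · have := h i hi.1
        rwa [Set.piecewise_eq_of_notMem _ _ _ hi.2] at this
    · rintro ⟨h1, h2⟩ i hi
      by_cases hH : i ∈ H
      · rw [Set.piecewise_eq_of_mem _ _ _ hH]; exact h1 i ⟨hi, hH⟩
      · rw [Set.piecewise_eq_of_notMem _ _ _ hH]; exact h2 i ⟨hi, hH⟩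
  rw [this, Measure.prod_prod, envLaw, Measure.infinitePi_pi _ fun i _ => ht i,
    Measure.infinitePi_pi _ fun i _ => ht i, Finset.prod_filter_mul_prod_filter_not]

/-- Functions of the environment in `H` and outside `H` are independent. -/
theorem lintegral_env_mul {d : ℕ} (μ : Measure (ProbVec d)) [IsProbabilityMeasure μ]
    (H : Set (Site d)) {f g : Env d → ℝ≥0∞} (hf : Measurable f) (hg : Measurable g)
    (hfH : ∀ ω ω' : Env d, (∀ x ∈ H, ω x = ω' x) → f ω = f ω')
    (hgH : ∀ ω ω' : Env d, (∀ x ∉ H, ω x = ω' x) → g ω = g ω') :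
    ∫⁻ ω, f ω * g ω ∂(envLaw μ) = (∫⁻ ω, f ω ∂(envLaw μ)) * ∫⁻ ω, g ω ∂(envLaw μ) := by
  classical
  conv_lhs => rw [← envLaw_piecewise μ H]
  rw [lintegral_map (f := fun ω => f ω * g ω) (hf.mul hg) (measurable_piecewise_env H),
    ← lintegral_prod_mul hf.aemeasurable hg.aemeasurable]
  refine lintegral_congr fun p => ?_
  congr 1
  · exact hfH _ _ fun x hx => Set.piecewise_eq_of_mem _ _ _ hx
  · exact hgH _ _ fun x hx => Set.piecewise_eq_of_notMem _ _ _ hx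

theorem measurePreserving_env_eval {d : ℕ} (μ : Measure (ProbVec d)) [IsProbabilityMeasure μ]
    (y : Site d) : MeasurePreserving (fun ω : Env d => ω y) (envLaw μ) μ :=
  measurePreserving_eval_infinitePi _ y

/-- The environment is stationary under the shifts of the lattice. -/
theorem measurePreserving_env_shift {d : ℕ} (μ : Measure (ProbVec d)) [IsProbabilityMeasure μ]
    (z : Site d) :
    MeasurePreserving (fun (ω : Env d) x => ω (x + z)) (envLaw μ) (envLaw μ) := by
  refine ⟨measurable_pi_lambda _ fun x => measurable_pi_apply _, ?_⟩
  have := Measure.infinitePi_map_piCongrLeft (fun _ : Site d => μ) (Equiv.subRight z)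
  rw [envLaw]
  conv_rhs => rw [← this]
  congr 1
  ext ω x : 2
  have h := Equiv.piCongrLeft_apply_apply (fun _ => ProbVec d) (Equiv.subRight z) ω (x + z)
  rw [show (Equiv.subRight z) (x + z) = x from add_sub_cancel_right x z] at h
  exact h.symm

theorem ae_env {d : ℕ} {μ : Measure (ProbVec d)} [IsProbabilityMeasure μ] {p : ProbVec d → Prop}
    (h : ∀ᵐ q ∂μ, p q) : ∀ᵐ ω ∂(envLaw μ), ∀ x, p (ω x) :=
  ae_all_iff.2 fun x => (measurePreserving_env_eval μ x).quasiMeasurePreserving.ae h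

/-- The infimum is itself an essential bound, by approximation along 1/(n+1). A nonzero value is
required because the infimum of the empty set is 0 by convention. -/
theorem linftyNorm_ae {d : ℕ} {μ : Measure (ProbVec d)} {ξ : ProbVec d → V d → ℝ}
    (h : linftyNorm μ ξ ≠ 0) : ∀ᵐ p ∂μ, ∀ e, |ξ p e| ≤ linftyNorm μ ξ := by
  rw [ae_all_iff]
  intro e
  set s := {M : ℝ | 0 < M ∧ ∀ e : V d, ∀ᵐ p ∂μ, |ξ p e| ≤ M} with hs
  have hne : s.Nonempty := by
    by_contra hne
    exact h (by rw [linftyNorm, ← hs, Set.not_nonempty_iff_eq_empty.1 hne, Real.sInf_empty])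
  have key : ∀ n : ℕ, ∀ᵐ p ∂μ, |ξ p e| ≤ linftyNorm μ ξ + 1 / ((n : ℝ) + 1) := by
    intro n
    obtain ⟨M, hM, hlt⟩ := exists_lt_of_csInf_lt hne
      (show sInf s < sInf s + 1 / ((n : ℝ) + 1) by
        have : (0 : ℝ) < 1 / ((n : ℝ) + 1) := by positivity
        linarith)
    filter_upwards [hM.2 e] with p hp
    exact hp.trans hlt.le
  filter_upwards [ae_all_iff.2 key] with p hp
  have ht := (tendsto_one_div_add_atTop_nhds_zero_nat (𝕜 := ℝ)).const_add (linftyNorm μ ξ)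
  rw [add_zero] at ht
  exact ge_of_tendsto' ht hp

/-! ### The single-site estimate -/

theorem dot_e1 {d : ℕ} (hd : 0 < d) (v : Site d) : dot v (e1 hd) = v ⟨0, hd⟩ := by
  simp [dot, e1]

theorem apply_eq_zero_of_l1norm_eq_one {d : ℕ} {v : Site d} (hv : l1norm v = 1) {i k : Fin d}
    (hi : v i ≠ 0) (hk : k ≠ i) : v k = 0 := by
  have h1 : |v i| + |v k| ≤ l1norm v := by
    rw [← Finset.sum_pair (f := fun j => |v j|) hk.symm]
    exact Finset.sum_le_sum_of_subset_of_nonneg (Finset.subset_univ _) fun _ _ _ => abs_nonneg _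
  have h2 := Int.one_le_abs hi
  exact abs_nonpos_iff.1 (by omega)

theorem abs_apply_le_one {d : ℕ} (e : V d) (i : Fin d) : |e.1 i| ≤ 1 :=
  (Finset.single_le_sum (f := fun i => |e.1 i|) (fun _ _ => abs_nonneg _)
    (Finset.mem_univ i)).trans_eq e.2

/-- Only e₁ and -e₁ have a nonzero first coordinate. -/
theorem sum_dot_e1_sq_le {d : ℕ} (hd : 0 < d) : ∑ e : V d, dot e.1 (e1 hd) ^ 2 ≤ 2 := by
  classical
  set i : Fin d := ⟨0, hd⟩
  have h1 : ∑ e : V d, dot e.1 (e1 hd) ^ 2 ≤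
      ∑ e : V d, if e.1 i ≠ 0 then (1 : ℝ) else 0 := by
    refine Finset.sum_le_sum fun e _ => ?_
    rw [dot_e1]
    split_ifs with h
    · rw [sq_le_one_iff_abs_le_one]
      exact_mod_cast abs_apply_le_one e i
    · have : e.1 i = 0 := not_not.1 h
      simp [i, this]
  refine h1.trans ?_
  rw [Finset.sum_boole]
  have : (Finset.univ.filter fun e : V d => e.1 i ≠ 0).card ≤ ({1, -1} : Finset ℤ).card := by
    refine Finset.card_le_card_of_injOn (fun e => e.1 i) (fun e he => ?_) ?_
    · have h0 : e.1 i ≠ 0 := by simpa using he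
      have := abs_le.1 (abs_apply_le_one e i)
      simp only [Finset.coe_insert, Finset.coe_singleton, Set.mem_insert_iff,
        Set.mem_singleton_iff]
      omega
    · intro e he e' he' hee
      have h0 : e.1 i ≠ 0 := by simpa using he
      have h0' : e'.1 i ≠ 0 := by simpa using he'
      refine Subtype.ext (funext fun k => ?_)
      by_cases hk : k = i
      · rw [hk]; exact hee
      · rw [apply_eq_zero_of_l1norm_eq_one e.2 h0 hk, apply_eq_zero_of_l1norm_eq_one e'.2 h0' hk]
  exact_mod_cast this

theorem measurable_probVec_apply {d : ℕ} (e : V d) : Measurable fun p : ProbVec d => p.1 e :=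
  (measurable_pi_apply e).comp measurable_subtype_coe

theorem probVec_le_one {d : ℕ} (p : ProbVec d) (e : V d) : p.1 e ≤ 1 :=
  p.2.2 ▸ Finset.single_le_sum (f := p.1) (fun e _ => p.2.1 e) (Finset.mem_univ e)

theorem measurable_driftDot {d : ℕ} (ℓ : EuclideanSpace ℝ (Fin d)) :
    Measurable fun p : ProbVec d => driftDot p.1 ℓ :=
  Finset.measurable_sum _ fun e _ => (measurable_probVec_apply e).mul_const _

theorem abs_driftDot_e1_le {d : ℕ} (hd : 0 < d) (p : ProbVec d) :
    |driftDot p.1 (e1 hd)| ≤ 1 := by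
  calc |driftDot p.1 (e1 hd)| ≤ ∑ e : V d, |p.1 e * dot e.1 (e1 hd)| :=
        Finset.abs_sum_le_sum_abs _ _
    _ ≤ ∑ e : V d, p.1 e := by
        refine Finset.sum_le_sum fun e _ => ?_
        rw [abs_mul, abs_of_nonneg (p.2.1 e), dot_e1]
        refine mul_le_of_le_one_right (p.2.1 e) ?_
        exact_mod_cast abs_apply_le_one e _
    _ = 1 := p.2.2

theorem integrable_probVec_apply {d : ℕ} (μ : Measure (ProbVec d)) [IsFiniteMeasure μ] (e : V d) :
    Integrable (fun p : ProbVec d => p.1 e) μ :=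
  Integrable.of_bound (measurable_probVec_apply e).aestronglyMeasurable 1
    (ae_of_all _ fun p => by
      rw [Real.norm_of_nonneg (p.2.1 e)]; exact probVec_le_one p e)

/-- The lower bound for the drift of Kalikow's walks. -/
noncomputable def driftBound {d : ℕ} (μ : Measure (ProbVec d)) (ℓ : EuclideanSpace ℝ (Fin d)) :
    ℝ :=
  avgDrift μ ℓ - 4 * (d : ℝ) * sigma μ ^ 2 * (1 + 9 * epsilon μ)

theorem ae_abs_sub_le {d : ℕ} (hd : 0 < d) {μ : Measure (ProbVec d)} (hε : 0 < epsilon μ) :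
    ∀ᵐ p ∂μ, ∀ e : V d, |p.1 e - 1 / (2 * (d : ℝ))| ≤ epsilon μ / (4 * d) := by
  have hd' : (0 : ℝ) < d := Nat.cast_pos.2 hd
  have h : linftyNorm μ (fun p e => p.1 e - 1 / (2 * (d : ℝ))) = epsilon μ / (4 * d) := by
    rw [epsilon, mul_div_cancel_left₀ _ (by positivity)]
  have := linftyNorm_ae (μ := μ) (ξ := fun p e => p.1 e - 1 / (2 * (d : ℝ)))
    (by rw [h]; positivity)
  rwa [h] at this

/-- Since ε < 1, the deviation from 1/(2d) is at most 1/(4d), half of the mean weight. -/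
theorem ae_elliptic {d : ℕ} (hd : 0 < d) {μ : Measure (ProbVec d)}
    (hε : epsilon μ ∈ Set.Ioo (0 : ℝ) 1) : ∀ᵐ p ∂μ, ∀ e : V d, 1 / (4 * (d : ℝ)) ≤ p.1 e := by
  have hd' : (0 : ℝ) < d := Nat.cast_pos.2 hd
  filter_upwards [ae_abs_sub_le hd hε.1] with p hp e
  have h1 := (abs_le.1 (hp e)).1
  have h2 : epsilon μ / (4 * d) ≤ 1 / (4 * d) := by gcongr; exact hε.2.le
  have h3 : 1 / (2 * (d : ℝ)) = 1 / (4 * d) + 1 / (4 * d) := by field_simp; norm_num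
  linarith

theorem sigma_sq {d : ℕ} (μ : Measure (ProbVec d)) [IsProbabilityMeasure μ] :
    sigma μ ^ 2 = ∑ e : V d, ∫ p, (p.1 e - ∫ q, q.1 e ∂μ) ^ 2 ∂μ := by
  rw [sigma, Real.sq_sqrt (Finset.sum_nonneg fun e _ => variance_nonneg _ _)]
  exact Finset.sum_congr rfl fun e _ =>
    variance_eq_integral (measurable_probVec_apply e).aemeasurable

/-- The single-site inequality behind Kalikow's condition: under any reweighting of `μ` by the
inverse of a positive linear form, the mean drift is at least `driftBound μ`. -/
theorem integral_drift_div_nonneg {d : ℕ} (hd : 0 < d) (μ : Measure (ProbVec d))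
    [IsProbabilityMeasure μ] (hε : epsilon μ ∈ Set.Ioo (0 : ℝ) 1) {u : V d → ℝ}
    (hu : ∀ e, 0 ≤ u e) :
    0 ≤ ∫ p, (driftDot p.1 (e1 hd) - driftBound μ (e1 hd)) / (∑ e, p.1 e * u e) ∂μ := by
  have hd' : (0 : ℝ) < d := Nat.cast_pos.2 hd
  obtain ⟨hε0, hε1⟩ := hε
  set ε := epsilon μ with hεdef
  set U := ∑ e, u e with hUdef
  have hU0 : 0 ≤ U := Finset.sum_nonneg fun e _ => hu e
  -- If u vanishes identically, the quotient is 0 by the convention on division by 0.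
  rcases hU0.eq_or_lt with hU | hU
  · have : ∀ e, u e = 0 := fun e =>
      (Finset.sum_eq_zero_iff_of_nonneg fun e _ => hu e).1 hU.symm e (Finset.mem_univ e)
    simp [this]
  set c : V d → ℝ := fun e => dot e.1 (e1 hd) with hc
  set m : V d → ℝ := fun e => ∫ q, q.1 e ∂μ with hm
  set a : ℝ := (1 - ε / 2) / (2 * d) with ha
  set b : ℝ := (1 + ε / 2) / (2 * d) with hb
  have ha0 : 0 < a := div_pos (by linarith) (by positivity)
  have hb0 : 0 < b := div_pos (by linarith) (by positivity)
  have hab : ∀ᵐ p ∂μ, ∀ e : V d, a ≤ p.1 e ∧ p.1 e ≤ b := by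
    filter_upwards [ae_abs_sub_le hd hε0] with p hp e
    have h1 := abs_le.1 (hp e)
    have h2 : a = 1 / (2 * d) - ε / (4 * d) := by rw [ha]; field_simp; ring
    have h3 : b = 1 / (2 * d) + ε / (4 * d) := by rw [hb]; field_simp; ring
    constructor <;> linarith [h1.1, h1.2]
  have hint := fun e => integrable_probVec_apply μ e
  have hma : ∀ e, a ≤ m e := fun e => by
    have := integral_mono_ae (integrable_const a) (hint e) (hab.mono fun p hp => (hp e).1)
    simpa using this
  set S : ProbVec d → ℝ := fun p => ∑ e, (p.1 e - m e) ^ 2 with hS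
  set Dm : ℝ := ∑ e, m e * u e with hDm
  have hDma : a * U ≤ Dm := by
    rw [hUdef, Finset.mul_sum]
    exact Finset.sum_le_sum fun e _ => mul_le_mul_of_nonneg_right (hma e) (hu e)
  have hDm0 : 0 < Dm := (mul_pos ha0 hU).trans_le hDma
  have hintsq : ∀ e, Integrable (fun p : ProbVec d => (p.1 e - m e) ^ 2) μ := fun e => by
    refine Integrable.of_bound
      (((measurable_probVec_apply e).sub_const _).pow_const 2).aestronglyMeasurable
      ((1 + |m e|) ^ 2) (ae_of_all _ fun p => ?_)
    rw [norm_pow]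
    gcongr
    refine (norm_sub_le _ _).trans ?_
    rw [Real.norm_of_nonneg (p.2.1 e)]
    exact add_le_add (probVec_le_one p e) le_rfl
  have hSint : Integrable S μ := integrable_finsetSum _ fun e _ => hintsq e
  have hSσ : ∫ p, S p ∂μ = sigma μ ^ 2 := by
    rw [sigma_sq, integral_finsetSum _ fun e _ => hintsq e]
  have hdrint : Integrable (fun p : ProbVec d => driftDot p.1 (e1 hd)) μ :=
    integrable_finsetSum _ fun e _ => (hint e).mul_const _
  have hlam : avgDrift μ (e1 hd) = ∑ e, m e * c e := by
    rw [avgDrift]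
    simp only [driftDot]
    rw [integral_finsetSum _ fun e _ => (hint e).mul_const _]
    exact Finset.sum_congr rfl fun e _ => integral_mul_const _ _
  set K : ℝ := 4 * (d : ℝ) * sigma μ ^ 2 * (1 + 9 * ε) with hK
  have hK0 : 0 ≤ K := by positivity
  -- With δ the centred drift, D the linear form and Dm its mean, (δ+K)/D = δ/Dm - δ(D-Dm)/(Dm·D) +
  -- K/D. The first term has mean 0, the second is bounded through S, and the third from below
  -- through D ≤ bU.
  have hbd : ∀ᵐ p ∂μ, (driftDot p.1 (e1 hd) - avgDrift μ (e1 hd)) / Dm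
      - 2 / (a ^ 2 * U) * S p + K / (b * U) ≤
      (driftDot p.1 (e1 hd) - driftBound μ (e1 hd)) / (∑ e, p.1 e * u e) := by
    filter_upwards [hab] with p hp
    set D := ∑ e, p.1 e * u e with hD
    have hDa : a * U ≤ D := by
      rw [hUdef, Finset.mul_sum]
      exact Finset.sum_le_sum fun e _ => mul_le_mul_of_nonneg_right (hp e).1 (hu e)
    have hDb : D ≤ b * U := by
      rw [hUdef, Finset.mul_sum]
      exact Finset.sum_le_sum fun e _ => mul_le_mul_of_nonneg_right (hp e).2 (hu e)
    have hD0 : 0 < D := (mul_pos ha0 hU).trans_le hDa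
    set δ := driftDot p.1 (e1 hd) - avgDrift μ (e1 hd) with hδ
    have hδ' : δ = ∑ e, (p.1 e - m e) * c e := by
      rw [hδ, hlam, driftDot, ← Finset.sum_sub_distrib]
      exact Finset.sum_congr rfl fun e _ => by ring
    -- Cauchy–Schwarz gives δ² ≤ 2S. Hence each δ(p(e) - m(e)) is at most (δ² + S)/2 ≤ 3S/2, which
    -- is rounded up to 2S.
    have hS0 : 0 ≤ S p := Finset.sum_nonneg fun e _ => sq_nonneg _
    have hδ2 : δ ^ 2 ≤ 2 * S p := by
      rw [hδ']
      refine (Finset.sum_mul_sq_le_sq_mul_sq _ _ _).trans ?_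
      rw [mul_comm]
      exact mul_le_mul_of_nonneg_right (sum_dot_e1_sq_le hd) hS0
    have hcross : δ * (D - Dm) ≤ 2 * S p * U := by
      have : δ * (D - Dm) = ∑ e, δ * (p.1 e - m e) * u e := by
        rw [hD, hDm, ← Finset.sum_sub_distrib, Finset.mul_sum]
        exact Finset.sum_congr rfl fun e _ => by ring
      rw [this, hUdef, Finset.mul_sum]
      refine Finset.sum_le_sum fun e _ => mul_le_mul_of_nonneg_right ?_ (hu e)
      have h1 : (p.1 e - m e) ^ 2 ≤ S p :=
        Finset.single_le_sum (f := fun e => (p.1 e - m e) ^ 2) (fun e _ => sq_nonneg _)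
          (Finset.mem_univ e)
      nlinarith [sq_nonneg (δ - (p.1 e - m e))]
    have e1' : driftDot p.1 (e1 hd) - driftBound μ (e1 hd) = δ + K := by
      rw [driftBound, hδ, hK]; ring
    have e2 : (δ + K) / D = δ / Dm - δ * (D - Dm) / (Dm * D) + K / D := by
      field_simp; ring
    have e3 : δ * (D - Dm) / (Dm * D) ≤ 2 / (a ^ 2 * U) * S p := by
      calc δ * (D - Dm) / (Dm * D) ≤ 2 * S p * U / (Dm * D) := by gcongr
        _ ≤ 2 * S p * U / ((a * U) * (a * U)) := by gcongr
        _ = 2 / (a ^ 2 * U) * S p := by field_simp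
    have e4 : K / (b * U) ≤ K / D := by gcongr
    rw [e1', e2]
    linarith
  have hint1 : Integrable (fun p : ProbVec d =>
      (driftDot p.1 (e1 hd) - avgDrift μ (e1 hd)) / Dm) μ :=
    (hdrint.sub (integrable_const _)).div_const _
  have hint2 : Integrable (fun p : ProbVec d => 2 / (a ^ 2 * U) * S p) μ := hSint.const_mul _
  have hint3 : Integrable (fun p : ProbVec d => (driftDot p.1 (e1 hd) - driftBound μ (e1 hd)) /
      (∑ e, p.1 e * u e)) μ := by
    refine Integrable.of_bound (((measurable_driftDot _).sub_const _).div
      (Finset.measurable_sum _ fun e _ =>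
        (measurable_probVec_apply e).mul_const _)).aestronglyMeasurable
      ((1 + |driftBound μ (e1 hd)|) / (a * U)) ?_
    filter_upwards [hab] with p hp
    have hDa : a * U ≤ ∑ e, p.1 e * u e := by
      rw [hUdef, Finset.mul_sum]
      exact Finset.sum_le_sum fun e _ => mul_le_mul_of_nonneg_right (hp e).1 (hu e)
    have hD0 := (mul_pos ha0 hU).trans_le hDa
    rw [norm_div, Real.norm_of_nonneg hD0.le]
    have := (abs_sub _ _).trans (add_le_add_left (abs_driftDot_e1_le hd p)
      |driftBound μ (e1 hd)|)
    rw [Real.norm_eq_abs]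
    have haU := mul_pos ha0 hU
    gcongr
  have hmono := integral_mono_ae ((hint1.sub hint2).add (integrable_const (K / (b * U)))) hint3 hbd
  refine le_trans ?_ hmono
  have hval : ∫ p, ((driftDot p.1 (e1 hd) - avgDrift μ (e1 hd)) / Dm
      - 2 / (a ^ 2 * U) * S p + K / (b * U)) ∂μ =
      K / (b * U) - 2 / (a ^ 2 * U) * sigma μ ^ 2 := by
    have h0 : ∫ p, (driftDot p.1 (e1 hd) - avgDrift μ (e1 hd)) ∂μ = 0 := by
      rw [integral_sub hdrint (integrable_const _), avgDrift]; simp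
    rw [integral_add (f := fun p : ProbVec d => (driftDot p.1 (e1 hd) - avgDrift μ (e1 hd)) / Dm
      - 2 / (a ^ 2 * U) * S p) (hint1.sub hint2) (integrable_const _), integral_sub hint1 hint2,
      integral_div, h0, integral_const_mul, hSσ]
    simp
    ring
  change 0 ≤ ∫ p, ((driftDot p.1 (e1 hd) - avgDrift μ (e1 hd)) / Dm
      - 2 / (a ^ 2 * U) * S p + K / (b * U)) ∂μ
  rw [hval]
  -- Multiplied out, this is 1 + ε/2 ≤ (1+9ε)(1-ε/2)². The difference is ε(30 - 35ε + 9ε²)/4,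
  -- positive on (0,1); the factor 1+9ε of the hypothesis is spent here.
  have hfin : 2 / a ^ 2 ≤ 4 * d * (1 + 9 * ε) / b := by
    rw [div_le_div_iff₀ (by positivity) hb0]
    have h1 : 2 * b = (1 + ε / 2) / d := by rw [hb]; field_simp
    have h2 : 4 * d * (1 + 9 * ε) * a ^ 2 = (1 + 9 * ε) * (1 - ε / 2) ^ 2 / d := by
      rw [ha]; field_simp; ring
    rw [h1, h2]
    gcongr
    nlinarith [mul_pos hε0 (sub_pos.2 hε1), mul_pos hε0 hε0]
  have : K / (b * U) - 2 / (a ^ 2 * U) * sigma μ ^ 2 =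
      sigma μ ^ 2 / U * (4 * d * (1 + 9 * ε) / b - 2 / a ^ 2) := by
    rw [hK]; field_simp
  rw [this]
  exact mul_nonneg (by positivity) (sub_nonneg.2 hfin)

/-! ### Kalikow's condition -/

theorem measurable_escapeProb {d : ℕ} (B : Set (Site d)) (y : Site d) :
    Measurable (escapeProb B y) :=
  Finset.measurable_sum _ fun e _ =>
    ((measurable_probVec_apply e).comp (measurable_pi_apply y)).mul
      ((measurable_hitProb B _ y).const_sub 1)

theorem ae_escapeProb_ge {d : ℕ} (hd : 0 < d) {μ : Measure (ProbVec d)} [IsProbabilityMeasure μ]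
    (hε : epsilon μ ∈ Set.Ioo (0 : ℝ) 1) {B : Set (Site d)} (hB : B ≠ Set.univ) {y : Site d}
    (hy : y ∈ B) : ∃ c : ℝ, 0 < c ∧ ∀ᵐ ω ∂(envLaw μ), c ≤ escapeProb B y ω := by
  have hd' : (1 : ℝ) ≤ d := Nat.one_le_cast.2 hd
  obtain ⟨z, hz⟩ := (Set.ne_univ_iff_exists_notMem B).1 hB
  obtain ⟨r, hr⟩ := escapeProb_ge hy hz (κ := 1 / (4 * (d : ℝ))) (by positivity)
    (by rw [div_le_one (by positivity)]; linarith)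
  exact ⟨_, by positivity, (ae_env (ae_elliptic hd hε)).mono hr⟩

theorem ae_green_eq {d : ℕ} (hd : 0 < d) {μ : Measure (ProbVec d)} [IsProbabilityMeasure μ]
    (hε : epsilon μ ∈ Set.Ioo (0 : ℝ) 1) {B : Set (Site d)} (hB : B ≠ Set.univ) {y : Site d}
    (hy : y ∈ B) (x : Site d) : ∀ᵐ ω ∂(envLaw μ),
      green B x y ω = ENNReal.ofReal (hitProb B x y ω / escapeProb B y ω) := by
  obtain ⟨c, hc, h⟩ := ae_escapeProb_ge hd hε hB hy
  filter_upwards [h] with ω hω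
  exact green_eq_hitProb_div hy (hc.trans_le hω) x

theorem ae_green_le {d : ℕ} (hd : 0 < d) {μ : Measure (ProbVec d)} [IsProbabilityMeasure μ]
    (hε : epsilon μ ∈ Set.Ioo (0 : ℝ) 1) {B : Set (Site d)} (hB : B ≠ Set.univ) {y : Site d}
    (hy : y ∈ B) (x : Site d) : ∃ C : ℝ, 0 ≤ C ∧ ∀ᵐ ω ∂(envLaw μ),
      green B x y ω ≤ ENNReal.ofReal C := by
  obtain ⟨c, hc, h⟩ := ae_escapeProb_ge hd hε hB hy
  refine ⟨1 / c, by positivity, ?_⟩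
  filter_upwards [h, ae_green_eq hd hε hB hy x] with ω hω hω'
  rw [hω']
  refine ENNReal.ofReal_le_ofReal ?_
  have := hitProb_le_one B x y ω
  gcongr

theorem integrable_green {d : ℕ} (hd : 0 < d) {μ : Measure (ProbVec d)} [IsProbabilityMeasure μ]
    (hε : epsilon μ ∈ Set.Ioo (0 : ℝ) 1) {B : Set (Site d)} (hB : B ≠ Set.univ) {y : Site d}
    (hy : y ∈ B) (x : Site d) :
    Integrable (fun ω => (green B x y ω).toReal) (envLaw μ) := by
  obtain ⟨C, hC, h⟩ := ae_green_le hd hε hB hy x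
  refine Integrable.of_bound (measurable_green B x y).ennreal_toReal.aestronglyMeasurable C ?_
  filter_upwards [h] with ω hω
  rw [Real.norm_of_nonneg ENNReal.toReal_nonneg]
  exact ENNReal.toReal_le_of_le_ofReal hC hω

theorem integrable_green_mul {d : ℕ} (hd : 0 < d) {μ : Measure (ProbVec d)}
    [IsProbabilityMeasure μ] (hε : epsilon μ ∈ Set.Ioo (0 : ℝ) 1) {B : Set (Site d)}
    (hB : B ≠ Set.univ) {y : Site d} (hy : y ∈ B) (x : Site d) {f : ProbVec d → ℝ}
    (hf : Measurable f) {C : ℝ} (hC : ∀ p, |f p| ≤ C) :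
    Integrable (fun ω : Env d => (green B x y ω).toReal * f (ω y)) (envLaw μ) :=
  (integrable_green hd hε hB hy x).mul_bdd (c := C)
    (hf.comp (measurable_pi_apply y)).aestronglyMeasurable (ae_of_all _ fun ω => hC (ω y))

theorem integral_env_eval {d : ℕ} (μ : Measure (ProbVec d)) [IsProbabilityMeasure μ]
    (y : Site d) {f : ProbVec d → ℝ} (hf : Measurable f) :
    ∫ ω, f (ω y) ∂(envLaw μ) = ∫ p, f p ∂μ := by
  have hmp := measurePreserving_env_eval μ y
  conv_rhs => rw [← hmp.map_eq]
  exact (integral_map hmp.measurable.aemeasurable hf.aestronglyMeasurable).symm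

open Classical in
theorem integral_envLaw_piecewise {d : ℕ} (μ : Measure (ProbVec d)) [IsProbabilityMeasure μ]
    (H : Set (Site d)) {Φ : Env d → ℝ} (hm : Measurable Φ) (hΦ : Integrable Φ (envLaw μ)) :
    ∫ ω, Φ ω ∂(envLaw μ) =
      ∫ ω, ∫ ω', Φ (H.piecewise ω ω') ∂(envLaw μ) ∂(envLaw μ) := by
  have hpm := measurable_piecewise_env H
  have hmap := envLaw_piecewise μ H
  have hint : Integrable (fun p : Env d × Env d => Φ (H.piecewise p.1 p.2))
      ((envLaw μ).prod (envLaw μ)) := by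
    rw [← hmap] at hΦ
    exact hΦ.comp_measurable hpm
  rw [← integral_prod _ hint]
  conv_lhs => rw [← hmap]
  exact integral_map hpm.aemeasurable hm.aestronglyMeasurable

/-- The annealed Green function, tilted by the local drift. -/
theorem integral_green_drift_nonneg {d : ℕ} (hd : 0 < d) {μ : Measure (ProbVec d)}
    [IsProbabilityMeasure μ] (hε : epsilon μ ∈ Set.Ioo (0 : ℝ) 1) {B : Set (Site d)}
    (hB : B ≠ Set.univ) {y : Site d} (hy : y ∈ B) (x : Site d) :
    0 ≤ ∫ ω, (green B x y ω).toReal * (driftDot (ω y).1 (e1 hd) - driftBound μ (e1 hd))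
      ∂(envLaw μ) := by
  classical
  set κ := driftBound μ (e1 hd) with hκ
  set Φ : Env d → ℝ := fun ω =>
    hitProb B x y ω / escapeProb B y ω * (driftDot (ω y).1 (e1 hd) - κ) with hΦ
  have hΦm : Measurable Φ :=
    ((measurable_hitProb B x y).div (measurable_escapeProb B y)).mul
      (((measurable_driftDot _).comp (measurable_pi_apply y)).sub_const κ)
  have hae : (fun ω : Env d => (green B x y ω).toReal * (driftDot (ω y).1 (e1 hd) - κ))
      =ᵐ[envLaw μ] Φ := by
    obtain ⟨c, hc, h⟩ := ae_escapeProb_ge hd hε hB hy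
    filter_upwards [h, ae_green_eq hd hε hB hy x] with ω hω hω'
    rw [hω', ENNReal.toReal_ofReal (div_nonneg (hitProb_nonneg _ _ _ _) (hc.le.trans hω))]
  have hΦint : Integrable Φ (envLaw μ) := by
    refine Integrable.congr ?_ hae
    refine integrable_green_mul hd hε hB hy x (f := fun p => driftDot p.1 (e1 hd) - κ)
      ((measurable_driftDot _).sub_const κ) (C := 1 + |κ|) fun p => ?_
    exact (abs_sub _ _).trans (add_le_add_left (abs_driftDot_e1_le hd p) _)
  rw [integral_congr_ae hae]
  -- Only the vector at y is resampled. The hitting probabilities are then frozen, and the inner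
  -- integral is the single-site integral with u(e) = 1 - `hitProb` from y + e.
  obtain ⟨H, hH⟩ : ∃ H : Set (Site d), ∀ z, z ∈ H ↔ z ≠ y := ⟨{y}ᶜ, fun z => Iff.rfl⟩
  rw [integral_envLaw_piecewise μ H hΦm hΦint]
  refine integral_nonneg fun ω => ?_
  have hval : ∀ ω' : Env d, Φ (H.piecewise ω ω') =
      hitProb B x y ω * ((fun p : ProbVec d => (driftDot p.1 (e1 hd) - κ) /
        (∑ e, p.1 e * (1 - hitProb B (y + e.1) y ω))) (ω' y)) := by
    intro ω'
    have h1 : ∀ z, hitProb B z y (H.piecewise ω ω') = hitProb B z y ω :=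
      fun z => hitProb_congr B z fun w hw => Set.piecewise_eq_of_mem _ _ _ ((hH w).2 hw)
    have h2 : H.piecewise ω ω' y = ω' y :=
      Set.piecewise_eq_of_notMem _ _ _ (by simp [hH])
    simp only [hΦ, escapeProb, h1, h2]
    ring
  simp only [hval, Pi.zero_apply]
  rw [integral_const_mul]
  refine mul_nonneg (hitProb_nonneg _ _ _ _) ?_
  have hfm : Measurable fun p : ProbVec d => (driftDot p.1 (e1 hd) - κ) /
        (∑ e, p.1 e * (1 - hitProb B (y + e.1) y ω)) :=
    ((measurable_driftDot _).sub_const κ).div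
      (Finset.measurable_sum _ fun e _ => (measurable_probVec_apply e).mul_const _)
  rw [integral_env_eval μ y hfm]
  exact integral_drift_div_nonneg hd μ hε fun e => sub_nonneg.2 (hitProb_le_one _ _ _ _)

/-- Connectedness supplies a nearest-neighbour path inside B from x to y, which an elliptic
environment charges. It keeps the denominator of Kalikow's weights away from 0. -/
theorem green_pos {d : ℕ} {B : Set (Site d)} (hconn : ((lattice d).induce B).Connected)
    {x y : Site d} (hx : x ∈ B) (hy : y ∈ B) {ω : Env d} (hω : ∀ x e, 0 < (ω x).1 e) :
    0 < green B x y ω := by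
  classical
  have hreach := (SimpleGraph.reachable_iff_reflTransGen _ _).1 (hconn.preconnected ⟨x, hx⟩ ⟨y, hy⟩)
  suffices h : ∀ a : B, Relation.ReflTransGen ((lattice d).induce B).Adj a ⟨y, hy⟩ →
      0 < green B a.1 y ω from h ⟨x, hx⟩ hreach
  intro a ha
  induction ha using Relation.ReflTransGen.head_induction_on with
  | refl =>
    rw [green_eq hy, if_pos rfl]
    exact lt_of_lt_of_le zero_lt_one le_self_add
  | head hab _ ih =>
    rename_i a b _
    have hadj : l1norm (a.1 - b.1) = 1 := hab
    have hadj' : l1norm (b.1 - a.1) = 1 := by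
      have : l1norm (b.1 - a.1) = l1norm (a.1 - b.1) :=
        Finset.sum_congr rfl fun i _ => abs_sub_comm (b.1 i) (a.1 i)
      rw [this, hadj]
    set e : V d := ⟨b.1 - a.1, hadj'⟩
    rw [green_eq a.2]
    have he : a.1 + e.1 = b.1 := add_sub_cancel _ _
    have h1 : 0 < ENNReal.ofReal ((ω a.1).1 e) * green B (a.1 + e.1) y ω := by
      rw [he]
      exact ENNReal.mul_pos (ENNReal.ofReal_pos.2 (hω _ _)).ne' ih.ne'
    refine h1.trans_le (le_trans ?_ le_add_self)
    exact Finset.single_le_sum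
      (f := fun e : V d => ENNReal.ofReal ((ω a.1).1 e) * green B (a.1 + e.1) y ω)
      (fun _ _ => zero_le) (Finset.mem_univ e)

/-- By linearity, the drift of Kalikow's weights is E[g·drift]/E[g], so
`integral_green_drift_nonneg` is the claim once divided by 0 < E[g] < ∞. -/
theorem driftBound_le_driftDot_kalikowEnv {d : ℕ} (hd : 0 < d) {μ : Measure (ProbVec d)}
    [IsProbabilityMeasure μ] (hε : epsilon μ ∈ Set.Ioo (0 : ℝ) 1) {B : Set (Site d)}
    (hB : B ≠ Set.univ) (hconn : ((lattice d).induce B).Connected) {x y : Site d} (hx : x ∈ B)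
    (hy : y ∈ B) : driftBound μ (e1 hd) ≤ driftDot (kalikowEnv μ B x y) (e1 hd) := by
  have hd' : (0 : ℝ) < d := Nat.cast_pos.2 hd
  set g : Env d → ℝ := fun ω => (green B x y ω).toReal with hg
  obtain ⟨C, hC, hle⟩ := ae_green_le hd hε hB hy x
  have hfin : ∀ᵐ ω ∂(envLaw μ), green B x y ω < ∞ :=
    hle.mono fun ω hω => hω.trans_lt ENNReal.ofReal_lt_top
  have hgint : Integrable g (envLaw μ) := integrable_green hd hε hB hy x
  have hG : (∫⁻ ω, green B x y ω ∂(envLaw μ)).toReal = ∫ ω, g ω ∂(envLaw μ) :=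
    (integral_toReal (measurable_green B x y).aemeasurable hfin).symm
  have hpos : 0 < ∫ ω, g ω ∂(envLaw μ) := by
    rw [integral_pos_iff_support_of_nonneg_ae (ae_of_all _ fun ω => ENNReal.toReal_nonneg) hgint]
    have : ∀ᵐ ω ∂(envLaw μ), ω ∈ Function.support g := by
      filter_upwards [hfin, ae_env (ae_elliptic hd hε)] with ω h1 h2
      refine (ENNReal.toReal_pos (green_pos hconn hx hy fun x e => ?_).ne' h1.ne).ne'
      exact lt_of_lt_of_le (by positivity) (h2 x e)
    have h1 : envLaw μ (Function.support g) = 1 := 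
      (measure_congr (t := Set.univ) (eventuallyEq_univ.2 this)).trans measure_univ
    exact h1 ▸ one_pos
  have hK : ∀ e, kalikowEnv μ B x y e = (∫ ω, g ω * (ω y).1 e ∂(envLaw μ)) /
      ∫ ω, g ω ∂(envLaw μ) := by
    intro e
    rw [kalikowEnv, ENNReal.toReal_div, hG, ← integral_toReal]
    · congr 2
      ext ω
      rw [ENNReal.toReal_mul, ENNReal.toReal_ofReal ((ω y).2.1 e)]
    · exact ((measurable_green B x y).mul (ENNReal.measurable_ofReal.comp
        ((measurable_probVec_apply e).comp (measurable_pi_apply y)))).aemeasurable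
    · filter_upwards [hfin] with ω hω
      exact ENNReal.mul_lt_top hω ENNReal.ofReal_lt_top
  have hint : ∀ e : V d, Integrable (fun ω : Env d => g ω * (ω y).1 e) (envLaw μ) := fun e =>
    integrable_green_mul hd hε hB hy x (f := fun p => p.1 e) (measurable_probVec_apply e)
      (C := 1) fun p => by rw [abs_of_nonneg (p.2.1 e)]; exact probVec_le_one p e
  have hdr : driftDot (kalikowEnv μ B x y) (e1 hd) =
      (∫ ω, g ω * driftDot (ω y).1 (e1 hd) ∂(envLaw μ)) / ∫ ω, g ω ∂(envLaw μ) := by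
    have : ∀ ω : Env d, g ω * driftDot (ω y).1 (e1 hd) =
        ∑ e : V d, g ω * (ω y).1 e * dot e.1 (e1 hd) := fun ω => by
      rw [driftDot, Finset.mul_sum]
      exact Finset.sum_congr rfl fun e _ => by ring
    simp only [this]
    rw [integral_finsetSum _ fun e _ => (hint e).mul_const _, driftDot, Finset.sum_div]
    refine Finset.sum_congr rfl fun e _ => ?_
    rw [integral_mul_const, hK]
    ring
  have hdint : Integrable (fun ω : Env d => g ω * driftDot (ω y).1 (e1 hd)) (envLaw μ) :=
    integrable_green_mul hd hε hB hy x (f := fun p => driftDot p.1 (e1 hd)) (measurable_driftDot _)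
      (C := 1) (abs_driftDot_e1_le hd)
  have hmain := integral_green_drift_nonneg hd hε hB hy x
  simp only [mul_sub] at hmain
  rw [integral_sub hdint (hgint.mul_const _), integral_mul_const] at hmain
  rw [hdr, le_div_iff₀ hpos]
  linarith

theorem kalikowCondition_of_driftBound_pos {d : ℕ} (hd : 0 < d) {μ : Measure (ProbVec d)}
    [IsProbabilityMeasure μ] (hε : epsilon μ ∈ Set.Ioo (0 : ℝ) 1)
    (hκ : 0 < driftBound μ (e1 hd)) : KalikowCondition μ (e1 hd) := by
  refine hκ.trans_le (le_csInf ?_ ?_)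
  -- The infimum is over a nonempty set, as B = {0} is admissible; otherwise it would be 0 by
  -- convention.
  · refine ⟨_, {0}, 0, ?_, ?_, rfl, rfl, rfl⟩
    · intro h
      have : (Pi.single ⟨0, hd⟩ 1 : Site d) ∈ ({0} : Set (Site d)) := h ▸ Set.mem_univ _
      exact one_ne_zero (Pi.single_eq_zero_iff.1 this)
    · have : Nonempty ({0} : Set (Site d)) := ⟨⟨0, rfl⟩⟩
      exact ⟨fun a b => Subsingleton.elim a b ▸ SimpleGraph.Reachable.refl _⟩
  · rintro _ ⟨B, y, hB, hconn, h0, hy, rfl⟩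
    exact driftBound_le_driftDot_kalikowEnv hd hε hB hconn h0 hy

/-! ### The Markov property and stopped increments -/

theorem measurable_coord {d : ℕ} (n : ℕ) : Measurable fun X : Path d => X n :=
  measurable_pi_apply n

/-- A set of trajectories that is determined by the trajectory up to time `n`. -/
def DeterminedBy {d : ℕ} (n : ℕ) (A : Set (Path d)) : Prop :=
  ∀ X X' : Path d, (∀ k ≤ n, X k = X' k) → X ∈ A → X' ∈ A

/-- A cylinder of length n lies either inside or outside an event determined by time n, so
identities need only be checked cylinder by cylinder. -/
theorem DeterminedBy.cyl_inter {d : ℕ} {n : ℕ} {A : Set (Path d)} (hA : DeterminedBy n A)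
    (γ : Path d) (S : Set (Path d)) : (γ ∈ A ∧ cyl γ n ∩ (A ∩ S) = cyl γ n ∩ S) ∨
      (γ ∉ A ∧ cyl γ n ∩ (A ∩ S) = ∅) := by
  by_cases h : γ ∈ A
  · refine Or.inl ⟨h, ?_⟩
    ext X
    exact ⟨fun hX => ⟨hX.1, hX.2.2⟩, fun hX => ⟨hX.1, hA γ X (fun k hk => (hX.1 k hk).symm) h, hX.2⟩⟩
  · refine Or.inr ⟨h, ?_⟩
    ext X
    simp only [Set.mem_inter_iff, Set.mem_empty_iff_false, iff_false, not_and]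
    exact fun hX hXA => absurd (hA X γ hX hXA) h

theorem DeterminedBy.measurableSet {d : ℕ} {n : ℕ} {A : Set (Path d)} (hA : DeterminedBy n A) :
    MeasurableSet A := by
  have : A = Preorder.frestrictLe (π := fun _ => Site d) n ⁻¹'
      (Preorder.frestrictLe (π := fun _ => Site d) n '' A) := by
    ext X
    refine ⟨fun h => ⟨X, h, rfl⟩, ?_⟩
    rintro ⟨X', hX', h⟩
    exact hA X' X (fun k hk => congrFun h ⟨k, Finset.mem_Iic.2 hk⟩) hX'
  rw [this]
  exact Preorder.measurable_frestrictLe (X := fun _ => Site d) n (Set.to_countable _).measurableSet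

/-- A product formula that holds on cylinders extends to the sets they generate. -/
theorem DeterminedBy.measure_inter_eq_mul {d : ℕ} {n : ℕ} {A S : Set (Path d)}
    (hA : DeterminedBy n A) (hS : MeasurableSet S) {ν : Measure (Path d)} {c : ℝ≥0∞}
    (h : ∀ γ ∈ A, ν (cyl γ n ∩ S) = ν (cyl γ n) * c) : ν (A ∩ S) = ν A * c := by
  rw [mul_comm, ← smul_eq_mul, ← Measure.smul_apply]
  refine measure_congr_cyl n (hA.measurableSet.inter hS) hA.measurableSet fun γ => ?_
  rcases hA.cyl_inter γ S with ⟨hγ, h1⟩ | ⟨hγ, h1⟩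
  · rcases hA.cyl_inter γ Set.univ with ⟨_, h2⟩ | ⟨hγ', _⟩
    · rw [Set.inter_univ, Set.inter_univ] at h2
      rw [h1, h2, h γ hγ, Measure.smul_apply, smul_eq_mul, mul_comm]
    · exact absurd hγ hγ'
  · rcases hA.cyl_inter γ Set.univ with ⟨hγ', _⟩ | ⟨_, h2⟩
    · exact absurd hγ' hγ
    · rw [Set.inter_univ] at h2
      rw [h1, h2, measure_empty, measure_empty]

theorem quenchedLaw_inter_shift {d : ℕ} (x y : Site d) (ω : Env d) {n : ℕ} {A S : Set (Path d)}
    (hA : DeterminedBy n A) (hAy : ∀ X ∈ A, X n = y) (hS : MeasurableSet S) :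
    quenchedLaw x ω (A ∩ shift n ⁻¹' S) = quenchedLaw x ω A * quenchedLaw y ω S :=
  hA.measure_inter_eq_mul (measurable_shift n hS) fun γ hγ => by
    rw [quenchedLaw_cyl_inter_shift _ _ _ _ hS, hAy γ hγ]

theorem quenchedLaw_one {d : ℕ} (x : Site d) (ω : Env d) (s : Set (Site d)) :
    quenchedLaw x ω {X | X 1 ∈ s} = stepLaw ω x s := by
  classical
  have h : {X : Path d | X 1 ∈ s} = shift 1 ⁻¹' {X | X 0 ∈ s} := rfl
  have h0 : ∀ z : Site d, quenchedLaw z ω {X | X 0 ∈ s} = Measure.dirac z s := by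
    intro z
    have : quenchedLaw z ω {X | X 0 ∈ s} = quenchedLaw z ω {_X | z ∈ s} := by
      refine measure_congr ?_
      filter_upwards [quenchedLaw_start z ω] with X hX
      exact congrArg (· ∈ s) hX
    rw [this, Measure.dirac_apply' _ s.to_countable.measurableSet, Set.indicator_apply]
    by_cases hz : z ∈ s <;> simp [hz]
  rw [h, quenchedLaw_shift_one x ω (measurableSet_coord 0 s)]
  simp only [h0, stepLaw, Measure.finsetSum_apply, Measure.smul_apply, smul_eq_mul]

theorem map_restrict_next {d : ℕ} (x y : Site d) (ω : Env d) {n : ℕ} {A : Set (Path d)}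
    (hA : DeterminedBy n A) (hAy : ∀ X ∈ A, X n = y) :
    Measure.map (fun X : Path d => X (n + 1)) ((quenchedLaw x ω).restrict A) =
      quenchedLaw x ω A • stepLaw ω y := by
  refine Measure.ext fun s hs => ?_
  rw [Measure.map_apply (measurable_coord _) hs,
    Measure.restrict_apply (measurable_coord _ hs), Set.inter_comm, Measure.smul_apply,
    smul_eq_mul, ← quenchedLaw_one, ← quenchedLaw_inter_shift x y ω hA hAy (measurableSet_coord 1 s)]
  rfl

/-- The walk is nearest-neighbour. -/
theorem quenchedLaw_nearest {d : ℕ} (x : Site d) (ω : Env d) :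
    ∀ᵐ X ∂(quenchedLaw x ω), ∀ n, l1norm (X (n + 1) - X n) = 1 := by
  rw [ae_all_iff]
  intro n
  have hy : ∀ y : Site d, ∀ᵐ X ∂(quenchedLaw x ω), X n = y → l1norm (X (n + 1) - y) = 1 := by
    intro y
    have hA : DeterminedBy n {X : Path d | X n = y} := fun X X' h hX =>
      (h n le_rfl).symm.trans hX
    have h1 := congrArg (fun ν => ν {z | ¬ l1norm (z - y) = 1})
      (map_restrict_next x y ω hA fun X hX => hX)
    simp only [Measure.smul_apply, smul_eq_mul] at h1
    have h2 : stepLaw ω y {z | ¬ l1norm (z - y) = 1} = 0 := by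
      simp only [stepLaw, Measure.finsetSum_apply, Measure.smul_apply, smul_eq_mul]
      refine Finset.sum_eq_zero fun e _ => ?_
      rw [Measure.dirac_apply' _ (Set.to_countable _).measurableSet]
      have : y + e.1 ∉ {z | ¬ l1norm (z - y) = 1} := by
        simp only [Set.mem_ofPred_eq, not_not, add_sub_cancel_left]
        exact e.2
      rw [Set.indicator_of_notMem this, mul_zero]
    rw [h2, mul_zero, Measure.map_apply (measurable_coord _) (Set.to_countable _).measurableSet,
      Measure.restrict_apply (measurable_coord _ (Set.to_countable _).measurableSet)] at h1
    rw [ae_iff]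
    refine measure_mono_null ?_ h1
    intro X hX
    have hX : ¬ (X n = y → l1norm (X (n + 1) - y) = 1) := hX
    push Not at hX
    exact ⟨hX.2, hX.1⟩
  filter_upwards [ae_all_iff.2 hy] with X hX
  exact hX (X n) rfl

/-- The generator of the walk, `∑_e p(e) (F(y + e) - F(y))`. -/
noncomputable def generator {d : ℕ} (F : Site d → ℝ) (y : Site d) (p : ProbVec d) : ℝ :=
  ∑ e : V d, p.1 e * (F (y + e.1) - F y)

theorem integral_stepLaw {d : ℕ} (ω : Env d) (y : Site d) (G : Site d → ℝ) :
    ∫ z, G z ∂(stepLaw ω y) = ∑ e : V d, (ω y).1 e * G (y + e.1) := by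
  rw [stepLaw, integral_finsetSum_measure]
  · refine Finset.sum_congr rfl fun e _ => ?_
    rw [integral_smul_measure, integral_dirac, ENNReal.toReal_ofReal ((ω y).2.1 e), smul_eq_mul]
  · intro e _
    exact (integrable_dirac (by simp)).smul_measure ENNReal.ofReal_ne_top

theorem integral_surv_increment {d : ℕ} (x : Site d) (ω : Env d) (B : Set (Site d)) (y : Site d)
    (n : ℕ) (F : Site d → ℝ) :
    ∫ X in surv B y n, (F (X (n + 1)) - F (X n)) ∂(quenchedLaw x ω) =
      (quenchedLaw x ω (surv B y n)).toReal * generator F y (ω y) := by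
  have hA : DeterminedBy n (surv B y n) := fun X X' h hX =>
    ⟨fun k hk => h k hk.le ▸ hX.1 k hk, h n le_rfl ▸ hX.2⟩
  have h1 : ∫ X in surv B y n, (F (X (n + 1)) - F (X n)) ∂(quenchedLaw x ω) =
      ∫ X in surv B y n, (fun z => F z - F y) (X (n + 1)) ∂(quenchedLaw x ω) :=
    setIntegral_congr_fun (measurableSet_surv B y n) fun X hX => by
      simp only [hX.2]
  rw [h1, ← integral_map (f := fun z => F z - F y) (measurable_coord (n + 1)).aemeasurable
    (measurable_of_countable _).aestronglyMeasurable,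
    map_restrict_next x y ω hA fun X hX => hX.2, integral_smul_measure, integral_stepLaw,
    smul_eq_mul, generator]

open Classical in
/-- `F` along the trajectory stopped when leaving `B`, as a sum of increments. -/
noncomputable def stopped {d : ℕ} (B : Set (Site d)) (F : Site d → ℝ) (N : ℕ) (X : Path d) : ℝ :=
  F (X 0) + ∑ n ∈ Finset.range N, if ∀ k ≤ n, X k ∈ B then F (X (n + 1)) - F (X n) else 0

/-- The telescoping sum freezes at m, the minimum of N and the exit time from B. -/
theorem stopped_eq {d : ℕ} (B : Set (Site d)) (F : Site d → ℝ) (N : ℕ) (X : Path d) :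
    ∃ m ≤ N, stopped B F N X = F (X m) ∧ (m = N ∨ X m ∉ B) ∧ ∀ k < m, X k ∈ B := by
  classical
  induction N with
  | zero => exact ⟨0, le_rfl, by simp [stopped], Or.inl rfl, by simp⟩
  | succ N ih =>
    obtain ⟨m, hm, h1, h2, h3⟩ := ih
    have hs : stopped B F (N + 1) X = stopped B F N X +
        if ∀ k ≤ N, X k ∈ B then F (X (N + 1)) - F (X N) else 0 := by
      rw [stopped, Finset.sum_range_succ, ← add_assoc, stopped]
    by_cases hN : ∀ k ≤ N, X k ∈ B
    · have hmN : m = N := h2.resolve_right (not_not.2 (hN m hm))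
      refine ⟨N + 1, le_rfl, ?_, Or.inl rfl, fun k hk => hN k (by omega)⟩
      rw [hs, if_pos hN, h1, hmN]
      ring
    · refine ⟨m, by omega, by rw [hs, if_neg hN, h1, add_zero], Or.inr fun hmB => ?_, h3⟩
      refine hN fun k hk => ?_
      rcases h2 with rfl | h2
      · rcases hk.lt_or_eq with h | rfl
        · exact h3 k h
        · exact hmB
      · exact absurd hmB h2

/-- Dynkin's formula: each increment is sorted by the site y of B it starts from, and the Markov
property replaces it by the generator at y weighted by the occupation probability. -/
theorem integral_stopped {d : ℕ} (x : Site d) (ω : Env d) (B : Finset (Site d)) {F : Site d → ℝ}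
    {C : ℝ} (hF : ∀ z, |F z| ≤ C) (N : ℕ) :
    Integrable (stopped (B : Set (Site d)) F N) (quenchedLaw x ω) ∧
    ∫ X, stopped (B : Set (Site d)) F N X ∂(quenchedLaw x ω) = F x +
      ∑ y ∈ B, (∑ n ∈ Finset.range N, (quenchedLaw x ω (surv (B : Set (Site d)) y n)).toReal) *
        generator F y (ω y) := by
  classical
  have hFm : ∀ n, Measurable fun X : Path d => F (X n) := fun n =>
    (measurable_of_countable F).comp (measurable_pi_apply n)
  have hFint : ∀ n, Integrable (fun X : Path d => F (X n)) (quenchedLaw x ω) := fun n =>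
    Integrable.of_bound (hFm n).aestronglyMeasurable C (ae_of_all _ fun X => hF _)
  have hind : ∀ (n : ℕ) (X : Path d),
      (if ∀ k ≤ n, X k ∈ (B : Set (Site d)) then F (X (n + 1)) - F (X n) else 0) =
        ∑ y ∈ B, (surv (B : Set (Site d)) y n).indicator
          (fun X : Path d => F (X (n + 1)) - F (X n)) X := by
    intro n X
    split_ifs with h
    · rw [Finset.sum_eq_single_of_mem (X n) (h n le_rfl)]
      · rw [Set.indicator_of_mem (show X ∈ surv (B : Set (Site d)) (X n) n from
          ⟨fun k hk => h k hk.le, rfl⟩)]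
      · intro y _ hy
        exact Set.indicator_of_notMem (fun hX => hy hX.2.symm) _
    · refine (Finset.sum_eq_zero fun y hy => Set.indicator_of_notMem (fun hX => h ?_) _).symm
      intro k hk
      rcases hk.lt_or_eq with h' | rfl
      · exact hX.1 k h'
      · exact hX.2 ▸ hy
  have hint : ∀ (n : ℕ) (y : Site d), Integrable ((surv (B : Set (Site d)) y n).indicator
      (fun X : Path d => F (X (n + 1)) - F (X n))) (quenchedLaw x ω) := fun n y =>
    ((hFint (n + 1)).sub (hFint n)).indicator (measurableSet_surv _ y n)
  have heq : stopped (B : Set (Site d)) F N = fun X : Path d => F (X 0) +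
      ∑ n ∈ Finset.range N, ∑ y ∈ B, (surv (B : Set (Site d)) y n).indicator
          (fun X : Path d => F (X (n + 1)) - F (X n)) X := by
    ext X
    rw [stopped]
    congr 1
    exact Finset.sum_congr rfl fun n _ => by rw [← hind]; congr
  have hsum : ∀ n, Integrable (fun X => ∑ y ∈ B, (surv (B : Set (Site d)) y n).indicator
          (fun X : Path d => F (X (n + 1)) - F (X n)) X) (quenchedLaw x ω) := fun n =>
    integrable_finsetSum _ fun y _ => hint n y
  rw [heq]
  refine ⟨(hFint 0).add (integrable_finsetSum _ fun n _ => hsum n), ?_⟩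
  rw [integral_add (hFint 0) (integrable_finsetSum _ fun n _ => hsum n),
    integral_finsetSum _ fun n _ => hsum n]
  congr 1
  · rw [integral_congr_ae (g := fun _ => F x)]
    · simp
    · filter_upwards [quenchedLaw_start x ω] with X hX
      rw [hX]
  · simp only [Finset.sum_mul]
    rw [Finset.sum_comm (s := B)]
    refine Finset.sum_congr rfl fun n _ => ?_
    rw [integral_finsetSum _ fun y _ => hint n y]
    refine Finset.sum_congr rfl fun y _ => ?_
    rw [integral_indicator (measurableSet_surv _ y n), integral_surv_increment]

/-! ### The annealed law of the trajectory -/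

/-- The annealed law of the trajectory. -/
noncomputable def pathLaw {d : ℕ} (μ : Measure (ProbVec d)) (x : Site d) : Measure (Path d) :=
  (envLaw μ).bind (quenchedLaw x)

theorem pathLaw_apply {d : ℕ} (μ : Measure (ProbVec d)) (x : Site d) {S : Set (Path d)}
    (hS : MeasurableSet S) : pathLaw μ x S = ∫⁻ ω, quenchedLaw x ω S ∂(envLaw μ) :=
  Measure.bind_apply hS (measurable_quenchedLaw x).aemeasurable

instance {d : ℕ} (μ : Measure (ProbVec d)) [IsProbabilityMeasure μ] (x : Site d) :
    IsProbabilityMeasure (pathLaw μ x) := by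
  constructor
  rw [pathLaw_apply μ x MeasurableSet.univ]
  simp

theorem pathLaw_real_apply {d : ℕ} (μ : Measure (ProbVec d)) (x : Site d) {S : Set (Path d)}
    (hS : MeasurableSet S) :
    (pathLaw μ x).real S = ∫ ω, (quenchedLaw x ω).real S ∂(envLaw μ) := by
  rw [measureReal_def, pathLaw_apply μ x hS, ← integral_toReal]
  · rfl
  · exact (measurable_quenchedLaw_apply x hS).aemeasurable
  · exact ae_of_all _ fun ω => measure_lt_top _ _

theorem ae_pathLaw {d : ℕ} {μ : Measure (ProbVec d)} {x : Site d} {p : Path d → Prop}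
    (hp : MeasurableSet {X | p X}) (h : ∀ᵐ ω ∂(envLaw μ), ∀ᵐ X ∂(quenchedLaw x ω), p X) :
    ∀ᵐ X ∂(pathLaw μ x), p X := by
  rw [ae_iff]
  change pathLaw μ x {X | p X}ᶜ = 0
  rw [pathLaw_apply μ x hp.compl,
    lintegral_eq_zero_iff (measurable_quenchedLaw_apply x hp.compl)]
  exact h

theorem ae_annealedLaw {d : ℕ} {μ : Measure (ProbVec d)} [IsProbabilityMeasure μ] {x : Site d}
    {p : Path d → Prop} (h : ∀ᵐ X ∂(pathLaw μ x), p X) : ∀ᵐ z ∂(annealedLaw μ x), p z.2 := by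
  have : Measure.map Prod.snd (annealedLaw μ x) = pathLaw μ x := by
    refine Measure.ext fun S hS => ?_
    rw [Measure.map_apply measurable_snd hS, annealedLaw,
      Measure.compProd_apply (measurable_snd hS), pathLaw_apply μ x hS]
    rfl
  rw [← this] at h
  exact ae_of_ae_map measurable_snd.aemeasurable h

theorem pathLaw_start {d : ℕ} (μ : Measure (ProbVec d)) (x : Site d) :
    ∀ᵐ X ∂(pathLaw μ x), X 0 = x :=
  ae_pathLaw (measurableSet_coord 0 {x}) (ae_of_all _ fun ω => quenchedLaw_start x ω)

/-- The trajectories with nearest-neighbour steps. -/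
def IsNearest {d : ℕ} (X : Path d) : Prop := ∀ n, l1norm (X (n + 1) - X n) = 1

theorem measurableSet_isNearest {d : ℕ} : MeasurableSet {X : Path d | IsNearest X} := by
  have : {X : Path d | IsNearest X} =
      ⋂ n, (fun X : Path d => X (n + 1) - X n) ⁻¹' {v | l1norm v = 1} := by
    ext X; simp [IsNearest]
  rw [this]
  exact MeasurableSet.iInter fun n =>
    ((measurable_coord (n + 1)).sub (measurable_coord n)) (Set.to_countable _).measurableSet

theorem pathLaw_nearest {d : ℕ} (μ : Measure (ProbVec d)) (x : Site d) :
    ∀ᵐ X ∂(pathLaw μ x), IsNearest X :=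
  ae_pathLaw measurableSet_isNearest (ae_of_all _ fun ω => quenchedLaw_nearest x ω)

theorem IsNearest.abs_step_le {d : ℕ} {X : Path d} (hX : IsNearest X) (n : ℕ) (i : Fin d) :
    |X (n + 1) i - X n i| ≤ 1 :=
  abs_apply_le_one ⟨X (n + 1) - X n, hX n⟩ i

theorem IsNearest.abs_sub_le {d : ℕ} {X : Path d} (hX : IsNearest X) (n : ℕ) (i : Fin d) :
    |X n i - X 0 i| ≤ n := by
  induction n with
  | zero => simp
  | succ n ih =>
    have := hX.abs_step_le n i
    rw [abs_le] at *
    push_cast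
    omega

/-! ### Kalikow's comparison for finite sets -/

/-- Dynkin's formula is averaged over the environment and the occupation sums are completed to Green
functions. The terms a(y)·E[g(drift - κ)] are then nonnegative and can be dropped, leaving ρ times
the expected time in B. The set A records a loss c' in the final value of F. -/
theorem kalikow_comparison {d : ℕ} (hd : 0 < d) {μ : Measure (ProbVec d)}
    [IsProbabilityMeasure μ] (hε : epsilon μ ∈ Set.Ioo (0 : ℝ) 1) (B : Finset (Site d))
    {F : Site d → ℝ} {C : ℝ} (hF : ∀ z, |F z| ≤ C) {a : Site d → ℝ} (ha : ∀ y ∈ B, 0 ≤ a y) {ρ : ℝ}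
    (hgen : ∀ y ∈ B, ∀ p : ProbVec d,
      a y * (driftDot p.1 (e1 hd) - driftBound μ (e1 hd)) + ρ ≤ generator F y p)
    (hρ : 0 ≤ ρ) {A : Set (Path d)} (hA : MeasurableSet A) {c c' : ℝ} {N₀ : ℕ}
    (hstopped : ∀ N ≥ N₀, ∀ X : Path d, X 0 = 0 → IsNearest X →
      stopped (B : Set (Site d)) F N X ≤ c - A.indicator (fun _ => c') X) (n₀ : ℕ) :
    F 0 + ρ * ∑ n ∈ Finset.range n₀,
      (pathLaw μ 0).real {X | ∀ k ≤ n, X k ∈ (B : Set (Site d))} ≤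
        c - c' * (pathLaw μ 0).real A := by
  classical
  set κ := driftBound μ (e1 hd) with hκ
  have hBne : (B : Set (Site d)) ≠ Set.univ := by
    intro h
    have : Nonempty (Fin d) := ⟨⟨0, hd⟩⟩
    exact Set.infinite_univ (h ▸ B.finite_toSet)
  set Q : Site d → ℕ → Env d → ℝ := fun y n ω =>
    (quenchedLaw 0 ω (surv (B : Set (Site d)) y n)).toReal with hQ
  set S : Site d → ℕ → Env d → ℝ := fun y N ω => ∑ n ∈ Finset.range N, Q y n ω with hS
  set g : Site d → Env d → ℝ := fun y ω => (green (B : Set (Site d)) 0 y ω).toReal with hg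
  have hQm : ∀ y n, Measurable (Q y n) := fun y n =>
    (measurable_quenchedLaw_apply 0 (measurableSet_surv _ y n)).ennreal_toReal
  have hQ0 : ∀ y n ω, 0 ≤ Q y n ω := fun _ _ _ => ENNReal.toReal_nonneg
  have hSm : ∀ y N, Measurable (S y N) := fun y N => Finset.measurable_sum _ fun n _ => hQm y n
  have hS0 : ∀ y N ω, 0 ≤ S y N ω := fun y N ω => Finset.sum_nonneg fun n _ => hQ0 y n ω
  have hfin : ∀ y ∈ B, ∀ᵐ ω ∂(envLaw μ), green (B : Set (Site d)) 0 y ω ≠ ∞ := fun y hy => by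
    obtain ⟨C', _, h⟩ := ae_green_le hd hε hBne (y := y) (Finset.mem_coe.2 hy) 0
    exact h.mono fun ω hω => ne_top_of_le_ne_top ENNReal.ofReal_ne_top hω
  have hSg : ∀ y ∈ B, ∀ᵐ ω ∂(envLaw μ), (∀ N, S y N ω ≤ g y ω) ∧
      Tendsto (fun N => S y N ω) atTop (nhds (g y ω)) := fun y hy => by
    filter_upwards [hfin y hy] with ω hω
    rw [green_eq_tsum] at hω
    have hsum : Summable fun n => Q y n ω := ENNReal.summable_toReal hω
    have hgt : g y ω = ∑' n, Q y n ω := by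
      simp only [hg, hQ]
      rw [green_eq_tsum, ENNReal.tsum_toReal_eq fun n => measure_ne_top _ _]
    rw [hgt]
    exact ⟨fun N => hsum.sum_le_tsum _ fun n _ => hQ0 y n ω, hsum.hasSum.tendsto_sum_nat⟩
  have hgint : ∀ y ∈ B, Integrable (g y) (envLaw μ) := fun y hy =>
    integrable_green hd hε hBne (Finset.mem_coe.2 hy) 0
  set f : Site d → ProbVec d → ℝ := fun y p => a y * (driftDot p.1 (e1 hd) - κ) + ρ with hf
  have hfm : ∀ y, Measurable (f y) := fun y =>
    (((measurable_driftDot _).sub_const κ).const_mul (a y)).add_const ρ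
  have hfb : ∀ y ∈ B, ∀ p, |f y p| ≤ a y * (1 + |κ|) + ρ := fun y hy p => by
    refine (abs_add_le _ _).trans (add_le_add ?_ (abs_of_nonneg hρ).le)
    rw [abs_mul, abs_of_nonneg (ha y hy)]
    exact mul_le_mul_of_nonneg_left
      ((abs_sub _ _).trans (add_le_add_left (abs_driftDot_e1_le hd p) _)) (ha y hy)
  have hSbd : ∀ y ∈ B, ∀ N, ∀ᵐ ω ∂(envLaw μ), ‖S y N ω * f y (ω y)‖ ≤
      g y ω * (a y * (1 + |κ|) + ρ) := fun y hy N => by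
    filter_upwards [hSg y hy] with ω hω
    rw [norm_mul, Real.norm_of_nonneg (hS0 y N ω)]
    exact mul_le_mul (hω.1 N) (hfb y hy (ω y)) (norm_nonneg _) ENNReal.toReal_nonneg
  have hSfm : ∀ y N, AEStronglyMeasurable (fun ω : Env d => S y N ω * f y (ω y)) (envLaw μ) :=
    fun y N => ((hSm y N).mul ((hfm y).comp (measurable_pi_apply y))).aestronglyMeasurable
  have hSfint : ∀ y ∈ B, ∀ N, Integrable (fun ω : Env d => S y N ω * f y (ω y)) (envLaw μ) :=
    fun y hy N => ((hgint y hy).mul_const _).mono' (hSfm y N) (hSbd y hy N)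
  -- The tilted inequality concerns the full Green function, not its truncations, so N tends to
  -- infinity first; the integrable function g dominates.
  have hlim : Tendsto (fun N => F 0 + ∑ y ∈ B, ∫ ω, S y N ω * f y (ω y) ∂(envLaw μ)) atTop
      (nhds (F 0 + ∑ y ∈ B, ∫ ω, g y ω * f y (ω y) ∂(envLaw μ))) := by
    refine tendsto_const_nhds.add (tendsto_finsetSum _ fun y hy => ?_)
    refine tendsto_integral_of_dominated_convergence _ (hSfm y)
      ((hgint y hy).mul_const (a y * (1 + |κ|) + ρ)) (hSbd y hy) ?_
    filter_upwards [hSg y hy] with ω hω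
    exact hω.2.mul_const _
  have hAint : Integrable (fun ω => (quenchedLaw 0 ω).real A) (envLaw μ) :=
    Integrable.of_bound (measurable_quenchedLaw_apply 0 hA).ennreal_toReal.aestronglyMeasurable 1
      (ae_of_all _ fun ω => by
        rw [Real.norm_of_nonneg measureReal_nonneg]; exact measureReal_le_one)
  have hN : ∀ N ≥ N₀, F 0 + ∑ y ∈ B, ∫ ω, S y N ω * f y (ω y) ∂(envLaw μ) ≤
      c - c' * (pathLaw μ 0).real A := by
    intro N hN
    have hquenched : ∀ ω : Env d, F 0 + ∑ y ∈ B, S y N ω * f y (ω y) ≤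
        c - c' * (quenchedLaw 0 ω).real A := by
      intro ω
      obtain ⟨hint, heq⟩ := integral_stopped 0 ω B hF N
      calc F 0 + ∑ y ∈ B, S y N ω * f y (ω y)
          ≤ F 0 + ∑ y ∈ B, S y N ω * generator F y (ω y) := by
            refine add_le_add le_rfl (Finset.sum_le_sum fun y hy => ?_)
            exact mul_le_mul_of_nonneg_left (hgen y hy (ω y)) (hS0 y N ω)
        _ = ∫ X, stopped (B : Set (Site d)) F N X ∂(quenchedLaw 0 ω) := heq.symm
        _ ≤ ∫ X, (c - A.indicator (fun _ => c') X) ∂(quenchedLaw 0 ω) := by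
            refine integral_mono_ae hint
              ((integrable_const c).sub ((integrable_const c').indicator hA)) ?_
            filter_upwards [quenchedLaw_start 0 ω, quenchedLaw_nearest 0 ω] with X h1 h2
            exact hstopped N hN X h1 h2
        _ = c - c' * (quenchedLaw 0 ω).real A := by
            rw [integral_sub (integrable_const c) ((integrable_const c').indicator hA),
              integral_indicator hA, setIntegral_const]
            simp [mul_comm]
    have := integral_mono (μ := envLaw μ)
      ((integrable_const (F 0)).add (integrable_finsetSum B fun y hy => hSfint y hy N))
      ((integrable_const c).sub (hAint.const_mul c')) hquenched
    simp only [Pi.add_apply, Pi.sub_apply] at this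
    rw [integral_add (integrable_const _) (integrable_finsetSum B fun y hy => hSfint y hy N),
      integral_sub (integrable_const _) (hAint.const_mul c'),
      integral_finsetSum B fun y hy => hSfint y hy N, integral_const_mul,
      ← pathLaw_real_apply μ 0 hA] at this
    simpa using this
  have hle := le_of_tendsto hlim (eventually_atTop.2 ⟨N₀, hN⟩)
  refine le_trans (add_le_add le_rfl ?_) hle
  -- Here `integral_green_drift_nonneg` enters, multiplied by a(y) ≥ 0.
  have hgf : ∀ y ∈ B, ρ * ∫ ω, g y ω ∂(envLaw μ) ≤ ∫ ω, g y ω * f y (ω y) ∂(envLaw μ) := by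
    intro y hy
    have h1 := integral_green_drift_nonneg hd hε hBne (y := y) (Finset.mem_coe.2 hy) 0
    have hint1 := integrable_green_mul hd hε hBne (y := y) (Finset.mem_coe.2 hy) 0
      (f := fun p => driftDot p.1 (e1 hd) - κ) ((measurable_driftDot _).sub_const κ) (C := 1 + |κ|)
      fun p => (abs_sub _ _).trans (add_le_add_left (abs_driftDot_e1_le hd p) _)
    have h2 : ∀ ω : Env d, g y ω * f y (ω y) =
        a y * (g y ω * (driftDot (ω y).1 (e1 hd) - κ)) + ρ * g y ω := fun ω => by
      simp only [hf]; ring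
    simp only [h2]
    rw [integral_add (hint1.const_mul _) ((hgint y hy).const_mul _), integral_const_mul,
      integral_const_mul]
    exact le_add_of_nonneg_left (mul_nonneg (ha y hy) h1)
  refine le_trans ?_ (Finset.sum_le_sum hgf)
  rw [← Finset.mul_sum]
  refine mul_le_mul_of_nonneg_left ?_ hρ
  have hQint : ∀ y n, Integrable (Q y n) (envLaw μ) := fun y n =>
    Integrable.of_bound (hQm y n).aestronglyMeasurable 1 (ae_of_all _ fun ω => by
      rw [Real.norm_of_nonneg (hQ0 y n ω)]; exact measureReal_le_one)
  -- Staying in B through time n is split according to the position at time n.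
  calc ∑ n ∈ Finset.range n₀, (pathLaw μ 0).real {X | ∀ k ≤ n, X k ∈ (B : Set (Site d))}
      = ∑ n ∈ Finset.range n₀, ∑ y ∈ B, ∫ ω, Q y n ω ∂(envLaw μ) := by
        refine Finset.sum_congr rfl fun n _ => ?_
        have hset : {X : Path d | ∀ k ≤ n, X k ∈ (B : Set (Site d))} =
            ⋃ y ∈ B, surv (B : Set (Site d)) y n := by
          ext X
          simp only [Set.mem_ofPred_eq, Set.mem_iUnion, surv, exists_prop]
          constructor
          · exact fun h => ⟨X n, h n le_rfl, fun k hk => h k hk.le, rfl⟩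
          · rintro ⟨y, hy, h, hn⟩ k hk
            rcases hk.lt_or_eq with h' | rfl
            · exact h k h'
            · rw [hn]; exact hy
        rw [hset, measureReal_biUnion_finset]
        · exact Finset.sum_congr rfl fun y _ => pathLaw_real_apply μ 0 (measurableSet_surv _ y n)
        · intro y _ y' _ hyy'
          rw [Function.onFun, Set.disjoint_left]
          exact fun X h1 h2 => hyy' (h1.2.symm.trans h2.2)
        · exact fun y _ => measurableSet_surv _ y n
    _ = ∑ y ∈ B, ∫ ω, S y n₀ ω ∂(envLaw μ) := by
        rw [Finset.sum_comm]
        exact Finset.sum_congr rfl fun y _ => (integral_finsetSum _ fun n _ => hQint y n).symm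
    _ ≤ ∑ y ∈ B, ∫ ω, g y ω ∂(envLaw μ) := by
        refine Finset.sum_le_sum fun y hy => ?_
        refine integral_mono_ae (integrable_finsetSum _ fun n _ => hQint y n) (hgint y hy) ?_
        filter_upwards [hSg y hy] with ω hω
        exact hω.1 n₀

/-! ### Passage times and backtracking -/

theorem measurableSet_forall_le {d : ℕ} (s : Set (Site d)) (n : ℕ) :
    MeasurableSet {X : Path d | ∀ k ≤ n, X k ∈ s} := by
  simpa only [Nat.lt_succ_iff] using measurableSet_forall_lt s (n + 1)

/-- A lattice box, intersected with a half-space. -/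
noncomputable def slab {d : ℕ} (R : ℕ) (s : Set (Site d)) : Finset (Site d) :=
  open Classical in
  (Fintype.piFinset fun _ : Fin d => Finset.Icc (-(R : ℤ)) R).filter (· ∈ s)

theorem mem_slab {d : ℕ} {R : ℕ} {s : Set (Site d)} {y : Site d} :
    y ∈ slab R s ↔ (∀ i, |y i| ≤ R) ∧ y ∈ s := by
  simp [slab, abs_le]

/-- The comparison needs finite sets. A nearest-neighbour path from 0 cannot leave the box of radius
R before time R, so until then the slab is as good as s. -/
theorem IsNearest.mem_slab_iff {d : ℕ} {X : Path d} (hX : IsNearest X) (h0 : X 0 = 0) {R n : ℕ}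
    (hn : n ≤ R) (s : Set (Site d)) : X n ∈ slab R s ↔ X n ∈ s := by
  refine mem_slab.trans ⟨fun h => h.2, fun h => ⟨fun i => ?_, h⟩⟩
  have := hX.abs_sub_le n i
  rw [h0] at this
  simp only [Pi.zero_apply, sub_zero] at this
  omega

/-- The annealed walk reaches the level `M` in expected time at most `M / driftBound`. -/
theorem driftBound_mul_sum_le {d : ℕ} (hd : 0 < d) {μ : Measure (ProbVec d)}
    [IsProbabilityMeasure μ] (hε : epsilon μ ∈ Set.Ioo (0 : ℝ) 1)
    (hκ : 0 < driftBound μ (e1 hd)) (M n₀ : ℕ) :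
    driftBound μ (e1 hd) * ∑ n ∈ Finset.range n₀,
      (pathLaw μ 0).real {X | ∀ k ≤ n, X k ⟨0, hd⟩ < M} ≤ M := by
  set i : Fin d := ⟨0, hd⟩ with hi
  set s : Set (Site d) := {y | y i < M} with hs
  -- The first coordinate, clipped to be bounded. On the slab and its neighbours the clipping is
  -- inactive, so the generator is exactly the local drift, and F ≤ M throughout.
  set F : Site d → ℝ := fun y => ((min (max (y i) (-(n₀ + 1))) M : ℤ) : ℝ) with hF
  have hFb : ∀ z, |F z| ≤ ((n₀ + 1 + M : ℤ) : ℝ) := by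
    intro z
    simp only [hF]
    rw [← Int.cast_abs]
    refine Int.cast_le.2 (abs_le.2 ⟨?_, ?_⟩) <;> omega
  have hgen : ∀ y ∈ slab n₀ s, ∀ p : ProbVec d,
      1 * (driftDot p.1 (e1 hd) - driftBound μ (e1 hd)) + driftBound μ (e1 hd) ≤
        generator F y p := by
    intro y hy p
    refine le_of_eq ?_
    rw [one_mul, sub_add_cancel, driftDot, generator]
    refine Finset.sum_congr rfl fun e _ => ?_
    rw [dot_e1, ← hi]
    congr 1
    have h1 := abs_le.1 ((mem_slab.1 hy).1 i)
    have h2 : y i < M := (mem_slab.1 hy).2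
    have h3 := abs_le.1 (abs_apply_le_one e i)
    simp only [hF, Pi.add_apply]
    rw [← Int.cast_sub]
    congr 1
    omega
  have := kalikow_comparison hd hε (slab n₀ s) hFb (a := fun _ => 1) (fun _ _ => zero_le_one)
    hgen hκ.le (A := ∅) MeasurableSet.empty (c := M) (c' := 0) (N₀ := 0)
    (fun N _ X _ _ => by
      obtain ⟨m, -, h, -⟩ := stopped_eq (slab n₀ s : Set (Site d)) F N X
      rw [h, Set.indicator_empty, sub_zero]
      simp only [hF]
      exact_mod_cast min_le_right _ _) n₀
  have hF0 : F 0 = 0 := by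
    simp only [hF, Pi.zero_apply]
    rw [Int.cast_eq_zero]
    omega
  rw [hF0, zero_add, zero_mul, sub_zero] at this
  refine le_trans (le_of_eq ?_) this
  congr 1
  refine Finset.sum_congr rfl fun n hn => measureReal_congr ?_
  filter_upwards [pathLaw_start μ 0, pathLaw_nearest μ 0] with X h0 hX
  refine propext (forall₂_congr fun k hk => ?_)
  exact (hX.mem_slab_iff h0 (hk.trans (Finset.mem_range.1 hn).le) s).symm

/-- The annealed walk has a positive probability of never going below its starting level. -/
theorem exists_backtrack_bound {d : ℕ} (hd : 0 < d) {μ : Measure (ProbVec d)}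
    [IsProbabilityMeasure μ] (hε : epsilon μ ∈ Set.Ioo (0 : ℝ) 1)
    (hκ : 0 < driftBound μ (e1 hd)) :
    ∃ q : ℝ, q < 1 ∧ ∀ R : ℕ,
      (pathLaw μ 0).real {X | ∀ k ≤ R, 0 ≤ X k ⟨0, hd⟩}ᶜ ≤ q := by
  set i : Fin d := ⟨0, hd⟩ with hi
  set κ := driftBound μ (e1 hd) with hκdef
  -- θ ≤ 1 permits exp(-θt) ≤ 1 - θt + θ²t² for |t| ≤ 1, and θ ≤ κ lets the drift term θκ absorb the
  -- error θ².
  set θ : ℝ := min κ 1 with hθ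
  have hθ0 : 0 < θ := lt_min hκ one_pos
  refine ⟨Real.exp (-θ), Real.exp_lt_one_iff.2 (by linarith), fun R => ?_⟩
  set s : Set (Site d) := {y | 0 ≤ y i} with hs
  -- The cut at -1 keeps F bounded and is inactive on neighbours of levels ≥ 0.
  set F : Site d → ℝ := fun y => -Real.exp (-θ * ((max (y i) (-1) : ℤ) : ℝ)) with hF
  have hFb : ∀ z, |F z| ≤ Real.exp θ := by
    intro z
    simp only [hF]
    rw [abs_neg, abs_of_pos (Real.exp_pos _)]
    refine Real.exp_le_exp.2 ?_
    have : (-1 : ℝ) ≤ ((max (z i) (-1) : ℤ) : ℝ) := by exact_mod_cast le_max_right _ _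
    nlinarith
  have hgen : ∀ y ∈ slab R s, ∀ p : ProbVec d,
      θ * Real.exp (-θ * (y i : ℝ)) * (driftDot p.1 (e1 hd) - κ) + 0 ≤ generator F y p := by
    intro y hy p
    have hy0 : 0 ≤ y i := (mem_slab.1 hy).2
    have hstep : ∀ e : V d, p.1 e * (Real.exp (-θ * (y i : ℝ)) *
        (θ * dot e.1 (e1 hd) - θ ^ 2)) ≤ p.1 e * (F (y + e.1) - F y) := by
      intro e
      refine mul_le_mul_of_nonneg_left ?_ (p.2.1 e)
      have h3 := abs_apply_le_one e i
      have h3' := abs_le.1 h3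
      rw [dot_e1, ← hi]
      simp only [hF, Pi.add_apply]
      rw [max_eq_left (by omega), max_eq_left (by omega)]
      set t : ℝ := (e.1 i : ℝ) with ht
      have ht1 : |t| ≤ 1 := by rw [ht, ← Int.cast_abs]; exact_mod_cast h3
      have habs : |-θ * t| ≤ 1 := by
        rw [abs_mul, abs_neg, abs_of_pos hθ0]
        exact mul_le_one₀ (min_le_right _ _) (abs_nonneg _) ht1
      have hexp := (abs_le.1 (Real.abs_exp_sub_one_sub_id_le habs)).2
      have ht2 : t ^ 2 ≤ 1 := (sq_le_one_iff_abs_le_one t).2 ht1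
      have hsplit : Real.exp (-θ * ((y i + e.1 i : ℤ) : ℝ)) =
          Real.exp (-θ * (y i : ℝ)) * Real.exp (-θ * t) := by
        rw [← Real.exp_add, Int.cast_add, mul_add]
      rw [hsplit]
      have hpos := Real.exp_pos (-θ * (y i : ℝ))
      have : θ * t - θ ^ 2 ≤ 1 - Real.exp (-θ * t) := by nlinarith [sq_nonneg θ]
      nlinarith
    refine le_trans ?_ (Finset.sum_le_sum fun e _ => hstep e)
    have hsum : ∑ e : V d, p.1 e * (Real.exp (-θ * (y i : ℝ)) *
        (θ * dot e.1 (e1 hd) - θ ^ 2)) =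
        Real.exp (-θ * (y i : ℝ)) * (θ * driftDot p.1 (e1 hd) - θ ^ 2) := by
      have h1 : ∀ e : V d, p.1 e * (Real.exp (-θ * (y i : ℝ)) *
          (θ * dot e.1 (e1 hd) - θ ^ 2)) =
          Real.exp (-θ * (y i : ℝ)) * θ * (p.1 e * dot e.1 (e1 hd)) -
          Real.exp (-θ * (y i : ℝ)) * θ ^ 2 * p.1 e := fun e => by ring
      simp only [h1]
      rw [Finset.sum_sub_distrib, ← Finset.mul_sum, ← Finset.mul_sum, p.2.2, driftDot]
      ring
    rw [hsum]
    have hθκ : θ * θ ≤ θ * κ := mul_le_mul_of_nonneg_left (min_le_left _ _) hθ0.le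
    have := mul_le_mul_of_nonneg_left hθκ (Real.exp_pos (-θ * (y i : ℝ))).le
    nlinarith
  have hA : MeasurableSet {X : Path d | ∀ k ≤ R, 0 ≤ X k i}ᶜ := (measurableSet_forall_le s R).compl
  -- Here ρ = 0. If the path goes below level 0 by time R, it is stopped there with F = -exp θ;
  -- otherwise F ≤ 0. Since F 0 = -1, the probability of backtracking is at most exp(-θ).
  have := kalikow_comparison hd hε (slab R s) hFb
    (a := fun y => θ * Real.exp (-θ * (y i : ℝ))) (fun _ _ => by positivity)
    hgen le_rfl hA (c := 0) (c' := Real.exp θ) (N₀ := R)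
    (fun N hN X h0 hX => by
      obtain ⟨m, hmN, h, h1, h2⟩ := stopped_eq (slab R s : Set (Site d)) F N X
      rw [h]
      by_cases hXA : X ∈ {X : Path d | ∀ k ≤ R, 0 ≤ X k i}ᶜ
      · rw [Set.indicator_of_mem hXA, zero_sub]
        have hXA' : ¬ ∀ k ≤ R, 0 ≤ X k i := hXA
        push Not at hXA'
        obtain ⟨k, hk, hXk⟩ := hXA'
        have hkB : X k ∉ slab R s := fun hkB => by
          have : 0 ≤ X k i := (mem_slab.1 hkB).2
          omega
        -- The stopping index is at most R, so the slab was left through level 0 and not through the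
        -- side of the box.
        have hmk : m ≤ k := by
          by_contra hmk
          exact hkB (h2 k (by omega))
        have hXm : X m ∉ s := by
          rw [← hX.mem_slab_iff h0 (hmk.trans hk)]
          rcases h1 with rfl | h1
          · rwa [show m = k by omega]
          · exact h1
        have hXm' : X m i < 0 := not_le.1 hXm
        simp only [hF]
        rw [max_eq_right (by omega)]
        simp
      · rw [Set.indicator_of_notMem hXA, sub_zero]
        simp only [hF]
        exact neg_nonpos.2 (Real.exp_pos _).le) 0
  have hF0 : F 0 = -1 := by simp [hF]
  rw [hF0, zero_mul, add_zero, zero_sub, neg_le_neg_iff] at this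
  rw [Real.exp_neg, ← one_div, le_div_iff₀ (Real.exp_pos θ), mul_comm]
  exact this

/-! ### Independence at passage times -/

/-- The trajectories that stay above the barrier `b` for `n` steps, relative to their start. -/
def rise {d : ℕ} (i : Fin d) (b : ℕ → ℝ) (n : ℕ) : Set (Path d) :=
  {X | ∀ k, 0 < k → k ≤ n → b k < ((X k i - X 0 i : ℤ) : ℝ)}

/-- The trajectories that stay above the barrier `b` forever, relative to their start. -/
def riseForever {d : ℕ} (i : Fin d) (b : ℕ → ℝ) : Set (Path d) := ⋂ n, rise i b n

theorem mem_riseForever {d : ℕ} {i : Fin d} {b : ℕ → ℝ} {X : Path d} :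
    X ∈ riseForever i b ↔ ∀ k, 0 < k → b k < ((X k i - X 0 i : ℤ) : ℝ) := by
  simp only [riseForever, Set.mem_iInter, rise, Set.mem_ofPred_eq]
  exact ⟨fun h k hk => h k k hk le_rfl, fun h n k hk _ => h k hk⟩

theorem determinedBy_rise {d : ℕ} (i : Fin d) (b : ℕ → ℝ) (n : ℕ) :
    DeterminedBy n (rise i b n) := fun X X' h hX k hk hkn => by
  rw [← h k hkn, ← h 0 (Nat.zero_le n)]
  exact hX k hk hkn

theorem measurableSet_rise {d : ℕ} (i : Fin d) (b : ℕ → ℝ) (n : ℕ) :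
    MeasurableSet (rise i b n) := (determinedBy_rise i b n).measurableSet

theorem measurableSet_riseForever {d : ℕ} (i : Fin d) (b : ℕ → ℝ) :
    MeasurableSet (riseForever i b) := MeasurableSet.iInter fun n => measurableSet_rise i b n

theorem antitone_rise {d : ℕ} (i : Fin d) (b : ℕ → ℝ) : Antitone (rise i b) :=
  fun _ _ h _ hX k hk hkn => hX k hk (hkn.trans h)

/-- Levels are integers, so staying strictly above a barrier ≥ -1 means never going below the start.
-/
theorem le_of_mem_rise {d : ℕ} {i : Fin d} {b : ℕ → ℝ} (hb : ∀ k, -1 ≤ b k) {n : ℕ} {X : Path d}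
    (hX : X ∈ rise i b n) {k : ℕ} (hk : k ≤ n) : X 0 i ≤ X k i := by
  rcases Nat.eq_zero_or_pos k with rfl | h
  · exact le_rfl
  · have h1 := (hb k).trans_lt (hX k h hk)
    have h2 : (-1 : ℤ) < X k i - X 0 i := by exact_mod_cast h1
    omega

/-- Each trajectory of the event steps only from sites at or above its starting level. -/
theorem quenchedLaw_rise_congr {d : ℕ} {i : Fin d} {b : ℕ → ℝ} (hb : ∀ k, -1 ≤ b k) (n : ℕ)
    (z : Site d) {ω ω' : Env d} (h : ∀ y : Site d, z i ≤ y i → ω y = ω' y) :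
    quenchedLaw z ω (rise i b n) = quenchedLaw z ω' (rise i b n) := by
  refine measure_congr_cyl n (measurableSet_rise i b n) (measurableSet_rise i b n) fun γ => ?_
  have h0 := (determinedBy_rise i b n).cyl_inter γ Set.univ
  simp only [Set.inter_univ] at h0
  rcases h0 with ⟨hγ, h1⟩ | ⟨-, h1⟩
  · rw [h1, quenchedLaw_cyl, quenchedLaw_cyl]
    by_cases hz : γ 0 = z
    · congr 1
      refine Finset.prod_congr rfl fun k hk => ?_
      rw [stepLaw, stepLaw, h (γ k)]
      rw [← hz]
      exact le_of_mem_rise hb hγ (Finset.mem_range.1 hk).le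
    · rw [if_neg hz, zero_mul, zero_mul]
  · rw [h1, measure_empty, measure_empty]

theorem quenchedLaw_translate {d : ℕ} (z : Site d) (ω : Env d) :
    Measure.map (fun (X : Path d) k => X k - z) (quenchedLaw z ω) =
      quenchedLaw 0 (fun x => ω (x + z)) := by
  classical
  have hm : Measurable fun (X : Path d) k => X k - z :=
    measurable_pi_lambda _ fun k => (measurable_coord k).sub_const z
  refine (measure_ext_cyl fun γ n => ?_).symm
  have hset : (fun (X : Path d) k => X k - z) ⁻¹' cyl γ n = cyl (fun k => γ k + z) n := by
    ext X
    simp only [Set.mem_preimage, cyl, Set.mem_ofPred_eq, sub_eq_iff_eq_add]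
  rw [Measure.map_apply hm (measurableSet_cyl γ n), hset, quenchedLaw_cyl, quenchedLaw_cyl]
  congr 1
  · simp only [add_eq_right]
  · refine Finset.prod_congr rfl fun k _ => ?_
    simp only [stepLaw, Measure.finsetSum_apply, Measure.smul_apply]
    refine Finset.sum_congr rfl fun e _ => ?_
    congr 1
    rw [Measure.dirac_apply' _ (measurableSet_singleton _),
      Measure.dirac_apply' _ (measurableSet_singleton _), Set.indicator_apply, Set.indicator_apply]
    simp only [Set.mem_singleton_iff, Pi.one_apply, add_right_comm _ z, add_left_inj]

theorem quenchedLaw_rise_translate {d : ℕ} (i : Fin d) (b : ℕ → ℝ) (n : ℕ) (z : Site d)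
    (ω : Env d) : quenchedLaw z ω (rise i b n) =
      quenchedLaw 0 (fun x => ω (x + z)) (rise i b n) := by
  have hm : Measurable fun (X : Path d) k => X k - z :=
    measurable_pi_lambda _ fun k => (measurable_coord k).sub_const z
  rw [← quenchedLaw_translate, Measure.map_apply hm (measurableSet_rise i b n)]
  congr 1
  ext X
  simp [rise]

/-- This replaces the Markov property, which fails for the annealed law. At a strict record time the
past has stepped only from strictly lower sites, the rising future steps only from the others, and
stationarity moves the new starting point to 0. -/
theorem pathLaw_inter_shift_rise {d : ℕ} (μ : Measure (ProbVec d)) [IsProbabilityMeasure μ]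
    {i : Fin d} {b : ℕ → ℝ} (hb : ∀ k, -1 ≤ b k) (n : ℕ) {m : ℕ} {A : Set (Path d)}
    (hA : DeterminedBy m A) (hAm : ∀ X ∈ A, ∀ k < m, X k i < X m i) :
    pathLaw μ 0 (A ∩ shift m ⁻¹' rise i b n) =
      pathLaw μ 0 A * pathLaw μ 0 (rise i b n) := by
  have hS := measurableSet_rise i b n
  refine hA.measure_inter_eq_mul (measurable_shift m hS) fun γ hγ => ?_
  rw [pathLaw_apply _ _ ((measurableSet_cyl γ m).inter (measurable_shift m hS)),
    pathLaw_apply _ _ (measurableSet_cyl γ m), pathLaw_apply _ _ hS]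
  simp only [quenchedLaw_cyl_inter_shift _ _ _ _ hS]
  rw [lintegral_env_mul μ {y | y i < γ m i}
    (measurable_quenchedLaw_apply 0 (measurableSet_cyl γ m)) (measurable_quenchedLaw_apply _ hS)]
  · congr 1
    simp only [quenchedLaw_rise_translate i b n (γ m)]
    exact (measurePreserving_env_shift μ (γ m)).lintegral_comp (measurable_quenchedLaw_apply 0 hS)
  · intro ω ω' h
    classical
    rw [quenchedLaw_cyl, quenchedLaw_cyl]
    congr 1
    refine Finset.prod_congr rfl fun k hk => ?_
    rw [stepLaw, stepLaw, h (γ k) (hAm γ hγ k (Finset.mem_range.1 hk))]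
  · intro ω ω' h
    exact quenchedLaw_rise_congr hb n (γ m) fun y hy => h y (not_lt.2 hy)

theorem pathLaw_inter_shift_riseForever {d : ℕ} (μ : Measure (ProbVec d))
    [IsProbabilityMeasure μ] {i : Fin d} {b : ℕ → ℝ} (hb : ∀ k, -1 ≤ b k) {m : ℕ}
    {A : Set (Path d)} (hA : DeterminedBy m A) (hAm : ∀ X ∈ A, ∀ k < m, X k i < X m i) :
    pathLaw μ 0 (A ∩ shift m ⁻¹' riseForever i b) =
      pathLaw μ 0 A * pathLaw μ 0 (riseForever i b) := by
  have h1 : Tendsto (fun n => pathLaw μ 0 (A ∩ shift m ⁻¹' rise i b n)) atTop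
      (nhds (pathLaw μ 0 (A ∩ shift m ⁻¹' riseForever i b))) := by
    rw [riseForever, Set.preimage_iInter, Set.inter_iInter]
    refine tendsto_measure_iInter_atTop (fun n => (hA.measurableSet.inter
      (measurable_shift m (measurableSet_rise i b n))).nullMeasurableSet) (fun n n' h => ?_)
      ⟨0, measure_ne_top _ _⟩
    exact Set.inter_subset_inter_right _ (Set.preimage_mono (antitone_rise i b h))
  have h2 : Tendsto (fun n => pathLaw μ 0 A * pathLaw μ 0 (rise i b n)) atTop
      (nhds (pathLaw μ 0 A * pathLaw μ 0 (riseForever i b))) := by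
    refine ENNReal.Tendsto.const_mul ?_ (Or.inr (measure_ne_top _ _))
    exact tendsto_measure_iInter_atTop (fun n => (measurableSet_rise i b n).nullMeasurableSet)
      (antitone_rise i b) ⟨0, measure_ne_top _ _⟩
  simp only [pathLaw_inter_shift_rise μ hb _ hA hAm] at h1
  exact tendsto_nhds_unique h1 h2

/-- The trajectories that reach the level `L` for the first time at time `m`. -/
def firstPassage {d : ℕ} (i : Fin d) (L m : ℕ) : Set (Path d) :=
  {X | (∀ k < m, X k i < L) ∧ (L : ℤ) ≤ X m i}

theorem determinedBy_firstPassage {d : ℕ} (i : Fin d) (L m : ℕ) :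
    DeterminedBy m (firstPassage i L m) := fun _ _ h hX =>
  ⟨fun k hk => h k hk.le ▸ hX.1 k hk, h m le_rfl ▸ hX.2⟩

theorem DeterminedBy.inter {d : ℕ} {m n : ℕ} (h : m ≤ n) {A A' : Set (Path d)}
    (hA : DeterminedBy m A) (hA' : DeterminedBy n A') : DeterminedBy n (A ∩ A') :=
  fun X X' hX hXA => ⟨hA X X' (fun k hk => hX k (hk.trans h)) hXA.1, hA' X X' hX hXA.2⟩

theorem disjoint_firstPassage {d : ℕ} (i : Fin d) (L : ℕ) :
    Pairwise (Function.onFun Disjoint fun m => (firstPassage i L m : Set (Path d))) := by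
  intro m n hmn
  rw [Function.onFun, Set.disjoint_left]
  intro X hm hn
  rcases lt_or_gt_of_ne hmn with h | h
  · exact absurd (hn.1 m h) (not_lt.2 hm.2)
  · exact absurd (hm.1 n h) (not_lt.2 hn.2)

theorem firstPassage_lt {d : ℕ} {i : Fin d} {L m : ℕ} {X : Path d} (hX : X ∈ firstPassage i L m)
    (k : ℕ) (hk : k < m) : X k i < X m i := (hX.1 k hk).trans_le hX.2

/-- The trajectories that belong to `S` from their first passage to the level `L` on. -/
def afterPassage {d : ℕ} (i : Fin d) (L : ℕ) (S : Set (Path d)) : Set (Path d) :=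
  ⋃ m, firstPassage i L m ∩ shift m ⁻¹' S

theorem measurableSet_afterPassage {d : ℕ} (i : Fin d) (L : ℕ) {S : Set (Path d)}
    (hS : MeasurableSet S) : MeasurableSet (afterPassage i L S) :=
  MeasurableSet.iUnion fun m =>
    (determinedBy_firstPassage i L m).measurableSet.inter (measurable_shift m hS)

/-- Summing over the almost surely finite passage time, the future after the passage has the
probability it would have from the origin, whatever the level L. -/
theorem pathLaw_afterPassage {d : ℕ} (μ : Measure (ProbVec d)) [IsProbabilityMeasure μ]
    {i : Fin d} {L : ℕ} {S : Set (Path d)} (hS : MeasurableSet S)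
    (h : ∀ m, pathLaw μ 0 (firstPassage i L m ∩ shift m ⁻¹' S) =
      pathLaw μ 0 (firstPassage i L m) * pathLaw μ 0 S)
    (hL : ∀ᵐ X ∂(pathLaw μ 0), ∃ m, X ∈ firstPassage i L m) :
    pathLaw μ 0 (afterPassage i L S) = pathLaw μ 0 S := by
  have hm := fun m => (determinedBy_firstPassage i L m).measurableSet
  rw [afterPassage, measure_iUnion]
  · simp only [h]
    rw [ENNReal.tsum_mul_right, ← measure_iUnion (disjoint_firstPassage i L) hm]
    have : pathLaw μ 0 (⋃ m, firstPassage i L m) = 1 :=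
      (measure_congr (t := Set.univ) (eventuallyEq_univ.2 (hL.mono fun X hX =>
        Set.mem_iUnion.2 hX))).trans measure_univ
    rw [this, one_mul]
  · intro m n hmn
    exact Disjoint.mono Set.inter_subset_left Set.inter_subset_left (disjoint_firstPassage i L hmn)
  · exact fun m => (hm m).inter (measurable_shift m hS)

/-! ### Counting slow levels -/

open Classical in
/-- A covering estimate: for a monotone `Λ`, the number of `l < M` from which `Λ` grows, up to
some `l' ≤ M`, at least at rate `1 / c` is at most `c (Λ M - Λ L)`. -/
theorem card_filter_fast_le {Λ : ℕ → ℕ} (hΛ : Monotone Λ) {c : ℝ} (hc : 0 ≤ c) {L M : ℕ}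
    (hLM : L ≤ M) :
    (((Finset.Ico L M).filter fun l => ∃ l', l < l' ∧ l' ≤ M ∧
      ((l' : ℝ) - l) ≤ c * ((Λ l' : ℝ) - Λ l)).card : ℝ) ≤ c * ((Λ M : ℝ) - Λ L) := by
  set p : ℕ → Prop := fun l => ∃ l', l < l' ∧ l' ≤ M ∧
      ((l' : ℝ) - l) ≤ c * ((Λ l' : ℝ) - Λ l) with hp
  obtain ⟨n, hn⟩ : ∃ n, n = M - L := ⟨_, rfl⟩
  induction n using Nat.strong_induction_on generalizing L with
  | _ n ih =>
    rcases hLM.eq_or_lt with rfl | hlt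
    · simp
    · by_cases hL : p L
      -- Greedy covering: if L is selected with witness l', the l' - L levels before l' are charged
      -- to the growth of Λ on [L, l'], and the count restarts at l'. Otherwise L is skipped.
      · obtain ⟨l', h1, h2, h3⟩ := hL
        have hsub : (Finset.Ico L M).filter p ⊆
            Finset.Ico L l' ∪ (Finset.Ico l' M).filter p := by
          intro k hk
          simp only [Finset.mem_filter, Finset.mem_union, Finset.mem_Ico] at hk ⊢
          by_cases hkl : k < l'
          · exact Or.inl ⟨hk.1.1, hkl⟩
          · exact Or.inr ⟨⟨not_lt.1 hkl, hk.1.2⟩, hk.2⟩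
        have hcard := (Finset.card_le_card hsub).trans (Finset.card_union_le _ _)
        rw [Nat.card_Ico] at hcard
        have hcard' : (((Finset.Ico L M).filter p).card : ℝ) ≤
            ((l' : ℝ) - L) + ((Finset.Ico l' M).filter p).card := by
          rw [← Nat.cast_sub h1.le]
          exact_mod_cast hcard
        have := ih (M - l') (by omega) h2 rfl
        linarith
      · have hsub : (Finset.Ico L M).filter p ⊆ (Finset.Ico (L + 1) M).filter p := by
          intro k hk
          simp only [Finset.mem_filter, Finset.mem_Ico] at hk ⊢
          refine ⟨⟨?_, hk.1.2⟩, hk.2⟩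
          rcases hk.1.1.eq_or_lt with rfl | h
          · exact absurd hk.2 hL
          · exact h
        have hcard : (((Finset.Ico L M).filter p).card : ℝ) ≤
            ((Finset.Ico (L + 1) M).filter p).card := Nat.cast_le.2 (Finset.card_le_card hsub)
        refine hcard.trans ((ih (M - (L + 1)) (by omega) hlt rfl).trans ?_)
        have : (Λ L : ℝ) ≤ Λ (L + 1) := Nat.cast_le.2 (hΛ L.le_succ)
        gcongr

theorem exists_firstPassage {d : ℕ} {i : Fin d} {L k : ℕ} {X : Path d} (h : (L : ℤ) ≤ X k i) :
    ∃ m ≤ k, X ∈ firstPassage i L m := by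
  classical
  have hex : ∃ m, (L : ℤ) ≤ X m i := ⟨k, h⟩
  exact ⟨Nat.find hex, Nat.find_min' hex h,
    fun j hj => not_le.1 (Nat.find_min hex hj), Nat.find_spec hex⟩

theorem IsNearest.firstPassage_eq {d : ℕ} {i : Fin d} {L m : ℕ} {X : Path d} (hX : IsNearest X)
    (h0 : X 0 = 0) (hm : X ∈ firstPassage i L m) : X m i = L := by
  refine le_antisymm ?_ hm.2
  rcases m with _ | m
  · rw [h0]; simp
  · have h1 := hm.1 m m.lt_succ_self
    have h2 := abs_le.1 (hX.abs_step_le m i)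
    omega

theorem IsNearest.shift {d : ℕ} {X : Path d} (hX : IsNearest X) (m : ℕ) : IsNearest (shift m X) :=
  fun n => hX (m + n)

open Classical in
/-- Up to the passage time `T` of the level `M`, all but `c T` of the levels are either revisited
after their first passage, or are left behind at speed larger than `c`. -/
theorem card_levels_le {d : ℕ} {i : Fin d} {X : Path d} (hX : IsNearest X) (h0 : X 0 = 0) {c : ℝ}
    (hc : 0 ≤ c) {M K T : ℕ} (hT : X ∈ firstPassage i M T) :
    ((M - K : ℕ) : ℝ) ≤
      ((Finset.range (M - K)).filter fun L =>
        X ∈ afterPassage i L (rise i (fun k => c * k) K)).card +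
      ((Finset.range (M - K)).filter fun L =>
        X ∈ afterPassage i L (riseForever i fun _ => 0)ᶜ).card + c * T := by
  -- Λ l is the last time up to T at which the walk is at level l or below. The covering estimate
  -- bounds the number of levels satisfying p by c·T.
  set Λ : ℕ → ℕ := fun l => Nat.findGreatest (fun n => X n i ≤ l) T with hΛ
  have hΛm : Monotone Λ := fun l l' h => Nat.findGreatest_mono_left
    (fun n (hn : X n i ≤ l) => hn.trans (by exact_mod_cast h)) T
  have hbad := card_filter_fast_le hΛm hc (Nat.zero_le M)
  set p : ℕ → Prop := fun l => ∃ l', l < l' ∧ l' ≤ M ∧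
      ((l' : ℝ) - l) ≤ c * ((Λ l' : ℝ) - Λ l) with hp
  have hcover : Finset.range (M - K) ⊆ ((Finset.range (M - K)).filter fun L =>
        X ∈ afterPassage i L (rise i (fun k => c * k) K)) ∪
      ((Finset.range (M - K)).filter fun L =>
        X ∈ afterPassage i L (riseForever i fun _ => 0)ᶜ) ∪ (Finset.Ico 0 M).filter p := by
    intro L hL
    have hLM : L < M - K := Finset.mem_range.1 hL
    by_contra hcon
    simp only [Finset.mem_union, Finset.mem_filter, hL, true_and, Finset.mem_Ico, Nat.zero_le,
      not_or] at hcon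
    obtain ⟨⟨hG, hNF⟩, hp'⟩ := hcon
    have hp' : ¬ p L := fun h => hp' ⟨by omega, h⟩
    have hXT : X T i = M := hX.firstPassage_eq h0 hT
    obtain ⟨m, hmT, hm⟩ := exists_firstPassage (i := i) (L := L) (k := T) (X := X)
      (by rw [hXT]; exact_mod_cast (by omega : L ≤ M))
    have hXm : X m i = L := hX.firstPassage_eq h0 hm
    have hF : shift m X ∈ riseForever i fun _ => 0 := by
      by_contra hF
      exact hNF (Set.mem_iUnion.2 ⟨m, hm, hF⟩)
    have hF' : ∀ n, m < n → (L : ℤ) < X n i := by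
      intro n hn
      have h1 := mem_riseForever.1 hF (n - m) (by omega)
      simp only [shift, Nat.add_sub_cancel' hn.le, add_zero, hXm] at h1
      have : (0 : ℤ) < X n i - L := by exact_mod_cast h1
      omega
    -- Level L is not revisited after its first passage m, so that passage is also its last visit.
    have hΛL : Λ L = m := by
      refine le_antisymm ?_ (Nat.le_findGreatest hmT hXm.le)
      by_contra hlt
      have hne : Λ L ≠ 0 := by omega
      have h1 : X (Λ L) i ≤ L := Nat.findGreatest_of_ne_zero rfl hne
      exact absurd (hF' _ (not_le.1 hlt)) (not_lt.2 h1)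
    refine hG (Set.mem_iUnion.2 ⟨m, hm, fun k hk hkK => ?_⟩)
    -- Since L < M - K, reaching M from L takes more than K steps, so the window of K steps ends
    -- before T.
    have hTm : m + k ≤ T := by
      have h1 := (hX.shift m).abs_sub_le (T - m) i
      simp only [shift, Nat.add_sub_cancel' hmT, add_zero, hXm, hXT] at h1
      have h2 := (abs_le.1 h1).2
      omega
    have hle : X (m + k) i ≤ M := by
      rcases hTm.lt_or_eq with h | h
      · exact (hT.1 _ h).le
      · rw [h, hXT]
    have hgt := hF' (m + k) (by omega)
    obtain ⟨l', hl'⟩ : ∃ l' : ℕ, X (m + k) i = l' := ⟨(X (m + k) i).toNat, by omega⟩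
    have hΛl' : m + k ≤ Λ l' := Nat.le_findGreatest hTm hl'.le
    -- Let l' be the level at time m + k, so Λ l' ≥ m + k. As L does not satisfy p, l' - L > c(Λ l'
    -- - Λ L) ≥ c·k, and the walk has risen faster than c, contradicting `hG`.
    have h1 : ¬ ((l' : ℝ) - L ≤ c * ((Λ l' : ℝ) - Λ L)) := fun h =>
      hp' ⟨l', by omega, by omega, h⟩
    rw [hΛL, not_le] at h1
    change c * k < ((X (m + k) i - X (m + 0) i : ℤ) : ℝ)
    rw [add_zero, hXm, hl']
    push_cast
    refine lt_of_le_of_lt (mul_le_mul_of_nonneg_left ?_ hc) h1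
    have : ((m + k : ℕ) : ℝ) ≤ Λ l' := Nat.cast_le.2 hΛl'
    push_cast at this
    linarith
  have hcard := (Finset.card_le_card hcover).trans ((Finset.card_union_le _ _).trans
    (Nat.add_le_add_right (Finset.card_union_le _ _) _))
  rw [Finset.card_range] at hcard
  have hcard' := (Nat.cast_le (α := ℝ)).2 hcard
  rw [Nat.cast_add, Nat.cast_add] at hcard'
  refine hcard'.trans (add_le_add le_rfl (hbad.trans (mul_le_mul_of_nonneg_left ?_ hc)))
  have h1 : (Λ M : ℝ) ≤ T := Nat.cast_le.2 (Nat.findGreatest_le T)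
  have h2 : (0 : ℝ) ≤ Λ 0 := Nat.cast_nonneg _
  linarith

/-! ### Ballisticity -/

theorem tendsto_pathLaw_rise {d : ℕ} (μ : Measure (ProbVec d)) [IsProbabilityMeasure μ]
    (i : Fin d) (b : ℕ → ℝ) : Tendsto (fun n => (pathLaw μ 0).real (rise i b n)) atTop
      (nhds ((pathLaw μ 0).real (riseForever i b))) :=
  (ENNReal.tendsto_toReal (measure_ne_top _ _)).comp
    (tendsto_measure_iInter_atTop (fun n => (measurableSet_rise i b n).nullMeasurableSet)
      (antitone_rise i b) ⟨0, measure_ne_top _ _⟩)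

/-- If level L were missed with probability a, the expected time below L up to N would be at least
N·a, while it is bounded by L/κ for every N. -/
theorem ae_exists_firstPassage {d : ℕ} (hd : 0 < d) {μ : Measure (ProbVec d)}
    [IsProbabilityMeasure μ] (hε : epsilon μ ∈ Set.Ioo (0 : ℝ) 1)
    (hκ : 0 < driftBound μ (e1 hd)) (L : ℕ) :
    ∀ᵐ X ∂(pathLaw μ 0), ∃ m, X ∈ firstPassage ⟨0, hd⟩ L m := by
  set i : Fin d := ⟨0, hd⟩ with hi
  set a := (pathLaw μ 0).real {X | ∀ k, X k i < L} with ha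
  have hN : ∀ N : ℕ, driftBound μ (e1 hd) * (N * a) ≤ L := by
    intro N
    refine le_trans (mul_le_mul_of_nonneg_left ?_ hκ.le) (driftBound_mul_sum_le hd hε hκ L N)
    have : ∀ n ∈ Finset.range N, a ≤ (pathLaw μ 0).real {X | ∀ k ≤ n, X k i < L} :=
      fun n _ => measureReal_mono fun X hX k _ => hX k
    have := Finset.card_nsmul_le_sum _ _ _ this
    rwa [Finset.card_range, nsmul_eq_mul] at this
  have ha0 : a = 0 := by
    by_contra h
    have hpos : 0 < a := lt_of_le_of_ne measureReal_nonneg (Ne.symm h)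
    obtain ⟨N, hN'⟩ := exists_nat_gt ((L : ℝ) / (driftBound μ (e1 hd) * a))
    rw [div_lt_iff₀ (mul_pos hκ hpos)] at hN'
    have := hN N
    nlinarith
  rw [measureReal_eq_zero_iff] at ha0
  filter_upwards [measure_eq_zero_iff_ae_notMem.1 ha0] with X hX
  have hX : ¬ ∀ k, X k i < L := hX
  push Not at hX
  obtain ⟨k, hk⟩ := hX
  obtain ⟨m, -, hm⟩ := exists_firstPassage hk
  exact ⟨m, hm⟩

/-- The annealed walk has a positive probability of never returning to its starting level. -/
theorem pathLaw_riseForever_zero_pos {d : ℕ} (hd : 0 < d) {μ : Measure (ProbVec d)}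
    [IsProbabilityMeasure μ] (hε : epsilon μ ∈ Set.Ioo (0 : ℝ) 1)
    (hκ : 0 < driftBound μ (e1 hd)) :
    0 < (pathLaw μ 0).real (riseForever ⟨0, hd⟩ fun _ => 0) := by
  set i : Fin d := ⟨0, hd⟩ with hi
  have hback : 0 < (pathLaw μ 0).real (riseForever i fun _ => -1) := by
    obtain ⟨q, hq, hle⟩ := exists_backtrack_bound hd hε hκ
    refine lt_of_lt_of_le (sub_pos.2 hq) (ge_of_tendsto' (tendsto_pathLaw_rise μ i _) fun R => ?_)
    have hm : MeasurableSet {X : Path d | ∀ k ≤ R, 0 ≤ X k i} :=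
      measurableSet_forall_le {y : Site d | 0 ≤ y i} R
    have h1 : (pathLaw μ 0).real {X | ∀ k ≤ R, 0 ≤ X k i} ≤
        (pathLaw μ 0).real (rise i (fun _ => -1) R) := by
      refine ENNReal.toReal_mono (measure_ne_top _ _) (measure_mono_ae ?_)
      filter_upwards [pathLaw_start μ 0] with X h0 hX k _ hkR
      have : 0 ≤ X k i := hX k hkR
      rw [h0]
      simp only [Pi.zero_apply, sub_zero]
      exact_mod_cast (by omega : (-1 : ℤ) < X k i)
    have h2 := hle R
    rw [probReal_compl_eq_one_sub hm] at h2
    linarith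
  have hfirst : 0 < (pathLaw μ 0).real (firstPassage i 1 1) := by
    have hd' : (0 : ℝ) < d := Nat.cast_pos.2 hd
    rw [pathLaw_real_apply μ 0 (determinedBy_firstPassage i 1 1).measurableSet]
    refine lt_of_lt_of_le (by positivity : 0 < 1 / (4 * (d : ℝ))) ?_
    have hint : Integrable (fun ω => (quenchedLaw 0 ω).real (firstPassage i 1 1)) (envLaw μ) :=
      Integrable.of_bound (measurable_quenchedLaw_apply 0
        (determinedBy_firstPassage i 1 1).measurableSet).ennreal_toReal.aestronglyMeasurable 1
        (ae_of_all _ fun ω => by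
          rw [Real.norm_of_nonneg measureReal_nonneg]; exact measureReal_le_one)
    have := integral_mono_ae (μ := envLaw μ) (integrable_const (1 / (4 * (d : ℝ)))) hint (by
      filter_upwards [ae_env (ae_elliptic hd hε)] with ω hω
      have hl : l1norm (Pi.single i 1 : Site d) = 1 := by
        rw [l1norm, Finset.sum_eq_single i]
        · simp
        · intro k _ hk; simp [hk]
        · simp
      set e : V d := ⟨Pi.single i 1, hl⟩
      refine (hω 0 e).trans ?_
      have h1 : quenchedLaw 0 ω {X | X 1 ∈ {y : Site d | 1 ≤ y i}} ≤
          quenchedLaw 0 ω (firstPassage i 1 1) := by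
        refine measure_mono_ae ?_
        filter_upwards [quenchedLaw_start 0 ω] with X h0 hX
        refine ⟨fun k hk => ?_, hX⟩
        rw [Nat.lt_one_iff.1 hk, h0]
        simp
      rw [quenchedLaw_one] at h1
      have h2 : ENNReal.ofReal ((ω 0).1 e) ≤ stepLaw ω 0 {y : Site d | 1 ≤ y i} := by
        simp only [stepLaw, Measure.finsetSum_apply, Measure.smul_apply, smul_eq_mul]
        refine le_trans (le_of_eq ?_) (Finset.single_le_sum
          (f := fun e : V d => ENNReal.ofReal ((ω 0).1 e) *
            Measure.dirac (0 + e.1) {y : Site d | 1 ≤ y i})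
          (fun _ _ => zero_le) (Finset.mem_univ e))
        have : (0 : Site d) + e.1 ∈ {y : Site d | 1 ≤ y i} := by simp [e]
        rw [Measure.dirac_apply_of_mem this, mul_one]
      exact (ENNReal.ofReal_le_iff_le_toReal (measure_ne_top _ _)).1 (h2.trans h1))
    simpa using this
  -- Stepping to level 1 at once and never falling below it afterwards keeps the walk above level 0;
  -- by independence the two probabilities multiply.
  have hmul := pathLaw_inter_shift_riseForever μ (i := i) (b := fun _ => -1) (fun _ => le_rfl)
    (determinedBy_firstPassage i 1 1) fun X hX => firstPassage_lt hX
  have hsub : pathLaw μ 0 (firstPassage i 1 1 ∩ shift 1 ⁻¹' riseForever i fun _ => -1) ≤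
      pathLaw μ 0 (riseForever i fun _ => 0) := by
    refine measure_mono_ae ?_
    filter_upwards [pathLaw_start μ 0] with X h0 hX
    refine mem_riseForever.2 fun k hk => ?_
    have h1 : (1 : ℤ) ≤ X 1 i := hX.1.2
    rw [h0]
    simp only [Pi.zero_apply, sub_zero]
    rcases Nat.eq_or_lt_of_le hk with h | h
    · rw [← h]
      exact_mod_cast (by omega : (0 : ℤ) < X 1 i)
    · have h2 := mem_riseForever.1 hX.2 (k - 1) (by omega)
      simp only [shift, add_zero] at h2
      rw [Nat.add_sub_cancel' h.le] at h2
      have h3 : (-1 : ℤ) < X k i - X 1 i := by exact_mod_cast h2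
      exact_mod_cast (by omega : (0 : ℤ) < X k i)
  refine lt_of_lt_of_le (mul_pos hfirst hback) ?_
  have := ENNReal.toReal_mono (measure_ne_top _ _) hsub
  rwa [hmul, ENNReal.toReal_mul] at this

/-- Comparison of the probabilities of never returning and of rising at speed `c`. -/
theorem sub_pathLaw_rise_le {d : ℕ} (hd : 0 < d) {μ : Measure (ProbVec d)}
    [IsProbabilityMeasure μ] (hε : epsilon μ ∈ Set.Ioo (0 : ℝ) 1)
    (hκ : 0 < driftBound μ (e1 hd)) {c : ℝ} (hc : 0 ≤ c) {K : ℕ} (hK : 0 < K) :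
    (pathLaw μ 0).real (riseForever ⟨0, hd⟩ fun _ => 0) -
      (pathLaw μ 0).real (rise ⟨0, hd⟩ (fun k => c * k) K) ≤ 2 * c / driftBound μ (e1 hd) := by
  classical
  set i : Fin d := ⟨0, hd⟩ with hi
  set κ := driftBound μ (e1 hd) with hκdef
  -- This leaves M - K = K levels to count against an expected passage time of at most 2K/κ, so K
  -- cancels and the bound is uniform in K.
  set M := 2 * K with hM
  set S := rise i (fun k => c * k) K with hS
  set S' : Set (Path d) := (riseForever i fun _ => 0)ᶜ with hS'
  have hSm : MeasurableSet S := measurableSet_rise i _ K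
  have hSm' : MeasurableSet S' := (measurableSet_riseForever i _).compl
  have hae := ae_exists_firstPassage hd hε hκ
  have hPS : ∀ L, pathLaw μ 0 (afterPassage i L S) = pathLaw μ 0 S := fun L =>
    pathLaw_afterPassage μ hSm (fun m => pathLaw_inter_shift_rise μ
      (fun k => le_trans (by norm_num) (mul_nonneg hc k.cast_nonneg)) K
      (determinedBy_firstPassage i L m) fun X hX => firstPassage_lt hX) (hae L)
  have hPS' : ∀ L, pathLaw μ 0 (afterPassage i L S') = pathLaw μ 0 S' := fun L =>
    pathLaw_afterPassage μ hSm' (fun m => by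
      have hF := measurableSet_riseForever i fun _ => (0 : ℝ)
      have h1 := pathLaw_inter_shift_riseForever μ (i := i) (b := fun _ => 0)
        (fun _ => by norm_num) (determinedBy_firstPassage i L m) fun X hX => firstPassage_lt hX
      -- The event of returning is not of rising type; its product formula follows from that of the
      -- complement by subtraction.
      have hfp := measure_inter_add_sdiff (μ := pathLaw μ 0) (firstPassage i L m)
        (measurable_shift m hF)
      have hone : pathLaw μ 0 (firstPassage i L m) *
          pathLaw μ 0 (riseForever i fun _ => 0) + pathLaw μ 0 (firstPassage i L m) *
          pathLaw μ 0 S' = pathLaw μ 0 (firstPassage i L m) := by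
        rw [← mul_add, hS', measure_add_measure_compl hF, measure_univ, mul_one]
      rw [h1] at hfp
      rw [hS', Set.preimage_compl, ← Set.sdiff_eq]
      exact (ENNReal.add_right_inj (by finiteness)).1 (hfp.trans hone.symm)) (hae L)
  -- The passage time of level M, as a sum of indicators whose expectations `driftBound_mul_sum_le`
  -- controls.
  set τ : Path d → ℝ≥0∞ := fun X =>
    ∑' n, {X : Path d | ∀ k ≤ n, X k i < M}.indicator 1 X with hτ
  have hτm : ∀ n, MeasurableSet {X : Path d | ∀ k ≤ n, X k i < M} := fun n =>
    measurableSet_forall_le {y : Site d | y i < M} n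
  have hpath : ∀ᵐ X ∂(pathLaw μ 0), ((M - K : ℕ) : ℝ≥0∞) ≤
      (∑ L ∈ Finset.range (M - K), (afterPassage i L S).indicator 1 X) +
      (∑ L ∈ Finset.range (M - K), (afterPassage i L S').indicator 1 X) +
      ENNReal.ofReal c * τ X := by
    filter_upwards [pathLaw_start μ 0, pathLaw_nearest μ 0, hae M] with X h0 hX hm
    obtain ⟨T, hT⟩ := hm
    have hdet := card_levels_le hX h0 hc (K := K) hT
    have hτX : (T : ℝ≥0∞) ≤ τ X := by
      refine le_trans (le_of_eq ?_) (ENNReal.sum_le_tsum (Finset.range T))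
      rw [Finset.sum_congr rfl fun n hn => Set.indicator_of_mem
        (show X ∈ {X : Path d | ∀ k ≤ n, X k i < M} from fun k hk =>
          hT.1 k (hk.trans_lt (Finset.mem_range.1 hn))) 1]
      simp
    have hcount : ∀ A : ℕ → Set (Path d),
        ∑ L ∈ Finset.range (M - K), (A L).indicator (1 : Path d → ℝ≥0∞) X =
          (((Finset.range (M - K)).filter fun L => X ∈ A L).card : ℝ≥0∞) := fun A => by
      simp only [Set.indicator_apply, Pi.one_apply]
      rw [Finset.sum_boole]
    rw [hcount, hcount]
    refine le_trans ?_ (add_le_add le_rfl (mul_le_mul_right hτX _))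
    have h1 := ENNReal.ofReal_le_ofReal hdet
    rwa [ENNReal.ofReal_natCast, ENNReal.ofReal_add (by positivity) (by positivity),
      ENNReal.ofReal_add (by positivity) (by positivity), ENNReal.ofReal_natCast,
      ENNReal.ofReal_natCast, ENNReal.ofReal_mul hc, ENNReal.ofReal_natCast] at h1
  have hτint : ∫⁻ X, τ X ∂(pathLaw μ 0) ≤ ENNReal.ofReal (M / κ) := by
    rw [lintegral_tsum fun n => (measurable_one.indicator (hτm n)).aemeasurable]
    simp only [lintegral_indicator_one (hτm _)]
    rw [ENNReal.tsum_eq_iSup_nat]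
    refine iSup_le fun N => ?_
    have h1 := driftBound_mul_sum_le hd hε hκ M N
    rw [mul_comm, ← le_div_iff₀ hκ] at h1
    refine le_trans (le_of_eq ?_) (ENNReal.ofReal_le_ofReal h1)
    rw [ENNReal.ofReal_sum_of_nonneg fun _ _ => measureReal_nonneg]
    exact Finset.sum_congr rfl fun n _ => (ofReal_measureReal).symm
  have hint := lintegral_mono_ae hpath
  have hm1 : ∀ L, Measurable ((afterPassage i L S).indicator (1 : Path d → ℝ≥0∞)) := fun L =>
    measurable_one.indicator (measurableSet_afterPassage i L hSm)
  have hm2 : ∀ L, Measurable ((afterPassage i L S').indicator (1 : Path d → ℝ≥0∞)) := fun L =>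
    measurable_one.indicator (measurableSet_afterPassage i L hSm')
  rw [lintegral_add_left (f := fun X =>
      (∑ L ∈ Finset.range (M - K), (afterPassage i L S).indicator 1 X) +
      (∑ L ∈ Finset.range (M - K), (afterPassage i L S').indicator 1 X))
      ((Finset.measurable_fun_sum _ fun L _ => hm1 L).add
      (Finset.measurable_fun_sum _ fun L _ => hm2 L)),
    lintegral_add_left (Finset.measurable_fun_sum _ fun L _ => hm1 L),
    lintegral_finsetSum _ fun L _ => hm1 L, lintegral_finsetSum _ fun L _ => hm2 L,
    lintegral_const_mul' _ _ ENNReal.ofReal_ne_top] at hint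
  simp only [lintegral_indicator_one (measurableSet_afterPassage i _ hSm),
    lintegral_indicator_one (measurableSet_afterPassage i _ hSm'), hPS, hPS', lintegral_const,
    measure_univ, mul_one, Finset.sum_const, Finset.card_range, nsmul_eq_mul] at hint
  have hint2 := hint.trans (add_le_add le_rfl (mul_le_mul_right hτint (ENNReal.ofReal c)))
  have hMK : M - K = K := by omega
  rw [hMK] at hint2
  have hreal := ENNReal.toReal_mono (by finiteness) hint2
  rw [ENNReal.toReal_add (by finiteness) (by finiteness),
    ENNReal.toReal_add (by finiteness) (by finiteness), ENNReal.toReal_mul, ENNReal.toReal_mul,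
    ENNReal.toReal_mul, ENNReal.toReal_natCast, ENNReal.toReal_ofReal hc,
    ENNReal.toReal_ofReal (by positivity)] at hreal
  change (K : ℝ) ≤ K * (pathLaw μ 0).real S + K * (pathLaw μ 0).real S' + c * (M / κ) at hreal
  rw [hS', probReal_compl_eq_one_sub (measurableSet_riseForever i _), hM] at hreal
  have hK' : (0 : ℝ) < K := Nat.cast_pos.2 hK
  push_cast at hreal
  have h2 : c * (2 * K / κ) = K * (2 * c / κ) := by ring
  rw [h2] at hreal
  refine le_of_mul_le_mul_left ?_ hK'
  linarith

/-- With p the probability of never returning, c = κp/4 makes the loss 2c/κ equal to p/2, uniformly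
in K, and K can tend to infinity. -/
theorem exists_riseForever_pos {d : ℕ} (hd : 0 < d) {μ : Measure (ProbVec d)}
    [IsProbabilityMeasure μ] (hε : epsilon μ ∈ Set.Ioo (0 : ℝ) 1)
    (hκ : 0 < driftBound μ (e1 hd)) :
    ∃ c : ℝ, 0 < c ∧ 0 < (pathLaw μ 0).real (riseForever ⟨0, hd⟩ fun k => c * k) := by
  have hp := pathLaw_riseForever_zero_pos hd hε hκ
  set p := (pathLaw μ 0).real (riseForever ⟨0, hd⟩ fun _ => 0) with hpdef
  set c := driftBound μ (e1 hd) * p / 4 with hc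
  have hc0 : 0 < c := by positivity
  refine ⟨c, hc0, lt_of_lt_of_le (half_pos hp) ?_⟩
  refine ge_of_tendsto (tendsto_pathLaw_rise μ _ _) (eventually_atTop.2 ⟨1, fun K hK => ?_⟩)
  have h1 := sub_pathLaw_rise_le hd hε hκ hc0.le (K := K) hK
  have h2 : 2 * c / driftBound μ (e1 hd) = p / 2 := by rw [hc]; field_simp; norm_num
  rw [h2] at h1
  linarith

theorem exists_determinedBy_of_mem_measurableCylinders {d : ℕ} {t : Set (Path d)}
    (ht : t ∈ measurableCylinders fun _ : ℕ => Site d) : ∃ n, DeterminedBy n t := by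
  obtain ⟨I, S, -, rfl⟩ := (mem_measurableCylinders t).1 ht
  refine ⟨I.sup id, fun X X' h hX => ?_⟩
  rw [mem_cylinder] at hX ⊢
  have : I.restrict X' = I.restrict X :=
    funext fun k => (h k (Finset.le_sup (f := id) k.2)).symm
  rwa [this]

/-- Almost surely, the walk rises forever at a positive speed from some time on. -/
theorem ae_exists_shift_riseForever {d : ℕ} (hd : 0 < d) {μ : Measure (ProbVec d)}
    [IsProbabilityMeasure μ] (hε : epsilon μ ∈ Set.Ioo (0 : ℝ) 1)
    (hκ : 0 < driftBound μ (e1 hd)) : ∃ c : ℝ, 0 < c ∧ ∀ᵐ X ∂(pathLaw μ 0),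
      ∃ m, shift m X ∈ riseForever ⟨0, hd⟩ fun k => c * k := by
  obtain ⟨c, hc, hq⟩ := exists_riseForever_pos hd hε hκ
  refine ⟨c, hc, ?_⟩
  set i : Fin d := ⟨0, hd⟩ with hi
  set S : Set (Path d) := riseForever i fun k => c * k with hS
  have hSm : MeasurableSet S := measurableSet_riseForever i _
  set E : Set (Path d) := ⋃ m, shift m ⁻¹' S with hE
  have hEm : MeasurableSet E := MeasurableSet.iUnion fun m => measurable_shift m hSm
  -- Whatever happened up to time n, the first passage of level n + 1 comes later, since steps are
  -- nearest-neighbour; from there, rising forever has its full probability independently of A.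
  have key : ∀ (n : ℕ) (A : Set (Path d)), DeterminedBy n A →
      pathLaw μ 0 A * pathLaw μ 0 S ≤ pathLaw μ 0 (A ∩ E) := by
    intro n A hA
    have hfp := fun m => (determinedBy_firstPassage i (n + 1) m).measurableSet
    have hdisj : ∀ B : ℕ → Set (Path d), Pairwise (Function.onFun Disjoint fun m =>
        (A ∩ firstPassage i (n + 1) m) ∩ B m) := fun B m m' hmm' =>
      Disjoint.mono (Set.inter_subset_left.trans Set.inter_subset_right)
        (Set.inter_subset_left.trans Set.inter_subset_right)
        (disjoint_firstPassage i (n + 1) hmm')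
    have h1 : pathLaw μ 0 A = ∑' m, pathLaw μ 0 (A ∩ firstPassage i (n + 1) m) := by
      rw [← measure_iUnion (by simpa using hdisj fun _ => Set.univ)
        fun m => hA.measurableSet.inter (hfp m)]
      refine measure_congr ?_
      filter_upwards [ae_exists_firstPassage hd hε hκ (n + 1)] with X hX
      refine propext ⟨fun h => ?_, fun h => ?_⟩
      · obtain ⟨m, hm⟩ := hX
        exact Set.mem_iUnion.2 ⟨m, h, hm⟩
      · obtain ⟨m, hm⟩ := Set.mem_iUnion.1 h
        exact hm.1
    have h2 : ∀ m, pathLaw μ 0 (A ∩ firstPassage i (n + 1) m) * pathLaw μ 0 S ≤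
        pathLaw μ 0 ((A ∩ firstPassage i (n + 1) m) ∩ shift m ⁻¹' S) := by
      intro m
      by_cases hm : n ≤ m
      · exact (pathLaw_inter_shift_riseForever μ
          (fun k => le_trans (by norm_num) (mul_nonneg hc.le k.cast_nonneg))
          (hA.inter hm (determinedBy_firstPassage i (n + 1) m))
          fun X hX => firstPassage_lt hX.2).ge
      · have : pathLaw μ 0 (A ∩ firstPassage i (n + 1) m) = 0 := by
          refine measure_eq_zero_iff_ae_notMem.2 ?_
          filter_upwards [pathLaw_start μ 0, pathLaw_nearest μ 0] with X h0 hX hXA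
          have h3 := (abs_le.1 (hX.abs_sub_le m i)).2
          have h4 : ((n + 1 : ℕ) : ℤ) ≤ X m i := hXA.2.2
          rw [h0] at h3
          simp only [Pi.zero_apply, sub_zero] at h3
          omega
        rw [this, zero_mul]
        exact zero_le
    rw [h1, ← ENNReal.tsum_mul_right]
    refine (ENNReal.tsum_le_tsum h2).trans ?_
    rw [← measure_iUnion (hdisj fun m => shift m ⁻¹' S)
      fun m => (hA.measurableSet.inter (hfp m)).inter (measurable_shift m hSm)]
    refine measure_mono (Set.iUnion_subset fun m X hX => ⟨hX.1.1, Set.mem_iUnion.2 ⟨m, hX.2⟩⟩)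
  -- A zero-one argument: approximating the complement of E by an event t determined by finitely
  -- many coordinates, `key` gives P(t)·P(S) ≤ P(t ∩ E), and the right-hand side is small.
  have hzero : pathLaw μ 0 Eᶜ * pathLaw μ 0 S = 0 := by
    refine le_antisymm (le_of_forall_pos_le_add fun ε hε => ?_) zero_le
    rw [zero_add]
    obtain ⟨t, ht, hlt⟩ := exists_measure_symmDiff_lt_of_generateFrom_isSetRing
      (μ := pathLaw μ 0) (C := measurableCylinders fun _ : ℕ => Site d)
      isSetRing_measurableCylinders
      ⟨{Set.univ}, Set.countable_singleton _, by simpa using univ_mem_measurableCylinders (fun _ : ℕ => Site d), by simp⟩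
      generateFrom_measurableCylinders.symm hEm.compl (ENNReal.half_pos hε.ne')
    obtain ⟨n, hn⟩ := exists_determinedBy_of_mem_measurableCylinders ht
    have h1 : pathLaw μ 0 (t ∩ E) ≤ ε / 2 := by
      refine le_trans (measure_mono fun X hX => ?_) hlt.le
      exact Or.inl ⟨hX.1, fun h => h hX.2⟩
    have h2 : pathLaw μ 0 Eᶜ ≤ pathLaw μ 0 t + ε / 2 := by
      refine le_trans (measure_mono (t := t ∪ symmDiff t Eᶜ) fun X hX => ?_)
        ((measure_union_le _ _).trans (add_le_add le_rfl hlt.le))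
      by_cases hXt : X ∈ t
      · exact Or.inl hXt
      · exact Or.inr (Or.inr ⟨hX, hXt⟩)
    calc pathLaw μ 0 Eᶜ * pathLaw μ 0 S ≤ (pathLaw μ 0 t + ε / 2) * pathLaw μ 0 S := by gcongr
      _ = pathLaw μ 0 t * pathLaw μ 0 S + ε / 2 * pathLaw μ 0 S := add_mul _ _ _
      _ ≤ ε / 2 + ε / 2 * 1 := by
          gcongr
          · exact (key n t hn).trans h1
          · exact prob_le_one
      _ = ε := by rw [mul_one, ENNReal.add_halves]
  have hEc : pathLaw μ 0 Eᶜ = 0 := by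
    refine (mul_eq_zero.1 hzero).resolve_right fun h => ?_
    rw [measureReal_def, h] at hq
    exact lt_irrefl _ hq
  filter_upwards [measure_eq_zero_iff_ae_notMem.1 hEc] with X hX
  simpa [hE] using hX

theorem liminf_pos_of_riseForever {u : ℕ → ℤ} {c : ℝ} (hc : 0 < c) {m : ℕ}
    (h : ∀ k, 0 < k → c * k < ((u (m + k) - u m : ℤ) : ℝ)) :
    (0 : EReal) < liminf (fun n : ℕ => (((u n : ℝ) / (n : ℝ) : ℝ) : EReal)) atTop := by
  have hpos : (0 : EReal) < ((c / 2 : ℝ) : EReal) := by exact_mod_cast half_pos hc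
  refine hpos.trans_le (le_liminf_of_le (by isBoundedDefault) ?_)
  -- From n > N on, the constant c·m - u m is below (c/2)·n, so half of the speed c survives.
  obtain ⟨N, hN⟩ := exists_nat_gt ((c * m - u m) / (c / 2))
  refine eventually_atTop.2 ⟨max (N + 1) (m + 1), fun n hn => ?_⟩
  have hn1 : N + 1 ≤ n := (le_max_left _ _).trans hn
  have hn2 : m + 1 ≤ n := (le_max_right _ _).trans hn
  have hn0 : (0 : ℝ) < n := Nat.cast_pos.2 (by omega)
  have h1 := h (n - m) (by omega)
  rw [Nat.add_sub_cancel' (by omega), Nat.cast_sub (by omega)] at h1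
  push_cast at h1
  rw [div_lt_iff₀ (half_pos hc)] at hN
  have h2 : (N : ℝ) ≤ n := Nat.cast_le.2 (by omega)
  refine EReal.coe_le_coe_iff.2 ((le_div_iff₀ hn0).2 ?_)
  nlinarith

theorem ballistic_of_driftBound_pos {d : ℕ} (hd : 0 < d) {μ : Measure (ProbVec d)}
    [IsProbabilityMeasure μ] (hε : epsilon μ ∈ Set.Ioo (0 : ℝ) 1)
    (hκ : 0 < driftBound μ (e1 hd)) : Ballistic μ (e1 hd) := by
  obtain ⟨c, hc, h⟩ := ae_exists_shift_riseForever hd hε hκ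
  refine (ae_annealedLaw h).mono fun z hz => ?_
  obtain ⟨m, hm⟩ := hz
  simp only [dot_e1]
  exact liminf_pos_of_riseForever (u := fun n => z.2 n ⟨0, hd⟩) hc (m := m) fun k hk =>
    mem_riseForever.1 hm k hk

end RWRE


theorem theorem2 (d : ℕ) (hd : 2 ≤ d)
    (μ : MeasureTheory.Measure (RWRE.ProbVec d)) [MeasureTheory.IsProbabilityMeasure μ]
    (hε : RWRE.epsilon μ ∈ Set.Ioo (0 : ℝ) 1)
    (hdrift : 4 * (d : ℝ) * RWRE.sigma μ ^ 2 * (1 + 9 * RWRE.epsilon μ) <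
      RWRE.avgDrift μ (RWRE.e1 (by omega : 0 < d))) :
    RWRE.KalikowCondition μ (RWRE.e1 (by omega : 0 < d)) ∧
      RWRE.Ballistic μ (RWRE.e1 (by omega : 0 < d)) :=
  have hκ : 0 < RWRE.driftBound μ (RWRE.e1 (by omega : 0 < d)) := sub_pos.2 hdrift
  ⟨RWRE.kalikowCondition_of_driftBound_pos _ hε hκ, RWRE.ballistic_of_driftBound_pos _ hε hκ⟩
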